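/- Let $F$ be a complete complex operator space with operator space dual $E=F^*$. For a cardinal $n\ge 1$ write $M_n=B(\ell^2(n))$ and $M_n(E)=CB(F,M_n)$ (matrices $x=[x_{ij}]$ over $E$ whose finite submatrices are uniformly bounded, acting by $x(\varphi)=[x_{ij}(\varphi)]$), with its weak* topology. Fix an infinite cardinal $\kappa$. Let $K=(K_n)_{1\le n\le\kappa}$, $K_n\subseteq M_n(E)$, be a nc compact convex set: each $K_n$ is weak* compact; $\sum_i\alpha_i x_i\alpha_i^*\in K_n$ for every bounded family $x_i\in K_{n_i}$ and all isometries $\alpha_i\in M_{n,n_i}$ with $\sum_i\alpha_i\alpha_i^*=1_n$; and $\beta^*x\beta\in K_m$ for every $x\in K_n$ and every isometry $\beta\in M_{n,m}$. Suppose that $K$ is nc spanning, that is, for some $n$ every element of $M_n(E)$ is a finite sum $\sum_k a_k^*x_kb_k$ with scalar matrices $a_k,b_k$, where either $x_k\in K_{n_k}$ and $a_k,b_k\in M_{n_k,n}$ (rectangular sense) or $x_k\in K_n$ and $a_k,b_k\in M_n$ (square sense). For a Hilbert space $\ell^2(N)$, a continuous nc affine function $f:K\to M_N$ is a family of maps $f:K_n\to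 M_n(M_N)$ that are continuous for the weak* topologies and satisfy $f(\sum_i\alpha_ix_i\alpha_i^*)=\sum_i\alpha_if(x_i)\alpha_i^*$ and $f(\beta^*x\beta)=\beta^*f(x)\beta$ for all data as above. Let $\mathbb A(K)$ be the space of these functions for $N=1$, with matrix norms $\|[f_{kl}]\|=\sup\{\|[f_{kl}(x)]\| : x\in K_n,\ 1\le n\le\kappa\}$, and let $\theta:F\to\mathbb A(K)$ be the restriction map, $\theta(\varphi)(x)=[x_{ij}(\varphi)]$ for $x=[x_{ij}]\in K_n$. Then: 1. $\theta$ is completely bounded and one-to-one. 2. $\theta$ is a bicontinuous linear isomorphism of $F$ onto $\mathbb A(K)$ if and only if $\theta(F)=\mathbb A(K)$, i.e. every $f\in\mathbb A(K)$ is the restriction of some element of $F$. 3. For every infinite cardinal $N$ (in particular for $N=\aleph_0$), the following are equivalent: (a) $\theta$ is a complete isomorphism, i.e. a bijection such that $\theta$ and $\theta^{-1}$ are completely bounded; (b) for every continuous nc affine $f:K\to M_N$ there is a weak* continuous completely bounded linear map $\Psi:E\to M_N$ with $f(x)=[\Psi(x_{ij})]$ for all $x=[x_{ij}]\in K_n$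 and all $n$; (c) for every continuous nc affine $f:K\to M_N$ there is $[\psi_{kl}]\in M_N(F)$ (a matrix over $F$ whose finite submatrices have uniformly bounded norms) with $f(x)=[x(\psi_{kl})]$ for all $x\in K_n$ and all $n$. -/

import Mathlib

open scoped ENNReal NNReal InnerProductSpace Topology

universe u v w

noncomputable section

namespace NCReg

/-! ### Hilbert spaces, matrices of operators -/

/-- The Hilbert space `ℓ²(ι)`. -/
abbrev L2 (ι : Type*) : Type _ := lp (fun _ : ι => ℂ) 2

/-- The Hilbert space direct sum `ℓ²(N) ⊗ H` of copies of `H` indexed by `N`. -/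
abbrev L2Sum (N : Type*) (H : Type*) [NormedAddCommGroup H] : Type _ := lp (fun _ : N => H) 2

open Classical in
/-- The standard basis vector `e i` of `ℓ²(ι)`. -/
def stdVec {ι : Type*} (i : ι) : L2 ι := lp.single 2 i (1 : ℂ)

section Operators

variable {H H' : Type*} [NormedAddCommGroup H] [InnerProductSpace ℂ H]
  [NormedAddCommGroup H'] [InnerProductSpace ℂ H']

/-- The operator on the `n`-fold Hilbert space sum `H ⊕ ⋯ ⊕ H` with operator matrix `[T i j]`. -/
def blockOp {n : ℕ} (T : Matrix (Fin n) (Fin n) (H →L[ℂ] H)) :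
    PiLp 2 (fun _ : Fin n => H) →L[ℂ] PiLp 2 (fun _ : Fin n => H) :=
  ((PiLp.continuousLinearEquiv 2 ℂ (fun _ : Fin n => H)).symm :
      (∀ _ : Fin n, H) →L[ℂ] PiLp 2 (fun _ : Fin n => H)) ∘L
    ContinuousLinearMap.pi (fun i => ∑ j, T i j ∘L PiLp.proj 2 (fun _ : Fin n => H) j)

theorem blockOp_apply {n : ℕ} (T : Matrix (Fin n) (Fin n) (H →L[ℂ] H))
    (ξ : PiLp 2 (fun _ : Fin n => H)) (i : Fin n) :
    blockOp T ξ i = ∑ j, T i j (ξ j) := by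
  simp [blockOp]

theorem blockOp_zero {n : ℕ} : blockOp (0 : Matrix (Fin n) (Fin n) (H →L[ℂ] H)) = 0 := by
  ext ξ i
  simp [blockOp_apply]

theorem norm_le_blockOp (T : H →L[ℂ] H) :
    ‖T‖ ≤ ‖blockOp (Matrix.of fun _ _ : Fin 1 => T)‖ := by
  refine ContinuousLinearMap.opNorm_le_bound _ (ContinuousLinearMap.opNorm_nonneg _) fun ξ => ?_
  have h := (blockOp (Matrix.of fun _ _ : Fin 1 => T)).le_opNorm (WithLp.toLp 2 fun _ => ξ)
  rw [PiLp.norm_eq_of_L2, PiLp.norm_eq_of_L2] at h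
  simpa [blockOp_apply] using h

theorem blockOp_add {n : ℕ} (S T : Matrix (Fin n) (Fin n) (H →L[ℂ] H)) :
    blockOp (S + T) = blockOp S + blockOp T := by
  ext ξ i
  simp [blockOp_apply, Finset.sum_add_distrib]

theorem blockOp_smul {n : ℕ} (c : ℂ) (T : Matrix (Fin n) (Fin n) (H →L[ℂ] H)) :
    blockOp (c • T) = c • blockOp T := by
  ext ξ i
  simp [blockOp_apply, Finset.smul_sum]

/-- The diagonal operator `b ⊕ ⋯ ⊕ b` on `n`-fold sums. -/
def diagOp (n : ℕ) (b : H →L[ℂ] H') :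
    PiLp 2 (fun _ : Fin n => H) →L[ℂ] PiLp 2 (fun _ : Fin n => H') :=
  ((PiLp.continuousLinearEquiv 2 ℂ (fun _ : Fin n => H')).symm :
      (∀ _ : Fin n, H') →L[ℂ] PiLp 2 (fun _ : Fin n => H')) ∘L
    ContinuousLinearMap.pi (fun i => b ∘L PiLp.proj 2 (fun _ : Fin n => H) i)

theorem diagOp_apply (n : ℕ) (b : H →L[ℂ] H') (ξ : PiLp 2 (fun _ : Fin n => H)) (i : Fin n) :
    diagOp n b ξ i = b (ξ i) := by
  simp [diagOp]

theorem norm_diagOp_le (n : ℕ) (b : H →L[ℂ] H') : ‖diagOp n b‖ ≤ ‖b‖ := by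
  refine ContinuousLinearMap.opNorm_le_bound _ (norm_nonneg _) fun ξ => ?_
  rw [PiLp.norm_eq_of_L2, PiLp.norm_eq_of_L2]
  refine Real.sqrt_le_iff.2 ⟨by positivity, ?_⟩
  rw [mul_pow, Real.sq_sqrt (by positivity), Finset.mul_sum]
  refine Finset.sum_le_sum fun i _ => ?_
  rw [diagOp_apply, ← mul_pow]
  gcongr
  exact b.le_opNorm _

/-- The operator `1 ⊗ b : ℓ²(N) ⊗ H → ℓ²(N) ⊗ H'`, acting as `b` in each coordinate. -/
def ampl (N : Type*) (b : H →L[ℂ] H') : L2Sum N H →L[ℂ] L2Sum N H' :=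
  LinearMap.mkContinuous
    { toFun := fun ξ => ⟨fun k => b (ξ k), by
        have h := (lp.memℓp ξ).const_smul (‖b‖ : ℂ)
        refine memℓp_gen (Summable.of_nonneg_of_le (fun k => by positivity) (fun k => ?_)
          ((memℓp_gen_iff (by norm_num)).1 h))
        refine Real.rpow_le_rpow (norm_nonneg _) ?_ (by norm_num)
        simpa [norm_smul] using b.le_opNorm (ξ k)⟩
      map_add' := fun ξ η => by ext k; exact map_add b _ _
      map_smul' := fun c ξ => by ext k; exact map_smul b c _ }
    ‖b‖ (fun ξ => by
      refine lp.norm_le_of_forall_sum_le (by norm_num) (by positivity) fun s => ?_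
      have h := lp.sum_rpow_le_norm_rpow (p := 2) (by norm_num) ξ s
      rw [Real.mul_rpow (norm_nonneg _) (norm_nonneg _)]
      refine le_trans ?_ (mul_le_mul_of_nonneg_left h (by positivity))
      rw [Finset.mul_sum]
      refine Finset.sum_le_sum fun k _ => ?_
      rw [← Real.mul_rpow (norm_nonneg _) (norm_nonneg _)]
      exact Real.rpow_le_rpow (norm_nonneg _) (b.le_opNorm (ξ k)) (by norm_num))

theorem ampl_apply (N : Type*) (b : H →L[ℂ] H') (ξ : L2Sum N H) (k : N) :
    ampl N b ξ k = b (ξ k) := rfl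

end Operators

/-! ### Matrix norms, completely bounded maps, operator spaces -/

/-- A family of (extended) norms on the spaces `M_n(V)`, `n ∈ ℕ`. -/
abbrev MatNorm (V : Type*) : Type _ := ∀ n : ℕ, Matrix (Fin n) (Fin n) V → ℝ≥0∞

/-- The completely bounded norm `sup_n ‖T⁽ⁿ⁾‖` of a linear map `T : V → W`, where
`T⁽ⁿ⁾ [a i j] = [T (a i j)]`. -/
def cbNorm {V W : Type*} [AddCommGroup V] [Module ℂ V] [AddCommGroup W] [Module ℂ W]
    (p : MatNorm V) (q : MatNorm W) (T : V →ₗ[ℂ] W) : ℝ≥0∞ :=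
  ⨆ (n : ℕ) (a : Matrix (Fin n) (Fin n) V) (_ : p n a ≤ 1), q n (a.map T)

/-- `T` is completely bounded. -/
def IsCB {V W : Type*} [AddCommGroup V] [Module ℂ V] [AddCommGroup W] [Module ℂ W]
    (p : MatNorm V) (q : MatNorm W) (T : V →ₗ[ℂ] W) : Prop :=
  cbNorm p q T < ⊤

/-- `T` is a complete isomorphism: a linear bijection such that `T` and `T⁻¹` are completely
bounded. -/
def IsCompleteIso {V W : Type*} [AddCommGroup V] [Module ℂ V] [AddCommGroup W] [Module ℂ W]
    (p : MatNorm V) (q : MatNorm W) (T : V →ₗ[ℂ] W) : Prop :=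
  ∃ e : V ≃ₗ[ℂ] W, (e : V →ₗ[ℂ] W) = T ∧
    IsCB p q (e : V →ₗ[ℂ] W) ∧ IsCB q p (e.symm : W →ₗ[ℂ] V)

/-- `T` is a bicontinuous isomorphism at level 1: a linear bijection such that `T` and `T⁻¹` are
bounded for the norms of `V = M_1(V)` and `W = M_1(W)`. -/
def IsBicontinuousIso {V W : Type*} [AddCommGroup V] [Module ℂ V] [AddCommGroup W] [Module ℂ W]
    (p : MatNorm V) (q : MatNorm W) (T : V →ₗ[ℂ] W) : Prop :=
  Function.Bijective T ∧
    (∃ C : ℝ≥0, ∀ v : V, q 1 (Matrix.of fun _ _ => T v) ≤ C * p 1 (Matrix.of fun _ _ => v)) ∧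
    (∃ C : ℝ≥0, ∀ v : V, p 1 (Matrix.of fun _ _ => v) ≤ C * q 1 (Matrix.of fun _ _ => T v))

/-- The matrix norms of `B(H)`: the operator norm of `M_n(B(H)) = B(H ⊕ ⋯ ⊕ H)`. -/
def opMatNorm (H : Type*) [NormedAddCommGroup H] [InnerProductSpace ℂ H] :
    MatNorm (H →L[ℂ] H) :=
  fun _ T => ENNReal.ofReal ‖blockOp T‖

/-- The product `α a β` of a matrix `a ∈ M_n(F)` with scalar matrices. -/
def scalarConj {F : Type*} [AddCommGroup F] [Module ℂ F] {n : ℕ}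
    (α : Matrix (Fin n) (Fin n) ℂ) (a : Matrix (Fin n) (Fin n) F)
    (β : Matrix (Fin n) (Fin n) ℂ) : Matrix (Fin n) (Fin n) F :=
  fun i j => ∑ k, ∑ l, (α i k * β l j) • a k l

/-- Abstract complex operator spaces: norms on all `M_n(F)`, extending the norm of `F`, which
satisfy Ruan's axioms. -/
class OperatorSpace (F : Type*) [NormedAddCommGroup F] [NormedSpace ℂ F] where
  mnorm : MatNorm F
  mnorm_ne_top : ∀ (n : ℕ) (a : Matrix (Fin n) (Fin n) F), mnorm n a ≠ ⊤
  mnorm_one : ∀ a : Matrix (Fin 1) (Fin 1) F, mnorm 1 a = ENNReal.ofReal ‖a 0 0‖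
  mnorm_eq_zero : ∀ (n : ℕ) (a : Matrix (Fin n) (Fin n) F), mnorm n a = 0 → a = 0
  mnorm_add_le : ∀ (n : ℕ) (a b : Matrix (Fin n) (Fin n) F),
    mnorm n (a + b) ≤ mnorm n a + mnorm n b
  mnorm_smul : ∀ (n : ℕ) (c : ℂ) (a : Matrix (Fin n) (Fin n) F),
    mnorm n (c • a) = ENNReal.ofReal ‖c‖ * mnorm n a
  mnorm_directSum : ∀ (m n : ℕ) (a : Matrix (Fin m) (Fin m) F) (b : Matrix (Fin n) (Fin n) F),
    mnorm (m + n) (Matrix.reindex finSumFinEquiv finSumFinEquiv (Matrix.fromBlocks a 0 0 b)) =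
      max (mnorm m a) (mnorm n b)
  mnorm_scalarConj_le : ∀ (n : ℕ) (α β : Matrix (Fin n) (Fin n) ℂ)
    (a : Matrix (Fin n) (Fin n) F),
    mnorm n (scalarConj α a β) ≤
      ENNReal.ofReal ‖Matrix.toEuclideanCLM (𝕜 := ℂ) α‖ * mnorm n a *
        ENNReal.ofReal ‖Matrix.toEuclideanCLM (𝕜 := ℂ) β‖

/-! ### The dual operator space `E = F^*` and its matrix spaces -/

section Dual

variable (F : Type u) [NormedAddCommGroup F] [NormedSpace ℂ F] [OperatorSpace F]

/-- The matrix norms of the dual operator space `E = F^*`: `M_n(F^*) = CB(F, M_n)`, where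
`X = [X i j]` is the map `φ ↦ [X i j φ]`. -/
def dualMatNorm : MatNorm (StrongDual ℂ F) := fun n X =>
  cbNorm (OperatorSpace.mnorm (F := F)) (opMatNorm (EuclideanSpace ℂ (Fin n)))
    { toFun := fun φ => Matrix.toEuclideanCLM (𝕜 := ℂ) (Matrix.of fun i j => X i j φ)
      map_add' := fun φ ψ => by
        rw [← map_add]
        congr 1
        ext i j
        simp
      map_smul' := fun c φ => by
        rw [RingHom.id_apply, ← map_smul]
        congr 1
        ext i j
        simp }

variable {F} in
/-- The completely bounded norm of a bounded map `F → B(ℓ²(ι))`. -/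
def matNorm {ι : Type v} (x : F →L[ℂ] (L2 ι →L[ℂ] L2 ι)) : ℝ≥0∞ :=
  cbNorm (OperatorSpace.mnorm (F := F)) (opMatNorm (L2 ι)) (x : F →ₗ[ℂ] (L2 ι →L[ℂ] L2 ι))

variable {F} in
theorem blockOp_le_matNorm {ι : Type v} (x : F →L[ℂ] (L2 ι →L[ℂ] L2 ι)) {n : ℕ}
    {a : Matrix (Fin n) (Fin n) F} (ha : OperatorSpace.mnorm n a ≤ 1) :
    ENNReal.ofReal ‖blockOp (a.map x)‖ ≤ matNorm x :=
  le_iSup_of_le n (le_iSup_of_le a (le_iSup_of_le ha le_rfl))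

variable {F} in
theorem norm_apply_le {ι : Type v} (x : F →L[ℂ] (L2 ι →L[ℂ] L2 ι)) (φ : F) :
    ENNReal.ofReal ‖x φ‖ ≤ ENNReal.ofReal ‖φ‖ * matNorm x := by
  rcases eq_or_ne φ 0 with rfl | hφ
  · simp
  have hφ' : ‖φ‖ ≠ 0 := norm_ne_zero_iff.2 hφ
  set ψ : F := ((‖φ‖⁻¹ : ℝ) : ℂ) • φ with hψ
  have h1 : OperatorSpace.mnorm 1 (Matrix.of fun _ _ : Fin 1 => ψ) ≤ 1 := by
    rw [OperatorSpace.mnorm_one, Matrix.of_apply, hψ, norm_smul]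
    simp [hφ']
  have h2 : ENNReal.ofReal ‖x ψ‖ ≤ matNorm x :=
    le_trans (ENNReal.ofReal_le_ofReal (norm_le_blockOp (x ψ))) (blockOp_le_matNorm x h1)
  have h3 : φ = ((‖φ‖ : ℝ) : ℂ) • ψ := by
    rw [hψ, smul_smul, ← Complex.ofReal_mul, mul_inv_cancel₀ hφ', Complex.ofReal_one, one_smul]
  have h4 : ‖x φ‖ = ‖φ‖ * ‖x ψ‖ := by
    conv_lhs => rw [h3, map_smul, norm_smul]
    simp
  rw [h4, ENNReal.ofReal_mul (norm_nonneg _)]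
  exact mul_le_mul_right h2 _

/-- The matrix space `M_ι(E)` of the dual operator space `E = F^*`, for an arbitrary index set
`ι`: `M_ι(F^*) = CB(F, B(ℓ²(ι)))`. The entries of `x` are the functionals
`φ ↦ ⟪e i, x φ (e j)⟫`, and the norm is the completely bounded norm `matNorm`. -/
def DualMat (ι : Type v) : Submodule ℂ (F →L[ℂ] (L2 ι →L[ℂ] L2 ι)) where
  carrier := {x | matNorm x < ⊤}
  zero_mem' := by
    have h : matNorm (0 : F →L[ℂ] (L2 ι →L[ℂ] L2 ι)) ≤ 0 := by
      refine iSup_le fun n => iSup_le fun a => iSup_le fun _ => ?_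
      have h0 : (a.map ((0 : F →L[ℂ] (L2 ι →L[ℂ] L2 ι)) : F →ₗ[ℂ] (L2 ι →L[ℂ] L2 ι))) =
          (0 : Matrix (Fin n) (Fin n) (L2 ι →L[ℂ] L2 ι)) := by
        ext; simp
      rw [h0, opMatNorm, blockOp_zero]
      simp
    exact lt_of_le_of_lt h (by simp)
  add_mem' := by
    intro x y hx hy
    refine lt_of_le_of_lt (b := matNorm x + matNorm y) ?_ (ENNReal.add_lt_top.2 ⟨hx, hy⟩)
    refine iSup_le fun n => iSup_le fun a => iSup_le fun ha => ?_
    have h0 : (a.map ((x + y : F →L[ℂ] (L2 ι →L[ℂ] L2 ι)) : F →ₗ[ℂ] (L2 ι →L[ℂ] L2 ι))) =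
        a.map x + a.map y := by
      ext; simp
    rw [h0, opMatNorm, blockOp_add]
    refine (ENNReal.ofReal_le_ofReal
      (norm_add_le (blockOp (a.map x)) (blockOp (a.map y)))).trans ?_
    rw [ENNReal.ofReal_add (norm_nonneg _) (norm_nonneg _)]
    exact add_le_add (blockOp_le_matNorm x ha) (blockOp_le_matNorm y ha)
  smul_mem' := by
    intro c x hx
    refine lt_of_le_of_lt (b := ENNReal.ofReal ‖c‖ * matNorm x) ?_ (ENNReal.mul_lt_top (by simp) hx)
    refine iSup_le fun n => iSup_le fun a => iSup_le fun ha => ?_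
    have h0 : (a.map ((c • x : F →L[ℂ] (L2 ι →L[ℂ] L2 ι)) : F →ₗ[ℂ] (L2 ι →L[ℂ] L2 ι))) =
        c • a.map x := by
      ext; simp
    rw [h0, opMatNorm, blockOp_smul, norm_smul, ENNReal.ofReal_mul (norm_nonneg _)]
    exact mul_le_mul_right (blockOp_le_matNorm x ha) _

variable {F}

/-- The matrix entry `x i j ∈ E = F^*` of `x ∈ M_ι(E)`. -/
def entry {ι : Type v} (x : DualMat F ι) (i j : ι) : StrongDual ℂ F :=
  innerSL ℂ (stdVec i) ∘L (ContinuousLinearMap.apply ℂ (L2 ι) (stdVec j)) ∘L x.1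

theorem entry_apply {ι : Type v} (x : DualMat F ι) (i j : ι) (φ : F) :
    entry x i j φ = ⟪(stdVec i : L2 ι), x.1 φ (stdVec j)⟫_ℂ := rfl

/-- The product `a^* x b ∈ M_κ(E)`, for `x ∈ M_ι(E)` and scalar matrices
`a, b : ℓ²(κ) → ℓ²(ι)`. -/
def conj {ι κ : Type v} (a : L2 κ →L[ℂ] L2 ι) (x : DualMat F ι) (b : L2 κ →L[ℂ] L2 ι) :
    DualMat F κ :=
  ⟨(ContinuousLinearMap.compL ℂ (L2 κ) (L2 ι) (L2 κ) (ContinuousLinearMap.adjoint a)) ∘L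
      ((ContinuousLinearMap.compL ℂ (L2 κ) (L2 ι) (L2 ι)).flip b) ∘L x.1, by
    refine lt_of_le_of_lt (b := ENNReal.ofReal ‖ContinuousLinearMap.adjoint a‖ * matNorm x.1 *
      ENNReal.ofReal ‖b‖) ?_
      (ENNReal.mul_lt_top (ENNReal.mul_lt_top (by simp) x.2) (by simp))
    refine iSup_le fun n => iSup_le fun c => iSup_le fun hc => ?_
    refine le_trans ?_ (mul_le_mul_left (mul_le_mul_right (blockOp_le_matNorm x.1 hc) _) _)
    set y : F →L[ℂ] (L2 κ →L[ℂ] L2 κ) :=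
      (ContinuousLinearMap.compL ℂ (L2 κ) (L2 ι) (L2 κ) (ContinuousLinearMap.adjoint a)) ∘L
        ((ContinuousLinearMap.compL ℂ (L2 κ) (L2 ι) (L2 ι)).flip b) ∘L x.1 with hy
    have h0 : blockOp (c.map (y : F →ₗ[ℂ] (L2 κ →L[ℂ] L2 κ))) =
        diagOp n (ContinuousLinearMap.adjoint a) ∘L blockOp (c.map x.1) ∘L diagOp n b := by
      ext1 ξ
      refine PiLp.ext fun i => ?_
      simp [blockOp_apply, diagOp_apply, hy]
    rw [opMatNorm, h0]
    simp only [← ENNReal.ofReal_mul (norm_nonneg _),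
      ← ENNReal.ofReal_mul (mul_nonneg (norm_nonneg _) (norm_nonneg _))]
    refine ENNReal.ofReal_le_ofReal ?_
    refine (ContinuousLinearMap.opNorm_comp_le _ _).trans ?_
    rw [mul_assoc]
    refine mul_le_mul (norm_diagOp_le n _) ?_ (norm_nonneg _) (norm_nonneg _)
    refine (ContinuousLinearMap.opNorm_comp_le _ _).trans ?_
    exact mul_le_mul_of_nonneg_left (norm_diagOp_le n _) (norm_nonneg _)⟩

theorem conj_apply {ι κ : Type v} (a : L2 κ →L[ℂ] L2 ι) (x : DualMat F ι)
    (b : L2 κ →L[ℂ] L2 ι) (φ : F) (ξ : L2 κ) :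
    (conj a x b).1 φ ξ = ContinuousLinearMap.adjoint a (x.1 φ (b ξ)) := rfl

end Dual

/-! ### Weak* topologies -/

/-- The functional `T ↦ ⟪η, T ξ⟫` on `B(H)`. -/
def vecFunctional {H : Type*} [NormedAddCommGroup H] [InnerProductSpace ℂ H] (η ξ : H) :
    StrongDual ℂ (H →L[ℂ] H) :=
  innerSL ℂ η ∘L ContinuousLinearMap.apply ℂ H ξ

/-- The predual of `B(H)`, i.e. the space of normal functionals: the norm closure in `B(H)^*` of
the span of the vector functionals `T ↦ ⟪η, T ξ⟫`. -/
def opPredual (H : Type*) [NormedAddCommGroup H] [InnerProductSpace ℂ H] :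
    Submodule ℂ (StrongDual ℂ (H →L[ℂ] H)) :=
  (Submodule.span ℂ (Set.range fun p : H × H => vecFunctional p.1 p.2)).topologicalClosure

/-- The weak* (σ-weak) topology of `B(H)`. -/
@[reducible] def opWeakStar (H : Type*) [NormedAddCommGroup H] [InnerProductSpace ℂ H] :
    TopologicalSpace (H →L[ℂ] H) :=
  TopologicalSpace.induced (fun T (ω : opPredual H) => ω.1 T) Pi.topologicalSpace

section WeakStar

variable (F : Type u) [NormedAddCommGroup F] [NormedSpace ℂ F] [OperatorSpace F] (ι : Type v)

variable {F ι} in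
/-- The functional `x ↦ ⟪η, x φ ξ⟫` on `M_ι(E)`. -/
def coefFunctional (φ : F) (η ξ : L2 ι) : DualMat F ι →ₗ[ℂ] ℂ where
  toFun x := ⟪η, x.1 φ ξ⟫_ℂ
  map_add' x y := by simp
  map_smul' c x := by simp

/-- The predual of `M_ι(E) = CB(F, B(ℓ²(ι)))` (the operator space projective tensor product of `F`
with the trace class), as a space of functionals on `M_ι(E)`: the closure, in the dual norm, of the
span of the functionals `x ↦ ⟪η, x φ ξ⟫`. -/
def matPredual : Set (DualMat F ι →ₗ[ℂ] ℂ) :=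
  {ω | ∀ ε : ℝ≥0, 0 < ε →
    ∃ ω₀ ∈ Submodule.span ℂ
      (Set.range fun p : F × L2 ι × L2 ι => coefFunctional p.1 p.2.1 p.2.2),
      ∀ x : DualMat F ι, ENNReal.ofReal ‖ω x - ω₀ x‖ ≤ ε * matNorm x.1}

/-- The weak* topology of `M_ι(E)`. -/
@[reducible] def weakStar : TopologicalSpace (DualMat F ι) :=
  TopologicalSpace.induced (fun x (ω : matPredual F ι) => ω.1 x) Pi.topologicalSpace

variable {F ι} in
/-- Evaluation `x ↦ x φ`, i.e. `[x i j] ↦ [x i j φ]`, is weak* continuous. -/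
theorem continuous_eval (φ : F) :
    Continuous[weakStar F ι, opWeakStar (L2 ι)] (fun x : DualMat F ι => x.1 φ) := by
  have key : ∀ ω : opPredual (L2 ι), ω.1.toLinearMap ∘ₗ
      (ContinuousLinearMap.apply ℂ (L2 ι →L[ℂ] L2 ι) φ).toLinearMap ∘ₗ (DualMat F ι).subtype ∈
      matPredual F ι := by
    rintro ⟨ω, hω⟩ ε hε
    set δ : ℝ≥0 := ε / (‖φ‖₊ + 1) with hδ
    have hδ0 : 0 < δ := by positivity
    obtain ⟨ω₀, hω₀, hd⟩ := Metric.mem_closure_iff.1 hω δ (by exact_mod_cast hδ0)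
    refine ⟨ω₀.toLinearMap ∘ₗ
      (ContinuousLinearMap.apply ℂ (L2 ι →L[ℂ] L2 ι) φ).toLinearMap ∘ₗ
        (DualMat F ι).subtype, ?_, fun x => ?_⟩
    · clear hd
      refine Submodule.span_induction (p := fun ω₁ _ => ω₁.toLinearMap ∘ₗ
        (ContinuousLinearMap.apply ℂ (L2 ι →L[ℂ] L2 ι) φ).toLinearMap ∘ₗ
        (DualMat F ι).subtype ∈ Submodule.span ℂ
        (Set.range fun p : F × L2 ι × L2 ι => coefFunctional p.1 p.2.1 p.2.2))
        ?_ ?_ ?_ ?_ hω₀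
      · rintro _ ⟨p, rfl⟩
        exact Submodule.subset_span ⟨(φ, p.1, p.2), rfl⟩
      · exact Submodule.zero_mem _
      · intro a b _ _ ha hb
        exact Submodule.add_mem _ ha hb
      · intro c a _ ha
        exact Submodule.smul_mem _ c ha
    · have h1 : ENNReal.ofReal ‖(ω - ω₀) (x.1 φ)‖ ≤
          (δ : ℝ≥0∞) * ENNReal.ofReal ‖x.1 φ‖ := by
        rw [dist_eq_norm] at hd
        rw [← ENNReal.ofReal_coe_nnreal, ← ENNReal.ofReal_mul (by positivity)]
        refine ENNReal.ofReal_le_ofReal ((ContinuousLinearMap.le_opNorm _ _).trans ?_)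
        exact mul_le_mul_of_nonneg_right hd.le (norm_nonneg _)
      refine h1.trans ((mul_le_mul_right (norm_apply_le x.1 φ) _).trans ?_)
      rw [← mul_assoc]
      refine mul_le_mul_left ?_ _
      rw [ofReal_norm, enorm_eq_nnnorm, ← ENNReal.coe_mul, ENNReal.coe_le_coe, hδ, div_mul_eq_mul_div]
      refine div_le_of_le_mul₀ (by positivity) (by positivity) ?_
      gcongr
      exact le_self_add
  refine continuous_induced_rng.2
    (@continuous_pi _ _ _ (weakStar F ι) _ _ fun ω => ?_)
  have h : Continuous[weakStar F ι, Pi.topologicalSpace]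
      (fun (x : DualMat F ι) (ω : matPredual F ι) => ω.1 x) := continuous_induced_dom
  have h2 : Continuous (fun p : matPredual F ι → ℂ => p ⟨_, key ω⟩) := continuous_apply _
  have h3 := @Continuous.comp _ _ _ (weakStar F ι) _ _ _ _ h2 h
  exact h3

end WeakStar

/-! ### Noncommutative sets, noncommutative convexity, noncommutative spans -/

/-- The index sets of the matrix levels: nonempty sets of cardinality at most `κ`. -/
abbrev Level (κ : Cardinal.{v}) : Type (v + 1) :=
  {ι : Type v // Nonempty ι ∧ Cardinal.mk ι ≤ κ}

/-- A family of isometries `α i : ℓ²(m i) → ℓ²(n)` with `∑ i, α i (α i)^* = 1`. -/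
structure IsIsometricPartition {I n : Type v} {m : I → Type v}
    (α : ∀ i, L2 (m i) →L[ℂ] L2 n) : Prop where
  isometry : ∀ i, Isometry (α i)
  hasSum : ∀ ξ : L2 n, HasSum (fun i => α i (ContinuousLinearMap.adjoint (α i) ξ)) ξ

section NC

variable {F : Type u} [NormedAddCommGroup F] [NormedSpace ℂ F] [OperatorSpace F]
variable {κ : Cardinal.{v}}

variable (F κ) in
/-- A nc set over `E = F^*`: a subset `K_n` of `M_n(E)` for each level `n`. -/
abbrev NCSet : Type _ := ∀ n : Level κ, Set (DualMat F n.1)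

/-- `y = ∑ i, α i (x i) (α i)^*` in `M_n(E)`, with strong operator convergence of the sum after
pairing with each element of `F`. -/
def IsDirectSum {I n : Type v} {m : I → Type v} (α : ∀ i, L2 (m i) →L[ℂ] L2 n)
    (x : ∀ i, DualMat F (m i)) (y : DualMat F n) : Prop :=
  ∀ (φ : F) (ξ : L2 n),
    HasSum (fun i => α i ((x i).1 φ (ContinuousLinearMap.adjoint (α i) ξ))) (y.1 φ ξ)

/-- Nc convexity: closure under direct sums of bounded families and under compressions. -/
structure IsNCConvex (K : NCSet F κ) : Prop where
  directSum : ∀ {I : Type v} (n : Level κ) (m : I → Level κ)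
    (α : ∀ i, L2 (m i).1 →L[ℂ] L2 n.1) (x : ∀ i, DualMat F (m i).1),
    IsIsometricPartition α → (∀ i, x i ∈ K (m i)) → (∃ C : ℝ≥0, ∀ i, matNorm (x i).1 ≤ C) →
      ∃ y ∈ K n, IsDirectSum α x y
  compress : ∀ (n m : Level κ) (β : L2 m.1 →L[ℂ] L2 n.1), Isometry β →
    ∀ x ∈ K n, conj β x β ∈ K m

/-- A nc compact convex set: nc convex, and each level `K_n` is weak* compact in `M_n(E)`. -/
structure IsNCCompactConvex (K : NCSet F κ) : Prop where
  convex : IsNCConvex K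
  compact : ∀ n : Level κ, @IsCompact _ (weakStar F n.1) (K n)

/-- `ncSpan(K)` at level `n`: all finite sums `∑ k, (a k)^* (x k) (b k)` with `x k ∈ K` at
arbitrary levels and rectangular scalar matrices `a k`, `b k`. -/
def ncSpan (K : NCSet F κ) (n : Level κ) : Submodule ℂ (DualMat F n.1) :=
  Submodule.span ℂ {y | ∃ (m : Level κ) (a b : L2 n.1 →L[ℂ] L2 m.1), ∃ x ∈ K m, y = conj a x b}

/-- `ncSpan_n(K_n)`: all finite sums `∑ k, (a k)^* (x k) (b k)` with `x k ∈ K_n` and square scalar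
matrices `a k`, `b k`. -/
def ncSpanSquare (K : NCSet F κ) (n : Level κ) : Submodule ℂ (DualMat F n.1) :=
  Submodule.span ℂ {y | ∃ a b : L2 n.1 →L[ℂ] L2 n.1, ∃ x ∈ K n, y = conj a x b}

/-- `K` is nc spanning, in the rectangular sense or in the square sense, at some level. -/
def IsNCSpanning (K : NCSet F κ) : Prop :=
  (∃ n : Level κ, ncSpan K n = ⊤) ∨ (∃ n : Level κ, ncSpanSquare K n = ⊤)

/-! ### Continuous nc affine functions -/

/-- The weak* topology of the level `K_n`. -/
@[reducible] def levelTop (K : NCSet F κ) (n : Level κ) : TopologicalSpace (K n) :=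
  TopologicalSpace.induced Subtype.val (weakStar F n.1)

/-- The space `𝔸(K)` of continuous nc affine functions `K → M(ℂ)`. -/
def Aff (K : NCSet F κ) : Submodule ℂ (∀ n : Level κ, K n → (L2 n.1 →L[ℂ] L2 n.1)) where
  carrier := {f |
    (∀ {I : Type v} (n : Level κ) (m : I → Level κ) (α : ∀ i, L2 (m i).1 →L[ℂ] L2 n.1)
      (x : ∀ i, K (m i)) (y : K n), IsIsometricPartition α →
      (∃ C : ℝ≥0, ∀ i, matNorm (x i).1.1 ≤ C) → IsDirectSum α (fun i => (x i).1) y.1 →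
        ∀ ξ, HasSum (fun i => α i (f (m i) (x i) (ContinuousLinearMap.adjoint (α i) ξ)))
          (f n y ξ)) ∧
    (∀ (n m : Level κ) (β : L2 m.1 →L[ℂ] L2 n.1), Isometry β → ∀ (x : K n) (y : K m),
      y.1 = conj β x.1 β → f m y = ContinuousLinearMap.adjoint β ∘L f n x ∘L β) ∧
    (∀ n : Level κ, Continuous[levelTop K n, opWeakStar (L2 n.1)] (f n))}
  zero_mem' := by
    refine ⟨fun n m α x y _ _ _ ξ => ?_, fun n m β _ x y _ => ?_, fun n => ?_⟩
    · simp
    · ext; simp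
    · exact @continuous_const _ _ (levelTop K n) (opWeakStar (L2 n.1)) 0
  add_mem' := by
    rintro f g ⟨hf1, hf2, hf3⟩ ⟨hg1, hg2, hg3⟩
    refine ⟨fun n m α x y h1 h2 h3 ξ => ?_, fun n m β hβ x y h => ?_, fun n => ?_⟩
    · simpa using (hf1 n m α x y h1 h2 h3 ξ).add (hg1 n m α x y h1 h2 h3 ξ)
    · simp only [Pi.add_apply, hf2 n m β hβ x y h, hg2 n m β hβ x y h]
      ext; simp
    · let _ := levelTop K n
      have hf := continuous_induced_rng.1 (hf3 n)
      have hg := continuous_induced_rng.1 (hg3 n)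
      refine continuous_induced_rng.2 (continuous_pi fun ω => ?_)
      have h := ((continuous_apply ω).comp hf).add ((continuous_apply ω).comp hg)
      refine h.congr fun x => ?_
      simp
  smul_mem' := by
    rintro c f ⟨hf1, hf2, hf3⟩
    refine ⟨fun n m α x y h1 h2 h3 ξ => ?_, fun n m β hβ x y h => ?_, fun n => ?_⟩
    · simpa using (hf1 n m α x y h1 h2 h3 ξ).const_smul c
    · simp only [Pi.smul_apply, hf2 n m β hβ x y h]
      ext; simp
    · let _ := levelTop K n
      have hf := continuous_induced_rng.1 (hf3 n)
      refine continuous_induced_rng.2 (continuous_pi fun ω => ?_)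
      have h := ((continuous_apply ω).comp hf).const_smul c
      refine h.congr fun x => ?_
      simp

/-- The matrix norms of `𝔸(K)`: `‖[f i j]‖ = sup {‖[f i j (x)]‖ : x ∈ K}`, the supremum being over
all levels. -/
def affMatNorm (K : NCSet F κ) : MatNorm (Aff K) := fun _ f =>
  ⨆ (n : Level κ) (x : K n), opMatNorm (L2 n.1) _ (f.map fun g => g.1 n x)

/-- The restriction map `θ : F → 𝔸(K)`: on `K_n`, `θ φ` is `[x i j] ↦ [x i j φ]`. -/
def restrict (K : NCSet F κ) : F →ₗ[ℂ] Aff K where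
  toFun φ := ⟨fun n x => x.1.1 φ, by
    refine ⟨fun n m α x y _ _ h ξ => h φ ξ, fun n m β _ x y h => ?_, fun n => ?_⟩
    · change y.1.1 φ = _
      rw [h]
      rfl
    · exact @Continuous.comp _ _ _ (levelTop K n) (weakStar F n.1) (opWeakStar (L2 n.1)) _ _
        (continuous_eval φ) (@continuous_induced_dom _ _ Subtype.val (weakStar F n.1))⟩
  map_add' φ ψ := by ext n x : 4; simp
  map_smul' c φ := by ext n x : 4; simp

/-- Continuous nc affine functions `f : K → M_N`, i.e. elements of `𝔸(K, M_N)`. The value at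
`x ∈ K_n` lies in `M_N(M_n) = B(ℓ²(N) ⊗ ℓ²(n))`, and a scalar matrix `β : ℓ²(m) → ℓ²(n)` acts
through `1 ⊗ β`. -/
structure IsMatAff (K : NCSet F κ) (N : Type w)
    (f : ∀ n : Level κ, K n → (L2Sum N (L2 n.1) →L[ℂ] L2Sum N (L2 n.1))) : Prop where
  directSum : ∀ {I : Type v} (n : Level κ) (m : I → Level κ)
    (α : ∀ i, L2 (m i).1 →L[ℂ] L2 n.1) (x : ∀ i, K (m i)) (y : K n),
    IsIsometricPartition α → (∃ C : ℝ≥0, ∀ i, matNorm (x i).1.1 ≤ C) →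
    IsDirectSum α (fun i => (x i).1) y.1 →
      ∀ ξ, HasSum (fun i => ampl N (α i) (f (m i) (x i)
        (ampl N (ContinuousLinearMap.adjoint (α i)) ξ))) (f n y ξ)
  compress : ∀ (n m : Level κ) (β : L2 m.1 →L[ℂ] L2 n.1), Isometry β → ∀ (x : K n) (y : K m),
    y.1 = conj β x.1 β →
      f m y = ampl N (ContinuousLinearMap.adjoint β) ∘L f n x ∘L ampl N β
  continuous : ∀ n : Level κ,
    Continuous[levelTop K n, opWeakStar (L2Sum N (L2 n.1))] (f n)

open Classical in
/-- The linear map `Ψ : E → M_N` is a linear-extension of `f : K → M_N`: on `K_n`, `f` is the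
amplification `[x i j] ↦ [Ψ (x i j)]`, entry by entry. -/
def IsLinearExtension (K : NCSet F κ) {N : Type w}
    (f : ∀ n : Level κ, K n → (L2Sum N (L2 n.1) →L[ℂ] L2Sum N (L2 n.1)))
    (Ψ : StrongDual ℂ F →ₗ[ℂ] (L2 N →L[ℂ] L2 N)) : Prop :=
  ∀ (n : Level κ) (x : K n) (i j : n.1) (k l : N),
    ⟪(stdVec i : L2 n.1), f n x (lp.single 2 l (stdVec j)) k⟫_ℂ =
      ⟪(stdVec k : L2 N), Ψ (entry x.1 i j) (stdVec l)⟫_ℂ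

/-- `Ψ : E → M_N` is continuous for the weak* topologies of `E = F^*` and `M_N = B(ℓ²(N))`. -/
def IsWeakStarContinuous {N : Type w} (Ψ : StrongDual ℂ F →ₗ[ℂ] (L2 N →L[ℂ] L2 N)) : Prop :=
  @Continuous (WeakDual ℂ F) (L2 N →L[ℂ] L2 N) inferInstance (opWeakStar (L2 N))
    (fun x : WeakDual ℂ F => Ψ (WeakDual.toStrongDual x))

/-- Membership in `M_N(F)`: the finite submatrices of `ψ` have uniformly bounded norm. -/
def IsBoundedMatrix {N : Type w} (ψ : Matrix N N F) : Prop :=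
  ∃ C : ℝ≥0, ∀ (n : ℕ) (e : Fin n ↪ N), OperatorSpace.mnorm n (ψ.submatrix e e) ≤ C

open Classical in
/-- The matrix `ψ` over `F` restricts to `f : K → M_N`: `f x = [x ψ_kl]` for `x ∈ K`. -/
def IsMatrixExtension (K : NCSet F κ) {N : Type w}
    (f : ∀ n : Level κ, K n → (L2Sum N (L2 n.1) →L[ℂ] L2Sum N (L2 n.1)))
    (ψ : Matrix N N F) : Prop :=
  ∀ (n : Level κ) (x : K n) (k l : N) (ξ : L2 n.1),
    f n x (lp.single 2 l ξ) k = x.1.1 (ψ k l) ξ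

end NC

end NCReg

end

/-!
The restriction map `θ : F → 𝔸(K)` is controlled from both sides by the geometry of `K`.

*From above.* A weak* compact set of matrices over `F^*` is bounded in the completely bounded norm:
the space `ℓ¹` over all elementary tensors `η ⊗ a ⊗ ξ` of norm at most one maps into the predual,
so the uniform boundedness principle applies (`exists_matNorm_le_of_isCompact`). Every element of
every level is a direct summand of an element of the top level, hence `K` is bounded uniformly over
all levels, and so is every continuous nc affine function (`IsNCCompactConvex.exists_matNorm_le`,
`IsMatAff.exists_norm_le`). This makes `θ` completely bounded.

*From below.* If `K` is nc spanning, every functional on `F` is a coefficient of a finite sum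
`∑ a^* x b` with `x ∈ K`. So the set of those `φ` that have norm at most one on `K` is weakly
bounded, hence bounded (`IsNCSpanning.exists_norm_le`). Thus `θ` is injective and bounded below at
the first matrix level, and it is bicontinuous as soon as it is onto.

For the equivalence with linear extensions, the three conditions are proved in a cycle.

* If `θ` is a complete isomorphism, apply `θ⁻¹` to the entries of a continuous nc affine
  `f : K → M_N`; the matrix over `F` so obtained is bounded because `f` is
  (`exists_matrixExtension_of_isCompleteIso`).
* If `ψ` is a bounded matrix over `F` restricting to `f`, let `Ψ(g) = [g(ψ_kl)]`. This is a bounded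
  operator because `g` is a coefficient of an element of the nc span of `K`; the map `Ψ` is
  completely bounded by a flip of tensor factors, and weak* continuous because `F` is norm closed
  in its bidual (`IsMatrixExtension.exists_linearMap`, `isCB_of_isBoundedMatrix`,
  `isWeakStarContinuous_of_entries`).
* If linear extensions exist, functions supported at one matrix position show that `θ` is onto. If
  `θ⁻¹` were not completely bounded, choose matrices `a_j` over `𝔸(K)` in the unit balls whose
  images under `θ⁻¹` have norm greater than `j`. As `N` is infinite, all the `a_j` fit as diagonal
  blocks into one continuous nc affine function `K → M_N`. The entries of its linear extension `Ψ`
  are the elements `θ⁻¹(a_j(p, q))`, and `mnorm_submatrix_le_of_isCB` bounds the norms of all the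
  blocks by `2 ‖Ψ‖_cb`, a contradiction (`isCompleteIso_of_linearExtension`).

The last bound needs that the norm of a matrix over `F` is recovered from complete contractions
`F → M_m`, as in Ruan's theorem. A version with a factor `2` suffices (`exists_dual_norming`): a
norming functional on `M_m(F)` is dominated by positive forms on the scalar factors, by a
Hahn-Banach separation of convex cones, and the forms are made invertible at the cost of the factor.
-/

noncomputable section

namespace NCReg

/-! ### Rectangular scalar multiplication in operator spaces -/

section RectConj

open scoped Matrix.Norms.L2Operator

/-- The product `α a β ∈ M_m(F)` of `a ∈ M_r(F)` with rectangular scalar matrices. -/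
def rectConj {F : Type*} [AddCommGroup F] [Module ℂ F] {m r : ℕ}
    (α : Matrix (Fin m) (Fin r) ℂ) (a : Matrix (Fin r) (Fin r) F)
    (β : Matrix (Fin r) (Fin m) ℂ) : Matrix (Fin m) (Fin m) F :=
  fun i j => ∑ k, ∑ l, (α i k * β l j) • a k l

/-- The scalar matrix of the coordinate embedding along an injection `e`. -/
def coordMat {p q : ℕ} (e : Fin p → Fin q) : Matrix (Fin q) (Fin p) ℂ :=
  (1 : Matrix (Fin q) (Fin q) ℂ).submatrix id e

theorem coordMat_apply {p q : ℕ} (e : Fin p → Fin q) (i : Fin q) (j : Fin p) :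
    coordMat e i j = if i = e j then 1 else 0 := by
  simp [coordMat, Matrix.one_apply]

theorem norm_coordMat_le {p q : ℕ} {e : Fin p → Fin q} (he : Function.Injective e) :
    ‖coordMat e‖ ≤ 1 := by
  have h1 : (coordMat e).conjTranspose * coordMat e = 1 := by
    ext i j
    simp [Matrix.mul_apply, coordMat_apply, Matrix.one_apply, he.eq_iff, eq_comm]
  have h2 := Matrix.l2_opNorm_conjTranspose_mul_self (coordMat e)
  rw [h1] at h2
  have h3 : ‖(1 : Matrix (Fin p) (Fin p) ℂ)‖ ≤ 1 := by
    rw [Matrix.cstar_norm_def, map_one]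
    exact ContinuousLinearMap.norm_id_le
  nlinarith [norm_nonneg (coordMat e)]

variable {F : Type u} [NormedAddCommGroup F] [NormedSpace ℂ F] [OperatorSpace F]

theorem mnorm_zero (n : ℕ) : OperatorSpace.mnorm n (0 : Matrix (Fin n) (Fin n) F) = 0 := by
  have h := OperatorSpace.mnorm_smul n (0 : ℂ) (0 : Matrix (Fin n) (Fin n) F)
  simpa using h

/-- Ruan's axiom for products with rectangular scalar matrices. -/
theorem mnorm_rectConj_le {m r : ℕ} (α : Matrix (Fin m) (Fin r) ℂ)
    (a : Matrix (Fin r) (Fin r) F) (β : Matrix (Fin r) (Fin m) ℂ) :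
    OperatorSpace.mnorm m (rectConj α a β) ≤
      ENNReal.ofReal ‖α‖ * OperatorSpace.mnorm r a * ENNReal.ofReal ‖β‖ := by
  set J₁ := coordMat (Fin.castAdd r : Fin m → Fin (m + r)) with hJ₁
  set J₂ := coordMat (Fin.natAdd m : Fin r → Fin (m + r)) with hJ₂
  have n₁ : ‖J₁‖ ≤ 1 := norm_coordMat_le (Fin.castAdd_injective m r)
  have n₂ : ‖J₂‖ ≤ 1 := norm_coordMat_le (Fin.natAdd_injective r m)
  -- pad everything with zeros to square matrices of size `m + r`
  have key : Matrix.reindex finSumFinEquiv finSumFinEquiv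
      (Matrix.fromBlocks (rectConj α a β) 0 0 (0 : Matrix (Fin r) (Fin r) F)) =
      scalarConj (J₁ * α * J₂.conjTranspose) (Matrix.reindex finSumFinEquiv finSumFinEquiv
        (Matrix.fromBlocks (0 : Matrix (Fin m) (Fin m) F) 0 0 a))
        (J₂ * β * J₁.conjTranspose) := by
    have c1 : ∀ (k : Fin m) (l : Fin r), Fin.castAdd r k ≠ Fin.natAdd m l := fun k l h => by
      have := congrArg Fin.val h; simp at this; omega
    ext i j
    refine Fin.addCases (fun i => ?_) (fun i => ?_) i <;>
    refine Fin.addCases (fun j => ?_) (fun j => ?_) j <;>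
    simp [scalarConj, rectConj, Fin.sum_univ_add, Matrix.mul_apply, hJ₁, hJ₂, coordMat_apply,
      c1, (c1 _ _).symm]
  have h1 := OperatorSpace.mnorm_directSum m r (rectConj α a β) (0 : Matrix (Fin r) (Fin r) F)
  have h2 := OperatorSpace.mnorm_directSum m r (0 : Matrix (Fin m) (Fin m) F) a
  rw [mnorm_zero, max_eq_left (zero_le)] at h1
  rw [mnorm_zero, max_eq_right (zero_le)] at h2
  rw [← h1, key, ← h2]
  refine (OperatorSpace.mnorm_scalarConj_le _ _ _ _).trans ?_
  rw [← Matrix.cstar_norm_def, ← Matrix.cstar_norm_def]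
  have hb : ∀ {p q p' q' : ℕ} (A : Matrix (Fin p) (Fin q) ℂ) (B : Matrix (Fin q) (Fin q') ℂ)
      (C : Matrix (Fin p') (Fin q') ℂ), ‖A‖ ≤ 1 → ‖C‖ ≤ 1 → ‖A * B * C.conjTranspose‖ ≤ ‖B‖ := by
    intro p q p' q' A B C hA hC
    refine (Matrix.l2_opNorm_mul _ _).trans ?_
    rw [Matrix.l2_opNorm_conjTranspose]
    refine (mul_le_of_le_one_right (norm_nonneg _) hC).trans ?_
    exact (Matrix.l2_opNorm_mul _ _).trans (mul_le_of_le_one_left (norm_nonneg _) hA)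
  gcongr
  · exact hb _ _ _ n₁ n₂
  · exact hb _ _ _ n₂ n₁

omit [OperatorSpace F] in
theorem rectConj_apply {m r : ℕ} (α : Matrix (Fin m) (Fin r) ℂ)
    (a : Matrix (Fin r) (Fin r) F) (β : Matrix (Fin r) (Fin m) ℂ) (i j : Fin m) :
    rectConj α a β i j = ∑ k, ∑ l, (α i k * β l j) • a k l := rfl

theorem norm_row_le {r : ℕ} (η : Fin r → ℂ) :
    ‖(Matrix.of fun (_ : Fin 1) k => η k : Matrix (Fin 1) (Fin r) ℂ)‖ ≤
      Real.sqrt (∑ k, ‖η k‖ ^ 2) := by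
  refine Real.le_sqrt_of_sq_le ?_
  set A := (Matrix.of fun (_ : Fin 1) k => η k : Matrix (Fin 1) (Fin r) ℂ)
  have h := Matrix.l2_opNorm_conjTranspose_mul_self A.conjTranspose
  rw [Matrix.conjTranspose_conjTranspose, Matrix.l2_opNorm_conjTranspose] at h
  rw [sq, ← h]
  have h2 : A * A.conjTranspose = Matrix.diagonal fun _ => ((∑ k, ‖η k‖ ^ 2 : ℝ) : ℂ) := by
    ext i j
    have hij : i = j := Subsingleton.elim _ _
    subst hij
    simp [A, Matrix.mul_apply, Complex.mul_conj, Complex.normSq_eq_norm_sq]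
  rw [h2, Matrix.l2_opNorm_diagonal]
  refine (pi_norm_le_iff_of_nonneg (by positivity)).2 fun _ => ?_
  rw [Complex.norm_real, Real.norm_of_nonneg (by positivity)]

theorem norm_col_le {r : ℕ} (ξ : Fin r → ℂ) :
    ‖(Matrix.of fun k (_ : Fin 1) => ξ k : Matrix (Fin r) (Fin 1) ℂ)‖ ≤
      Real.sqrt (∑ k, ‖ξ k‖ ^ 2) := by
  have h := norm_row_le (fun k => star (ξ k))
  rw [← Matrix.l2_opNorm_conjTranspose] at h
  simp only [norm_star] at h
  convert! h using 2
  ext i j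
  simp

/-- A scalar compression of `a ∈ M_r(F)` to `F` has norm at most that of `a`. -/
theorem norm_sum_smul_le {r : ℕ} (a : Matrix (Fin r) (Fin r) F) (η ξ : Fin r → ℂ) :
    ‖∑ k, ∑ l, (η k * ξ l) • a k l‖ ≤
      Real.sqrt (∑ k, ‖η k‖ ^ 2) * (OperatorSpace.mnorm r a).toReal *
        Real.sqrt (∑ k, ‖ξ k‖ ^ 2) := by
  have h := mnorm_rectConj_le (Matrix.of fun (_ : Fin 1) k => η k) a
    (Matrix.of fun k (_ : Fin 1) => ξ k)
  rw [OperatorSpace.mnorm_one, rectConj_apply] at h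
  simp only [Matrix.of_apply] at h
  rw [← ENNReal.ofReal_toReal (OperatorSpace.mnorm_ne_top r a),
    ← ENNReal.ofReal_mul (norm_nonneg _), ← ENNReal.ofReal_mul (by positivity),
    ENNReal.ofReal_le_ofReal_iff (by positivity)] at h
  refine h.trans ?_
  gcongr
  · exact norm_row_le η
  · exact norm_col_le ξ

/-- The embedding of `φ ∈ F` as the matrix with single entry `φ` has norm at most `‖φ‖`. -/
theorem mnorm_single_le {m : ℕ} (k l : Fin m) (φ : F) :
    OperatorSpace.mnorm m (Matrix.single k l φ) ≤ ENNReal.ofReal ‖φ‖ := by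
  have h := mnorm_rectConj_le (coordMat fun _ : Fin 1 => k) (Matrix.of fun _ _ : Fin 1 => φ)
    (coordMat fun _ : Fin 1 => l).conjTranspose
  have h1 : rectConj (coordMat fun _ : Fin 1 => k) (Matrix.of fun _ _ : Fin 1 => φ)
    (coordMat fun _ : Fin 1 => l).conjTranspose = Matrix.single k l φ := by
    ext i j
    simp only [rectConj_apply, coordMat_apply, Matrix.conjTranspose_apply, Matrix.single_apply,
      Finset.univ_unique, Finset.sum_singleton, Matrix.of_apply]
    by_cases h1 : i = k <;> by_cases h2 : j = l <;> simp [h1, h2, eq_comm] <;> tauto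
  rw [h1, OperatorSpace.mnorm_one, Matrix.l2_opNorm_conjTranspose] at h
  refine h.trans ?_
  rw [← ENNReal.ofReal_mul (norm_nonneg _), ← ENNReal.ofReal_mul (by positivity)]
  refine ENNReal.ofReal_le_ofReal ?_
  have n1 := norm_coordMat_le (Function.injective_of_subsingleton fun _ : Fin 1 => k)
  have n2 := norm_coordMat_le (Function.injective_of_subsingleton fun _ : Fin 1 => l)
  refine (mul_le_of_le_one_right (by positivity) n2).trans ?_
  exact mul_le_of_le_one_left (norm_nonneg _) n1

variable (F) in
/-- The norm of `M_n(F)` as a seminorm. -/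
def matSeminorm (n : ℕ) : Seminorm ℂ (Matrix (Fin n) (Fin n) F) :=
  Seminorm.of (fun a => (OperatorSpace.mnorm n a).toReal)
    (fun a b => by
      rw [← ENNReal.toReal_add (OperatorSpace.mnorm_ne_top n a) (OperatorSpace.mnorm_ne_top n b)]
      exact ENNReal.toReal_mono (ENNReal.add_ne_top.2
        ⟨OperatorSpace.mnorm_ne_top n a, OperatorSpace.mnorm_ne_top n b⟩)
        (OperatorSpace.mnorm_add_le n a b))
    (fun c a => by
      rw [OperatorSpace.mnorm_smul, ENNReal.toReal_mul, ENNReal.toReal_ofReal (norm_nonneg _)])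

theorem matSeminorm_apply {n : ℕ} (a : Matrix (Fin n) (Fin n) F) :
    matSeminorm F n a = (OperatorSpace.mnorm n a).toReal := rfl

/-- A norming functional of `a ∈ M_n(F)`. -/
theorem exists_dual_matrix {n : ℕ} (a : Matrix (Fin n) (Fin n) F) :
    ∃ G : Matrix (Fin n) (Fin n) F →ₗ[ℂ] ℂ,
      G a = ((OperatorSpace.mnorm n a).toReal : ℂ) ∧
        ∀ b, ‖G b‖ ≤ (OperatorSpace.mnorm n b).toReal := by
  by_cases ha : a = 0
  · subst ha
    exact ⟨0, by simp [mnorm_zero], by simp⟩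
  let f := LinearEquiv.coord ℂ (Matrix (Fin n) (Fin n) F) a ha
  obtain ⟨G, hG, hGn⟩ := Module.Dual.exists_extension_of_le_seminorm (𝕜 := ℂ) (ℂ ∙ a)
    (((matSeminorm F n a : ℝ) : ℂ) • (f : (ℂ ∙ a) →ₗ[ℂ] ℂ)) (p := matSeminorm F n) (by
      rintro ⟨x, hx⟩
      obtain ⟨c, rfl⟩ := Submodule.mem_span_singleton.1 hx
      have : f ⟨c • a, hx⟩ = c := by
        have := LinearEquiv.coord_self ℂ (Matrix (Fin n) (Fin n) F) a ha
        have h2 : (⟨c • a, hx⟩ : (ℂ ∙ a)) = c • ⟨a, Submodule.mem_span_singleton_self a⟩ := rfl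
        rw [h2, map_smul, this]; simp
      simp only [LinearMap.smul_apply, LinearEquiv.coe_coe, this, smul_eq_mul, norm_mul,
        Complex.norm_real, map_smul_eq_mul]
      rw [Real.norm_of_nonneg (apply_nonneg _ _), mul_comm])
  refine ⟨G, ?_, hGn⟩
  have h := hG ⟨a, Submodule.mem_span_singleton_self a⟩
  simp only at h
  rw [h, LinearMap.smul_apply, LinearEquiv.coe_coe, LinearEquiv.coord_self, smul_eq_mul, mul_one,
    matSeminorm_apply]

end RectConj

/-! ### Duality for the matrix norms -/

section Duality
open scoped Matrix.Norms.L2Operator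

open scoped ComplexOrder MatrixOrder in
/-- A positive form on `ℂ^m` of trace at most `1` is dominated by `‖T ζ‖²` for an invertible `T` of
Hilbert-Schmidt norm at most `√2`. The loss of the factor `√2` buys invertibility. -/
theorem exists_isUnit_dominating {m : ℕ} (P : Matrix (Fin m) (Fin m) ℂ)
    (hP : ∀ ζ : Fin m → ℂ, 0 ≤ (∑ i, ∑ j, ζ i * star (ζ j) * P i j).re)
    (htr : (∑ i, P i i).re ≤ 1) :
    ∃ T : Matrix (Fin m) (Fin m) ℂ, IsUnit T ∧ ∑ i, ∑ k, ‖T i k‖ ^ 2 ≤ 2 ∧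
      ∀ ζ : Fin m → ℂ, (∑ i, ∑ j, ζ i * star (ζ j) * P i j).re ≤
        ∑ k, ‖(T.mulVec ζ) k‖ ^ 2 := by
  set R : Matrix (Fin m) (Fin m) ℂ := (1 / 2 : ℂ) • (P.transpose + P.transpose.conjTranspose)
    with hR
  set M : Matrix (Fin m) (Fin m) ℂ := R + (1 / m : ℂ) • 1 with hM
  have hRq : ∀ ζ : Fin m → ℂ, star ζ ⬝ᵥ R.mulVec ζ =
      ((∑ i, ∑ j, ζ i * star (ζ j) * P i j).re : ℂ) := by
    intro ζ
    have e1 : star ζ ⬝ᵥ P.transpose.mulVec ζ = ∑ i, ∑ j, ζ i * star (ζ j) * P i j := by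
      simp only [dotProduct, Matrix.mulVec, Finset.mul_sum, Pi.star_apply, Matrix.transpose_apply]
      rw [Finset.sum_comm]
      exact Finset.sum_congr rfl fun i _ => Finset.sum_congr rfl fun j _ => by ring
    have e2 : star ζ ⬝ᵥ P.transpose.conjTranspose.mulVec ζ =
        star (∑ i, ∑ j, ζ i * star (ζ j) * P i j) := by
      rw [← e1, Matrix.star_dotProduct, Matrix.star_mulVec, Matrix.dotProduct_mulVec,
        Matrix.conjTranspose_conjTranspose]
    rw [hR, Matrix.smul_mulVec, Matrix.add_mulVec, dotProduct_smul, dotProduct_add, e1, e2,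
      Complex.re_eq_add_conj, smul_eq_mul, Complex.star_def]
    ring
  have hζ : ∀ ζ : Fin m → ℂ, star ζ ⬝ᵥ ζ = ((∑ i, ‖ζ i‖ ^ 2 : ℝ) : ℂ) := by
    intro ζ
    simp [dotProduct, Complex.conj_mul']
  have hMq : ∀ ζ : Fin m → ℂ, star ζ ⬝ᵥ M.mulVec ζ =
      (((∑ i, ∑ j, ζ i * star (ζ j) * P i j).re + 1 / m * ∑ i, ‖ζ i‖ ^ 2 : ℝ) : ℂ) := by
    intro ζ
    rw [hM, Matrix.add_mulVec, dotProduct_add, hRq, Matrix.smul_mulVec, Matrix.one_mulVec,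
      dotProduct_smul, hζ]
    push_cast
    simp
  have hMh : M.IsHermitian := by
    refine Matrix.IsHermitian.add ?_ ?_
    · rw [Matrix.IsHermitian, hR, Matrix.conjTranspose_smul, Matrix.conjTranspose_add,
        Matrix.conjTranspose_conjTranspose, add_comm]
      simp
    · rw [Matrix.IsHermitian, Matrix.conjTranspose_smul]
      simp
  have hMpd : M.PosDef := by
    refine Matrix.PosDef.of_dotProduct_mulVec_pos hMh fun ζ hz => ?_
    rw [hMq]
    obtain ⟨i, hi⟩ := Function.ne_iff.1 hz
    have hm : 0 < m := Fin.pos i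
    have : 0 < ∑ i, ‖ζ i‖ ^ 2 := Finset.sum_pos' (fun _ _ => by positivity)
      ⟨i, Finset.mem_univ _, by have := norm_pos_iff.2 hi; positivity⟩
    have h2 := hP ζ
    have : 0 < (∑ i, ∑ j, ζ i * star (ζ j) * P i j).re + 1 / m * ∑ i, ‖ζ i‖ ^ 2 := by positivity
    exact_mod_cast this
  obtain ⟨T, hT⟩ := CStarAlgebra.nonneg_iff_eq_star_mul_self.1
    (Matrix.nonneg_iff_posSemidef.2 hMpd.posSemidef)
  have hTq : ∀ ζ : Fin m → ℂ, star ζ ⬝ᵥ M.mulVec ζ =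
      ((∑ k, ‖(T.mulVec ζ) k‖ ^ 2 : ℝ) : ℂ) := by
    intro ζ
    rw [hT, ← hζ, Matrix.star_eq_conjTranspose, ← Matrix.mulVec_mulVec, Matrix.dotProduct_mulVec,
      ← Matrix.star_mulVec]
  refine ⟨T, ?_, ?_, fun ζ => ?_⟩
  · have h := hMpd.isUnit
    rw [hT, Matrix.isUnit_iff_isUnit_det, Matrix.det_mul] at h
    exact (Matrix.isUnit_iff_isUnit_det _).2 (isUnit_of_mul_isUnit_right h)
  · have h1 : M.trace = ((∑ i, ∑ k, ‖T i k‖ ^ 2 : ℝ) : ℂ) := by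
      rw [hT, Finset.sum_comm]
      simp [Matrix.trace, Matrix.mul_apply, Complex.conj_mul']
    have h2 : M.trace.re ≤ 2 := by
      have : M.trace.re = (∑ i, P i i).re + (1 / m : ℝ) * m := by
        rw [hM, Matrix.trace_add, hR, Matrix.trace_smul, Matrix.trace_add, Matrix.trace_smul,
          Matrix.trace_one, Matrix.trace_conjTranspose, Matrix.trace_transpose]
        have e : P.trace = ∑ i, P i i := rfl
        rw [← e]
        have e3 : (1 / 2 : ℂ) • (P.trace + star P.trace) = (P.trace.re : ℂ) := by
          rw [Complex.re_eq_add_conj, smul_eq_mul, Complex.star_def]; ring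
        have e4 : (1 / m : ℂ) • ((Fintype.card (Fin m) : ℕ) : ℂ) = ((1 / m * m : ℝ) : ℂ) := by
          simp
        rw [e3, e4, Complex.add_re, Complex.ofReal_re, Complex.ofReal_re]
      rw [this]
      have : (1 / m : ℝ) * m ≤ 1 := by
        rw [one_div]; exact inv_mul_le_one
      linarith
    rw [h1, Complex.ofReal_re] at h2
    exact h2
  · have h := (hMq ζ).symm.trans (hTq ζ)
    have h3 := Complex.ofReal_injective h
    rw [← h3]
    have : (0 : ℝ) ≤ 1 / m * ∑ i, ‖ζ i‖ ^ 2 := by positivity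
    linarith

variable {F : Type u} [NormedAddCommGroup F] [NormedSpace ℂ F] [OperatorSpace F]

/-- The set of triples `(αα^*, β^*β, 2 G(α b β))` with `‖b‖ ≤ 1`. It is a convex cone because
`M_r(F)` contains the direct sums of contractions. -/
def productCone {m : ℕ} (G : Matrix (Fin m) (Fin m) F →ₗ[ℂ] ℂ) :
    Set (Matrix (Fin m) (Fin m) ℂ × Matrix (Fin m) (Fin m) ℂ × ℂ) :=
  {w | ∃ (r : ℕ) (α : Matrix (Fin m) (Fin r) ℂ) (b : Matrix (Fin r) (Fin r) F)
    (β : Matrix (Fin r) (Fin m) ℂ), OperatorSpace.mnorm r b ≤ 1 ∧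
      w = (α * α.conjTranspose, β.conjTranspose * β, 2 * G (rectConj α b β))}

theorem productCone_add {m : ℕ} (G : Matrix (Fin m) (Fin m) F →ₗ[ℂ] ℂ)
    {w₁ w₂ : Matrix (Fin m) (Fin m) ℂ × Matrix (Fin m) (Fin m) ℂ × ℂ}
    (h₁ : w₁ ∈ productCone G) (h₂ : w₂ ∈ productCone G) : w₁ + w₂ ∈ productCone G := by
  obtain ⟨r, α, b, β, hb, rfl⟩ := h₁
  obtain ⟨s, α', b', β', hb', rfl⟩ := h₂
  refine ⟨r + s, Matrix.of fun i => Fin.append (α i) (α' i),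
    Matrix.reindex finSumFinEquiv finSumFinEquiv (Matrix.fromBlocks b 0 0 b'),
    Matrix.of fun k j => Fin.append (fun p => β p j) (fun p => β' p j) k, ?_, ?_⟩
  · rw [OperatorSpace.mnorm_directSum]
    exact max_le hb hb'
  · have h3 : rectConj (Matrix.of fun i => Fin.append (α i) (α' i))
        (Matrix.reindex finSumFinEquiv finSumFinEquiv (Matrix.fromBlocks b 0 0 b'))
        (Matrix.of fun k j => Fin.append (fun p => β p j) (fun p => β' p j) k) = rectConj α b β + rectConj α' b' β' := by
      ext i j
      simp [rectConj, Fin.sum_univ_add]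
    rw [h3, map_add, mul_add]
    refine Prod.ext ?_ (Prod.ext ?_ rfl)
    · ext i j
      simp [Matrix.mul_apply, Fin.sum_univ_add]
    · ext i j
      simp [Matrix.mul_apply, Fin.sum_univ_add]

theorem productCone_smul {m : ℕ} (G : Matrix (Fin m) (Fin m) F →ₗ[ℂ] ℂ)
    {w : Matrix (Fin m) (Fin m) ℂ × Matrix (Fin m) (Fin m) ℂ × ℂ}
    (h : w ∈ productCone G) {t : ℝ} (ht : 0 ≤ t) : t • w ∈ productCone G := by
  obtain ⟨r, α, b, β, hb, rfl⟩ := h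
  have hs : ((Real.sqrt t : ℝ) : ℂ) * (Real.sqrt t : ℝ) = t := by
    rw [← Complex.ofReal_mul, Real.mul_self_sqrt ht]
  refine ⟨r, (Real.sqrt t : ℂ) • α, b, (Real.sqrt t : ℂ) • β, hb, ?_⟩
  have h3 : rectConj ((Real.sqrt t : ℂ) • α) b ((Real.sqrt t : ℂ) • β) =
      (t : ℂ) • rectConj α b β := by
    ext i j
    simp only [rectConj, Matrix.smul_apply, Finset.smul_sum, smul_smul, smul_eq_mul]
    refine Finset.sum_congr rfl fun k _ => Finset.sum_congr rfl fun l _ => ?_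
    rw [← hs]; congr 1; ring
  rw [h3, map_smul]
  refine Prod.ext ?_ (Prod.ext ?_ ?_)
  · simp only [Matrix.conjTranspose_smul, Matrix.smul_mul, Matrix.mul_smul, smul_smul,
      Complex.star_def, Complex.conj_ofReal, hs]
    ext i j; simp
  · simp only [Matrix.conjTranspose_smul, Matrix.smul_mul, Matrix.mul_smul, smul_smul,
      Complex.star_def, Complex.conj_ofReal, hs]
    ext i j; simp
  · simp; ring

/-- A contractive functional `G` on `M_m(F)` admits positive forms `P`, `Q` of trace at most `1`
with `2 Re G(α b β) ≤ P(αα^*) + Q(β^*β)` for contractions `b` of every size: separate the cone of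
triples `(αα^*, β^*β, 2 G(α b β))` from the open cone `‖A‖ + ‖B‖ < Re z`. -/
theorem exists_dominating_forms {m : ℕ} (G : Matrix (Fin m) (Fin m) F →ₗ[ℂ] ℂ)
    (hG : ∀ b, ‖G b‖ ≤ (OperatorSpace.mnorm m b).toReal) :
    ∃ P Q : Matrix (Fin m) (Fin m) ℂ, (∑ i, P i i).re ≤ 1 ∧ (∑ i, Q i i).re ≤ 1 ∧
      ∀ (r : ℕ) (α : Matrix (Fin m) (Fin r) ℂ) (b : Matrix (Fin r) (Fin r) F)
        (β : Matrix (Fin r) (Fin m) ℂ), OperatorSpace.mnorm r b ≤ 1 →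
          2 * (G (rectConj α b β)).re ≤
            (∑ i, ∑ j, (α * α.conjTranspose) i j * P i j).re +
              (∑ i, ∑ j, (β.conjTranspose * β) i j * Q i j).re := by
  set U : Set (Matrix (Fin m) (Fin m) ℂ × Matrix (Fin m) (Fin m) ℂ × ℂ) :=
    {w | ‖w.1‖ + ‖w.2.1‖ < w.2.2.re} with hU
  have hUo : IsOpen U := by
    refine isOpen_lt ?_ ?_
    · exact (continuous_fst.norm).add ((continuous_fst.comp continuous_snd).norm)
    · exact Complex.continuous_re.comp (continuous_snd.comp continuous_snd)
  have hUc : Convex ℝ U := by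
    intro x hx y hy a b ha hb hab
    simp only [hU, Set.mem_ofPred_eq, Prod.fst_add, Prod.snd_add, Prod.smul_fst, Prod.smul_snd,
      Complex.add_re, Complex.real_smul, Complex.re_ofReal_mul] at hx hy ⊢
    have h1 := norm_add_le (a • x.1) (b • y.1)
    have h2 := norm_add_le (a • x.2.1) (b • y.2.1)
    have e : ∀ (t : ℝ) (_ : 0 ≤ t) (A : Matrix (Fin m) (Fin m) ℂ), ‖t • A‖ = t * ‖A‖ := by
      intro t ht A
      have : t • A = (t : ℂ) • A := by ext i j; simp
      rw [this, norm_smul, Complex.norm_real, Real.norm_of_nonneg ht]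
    rw [e a ha, e b hb] at h1 h2
    rcases ha.eq_or_lt with rfl | ha'
    · have : b = 1 := by linarith
      subst this
      linarith
    · nlinarith
  have hCc : Convex ℝ (productCone G) := fun x hx y hy a b ha hb _ =>
    productCone_add G (productCone_smul G hx ha) (productCone_smul G hy hb)
  have hdisj : Disjoint U (productCone G) := by
    refine Set.disjoint_left.2 ?_
    rintro _ hw ⟨r, α, b, β, hb, rfl⟩
    simp only [hU, Set.mem_ofPred_eq] at hw
    have h1 : ‖α * α.conjTranspose‖ = ‖α‖ * ‖α‖ := by
      have := Matrix.l2_opNorm_conjTranspose_mul_self α.conjTranspose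
      rwa [Matrix.conjTranspose_conjTranspose, Matrix.l2_opNorm_conjTranspose] at this
    rw [h1, Matrix.l2_opNorm_conjTranspose_mul_self] at hw
    have h2 : (G (rectConj α b β)).re ≤ ‖α‖ * ‖β‖ := by
      refine (Complex.re_le_norm _).trans ((hG _).trans ?_)
      refine ENNReal.toReal_le_of_le_ofReal (by positivity) ((mnorm_rectConj_le α b β).trans ?_)
      rw [ENNReal.ofReal_mul (norm_nonneg _)]
      gcongr
      exact mul_le_of_le_one_right zero_le hb
    have h3 : (2 * G (rectConj α b β)).re = 2 * (G (rectConj α b β)).re := by simp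
    rw [h3] at hw
    nlinarith [sq_nonneg (‖α‖ - ‖β‖)]
  obtain ⟨f, u, hfU, hfC⟩ := RCLike.geometric_hahn_banach_open (𝕜 := ℂ) hUc hUo hCc hdisj
  simp only [RCLike.re_to_complex] at hfU hfC
  have h0C : (0 : Matrix (Fin m) (Fin m) ℂ × Matrix (Fin m) (Fin m) ℂ × ℂ) ∈ productCone G :=
    ⟨0, 0, 0, 0, by simp [mnorm_zero], by
      refine Prod.ext ?_ (Prod.ext ?_ ?_)
      · simp
      · simp
      · have : rectConj (0 : Matrix (Fin m) (Fin 0) ℂ) (0 : Matrix (Fin 0) (Fin 0) F) 0 = 0 := by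
          ext i j; simp [rectConj]
        simp [this]⟩
  have hu : u ≤ 0 := by simpa using hfC 0 h0C
  have hfsm : ∀ (t : ℝ) w, (f (t • w)).re = t * (f w).re := by
    intro t w
    have : t • w = (t : ℂ) • w := by
      refine Prod.ext ?_ (Prod.ext ?_ ?_)
      · ext i j; simp
      · ext i j; simp
      · simp
    rw [this, map_smul, smul_eq_mul, Complex.re_ofReal_mul]
  have hC0 : ∀ w ∈ productCone G, 0 ≤ (f w).re := by
    intro w hw
    by_contra! hneg
    have h1 := hfC _ (productCone_smul G hw (t := (u - 1) / (f w).re)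
      (div_nonneg_of_nonpos (by linarith) hneg.le))
    rw [hfsm, div_mul_cancel₀ _ hneg.ne] at h1
    linarith
  -- the open cone is unbounded in imaginary directions, so `z ↦ f (0, 0, z)` has a real negative
  -- coefficient; dividing by it normalizes the traces of the forms `P` and `Q`
  set γ : ℂ := f (0, 0, 1) with hγ
  have hfz : ∀ z : ℂ, f (0, 0, z) = z * γ := by
    intro z
    rw [hγ, ← smul_eq_mul, ← map_smul]
    simp
  have hγr : ∀ s : ℝ, γ.re - s * γ.im < 0 := by
    intro s
    have h := hfU (0, 0, ⟨1, s⟩) (by simp [hU])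
    rw [hfz, Complex.mul_re] at h
    simp only [one_mul] at h
    linarith
  have hγi : γ.im = 0 := by
    by_contra hne
    have h := hγr (γ.re / γ.im)
    rw [div_mul_cancel₀ _ hne] at h
    linarith
  have hg : 0 < -γ.re := by
    have := hγr 0
    linarith
  set g : ℝ := -γ.re with hgdef
  have hAB : ∀ A B : Matrix (Fin m) (Fin m) ℂ, (f (A, B, 0)).re ≤ (‖A‖ + ‖B‖) * g := by
    intro A B
    refine le_of_forall_pos_le_add fun ε hε => ?_
    have h := hfU (A, B, ((‖A‖ + ‖B‖ + ε / g : ℝ) : ℂ)) (by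
      simp only [hU, Set.mem_ofPred_eq, Complex.ofReal_re]
      have : 0 < ε / g := by positivity
      linarith)
    have e : (A, B, ((‖A‖ + ‖B‖ + ε / g : ℝ) : ℂ)) =
      (A, B, (0 : ℂ)) + (0, 0, ((‖A‖ + ‖B‖ + ε / g : ℝ) : ℂ)) := by simp
    rw [e, map_add, hfz, Complex.add_re, Complex.re_ofReal_mul] at h
    have : γ.re = -g := by rw [hgdef]; ring
    rw [this] at h
    have h5 : ε / g * g = ε := div_mul_cancel₀ _ hg.ne'
    nlinarith
  have hone : ‖(1 : Matrix (Fin m) (Fin m) ℂ)‖ ≤ 1 := by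
    rw [Matrix.cstar_norm_def, map_one]
    exact ContinuousLinearMap.norm_id_le
  have hsum1 : ∀ A : Matrix (Fin m) (Fin m) ℂ, f (A, 0, 0) =
      ∑ i, ∑ j, A i j * f (Matrix.single i j 1, 0, 0) := by
    intro A
    let L : Matrix (Fin m) (Fin m) ℂ →ₗ[ℂ] ℂ :=
      f.toLinearMap ∘ₗ LinearMap.inl ℂ _ _
    have h : L A = ∑ i, ∑ j, A i j * L (Matrix.single i j 1) := by
      conv_lhs => rw [Matrix.matrix_eq_sum_single A]
      simp only [map_sum]
      refine Finset.sum_congr rfl fun i _ => Finset.sum_congr rfl fun j _ => ?_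
      rw [← smul_eq_mul (A i j), ← map_smul, Matrix.smul_single, smul_eq_mul, mul_one]
    exact h
  have hsum2 : ∀ A : Matrix (Fin m) (Fin m) ℂ, f (0, A, 0) =
      ∑ i, ∑ j, A i j * f (0, Matrix.single i j 1, 0) := by
    intro A
    let L : Matrix (Fin m) (Fin m) ℂ →ₗ[ℂ] ℂ :=
      f.toLinearMap ∘ₗ LinearMap.inr ℂ _ _ ∘ₗ LinearMap.inl ℂ _ _
    have h : L A = ∑ i, ∑ j, A i j * L (Matrix.single i j 1) := by
      conv_lhs => rw [Matrix.matrix_eq_sum_single A]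
      simp only [map_sum]
      refine Finset.sum_congr rfl fun i _ => Finset.sum_congr rfl fun j _ => ?_
      rw [← smul_eq_mul (A i j), ← map_smul, Matrix.smul_single, smul_eq_mul, mul_one]
    exact h
  have hgc : ((g : ℝ) : ℂ)⁻¹ = ((g⁻¹ : ℝ) : ℂ) := by simp
  refine ⟨fun i j => (g : ℂ)⁻¹ * f (Matrix.single i j 1, 0, 0),
    fun i j => (g : ℂ)⁻¹ * f (0, Matrix.single i j 1, 0), ?_, ?_, ?_⟩
  · have h1 : (∑ i, (g : ℂ)⁻¹ * f (Matrix.single i i 1, 0, 0)) = (g : ℂ)⁻¹ * f (1, 0, 0) := by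
      rw [hsum1, ← Finset.mul_sum]
      simp [Matrix.one_apply]
    rw [h1, hgc, Complex.re_ofReal_mul]
    have h2 := hAB 1 0
    rw [norm_zero, add_zero] at h2
    rw [inv_mul_le_iff₀ hg]
    nlinarith
  · have h1 : (∑ i, (g : ℂ)⁻¹ * f (0, Matrix.single i i 1, 0)) = (g : ℂ)⁻¹ * f (0, 1, 0) := by
      rw [hsum2, ← Finset.mul_sum]
      simp [Matrix.one_apply]
    rw [h1, hgc, Complex.re_ofReal_mul]
    have h2 := hAB 0 1
    rw [norm_zero, zero_add] at h2
    rw [inv_mul_le_iff₀ hg]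
    nlinarith
  · intro r α b β hb
    have h := hC0 _ ⟨r, α, b, β, hb, rfl⟩
    have e : (α * α.conjTranspose, β.conjTranspose * β, 2 * G (rectConj α b β)) =
      (α * α.conjTranspose, (0 : Matrix (Fin m) (Fin m) ℂ), (0 : ℂ)) +
        ((0, β.conjTranspose * β, 0) + (0, 0, 2 * G (rectConj α b β))) := by simp
    rw [e, map_add, map_add, hfz, hsum1, hsum2, Complex.add_re, Complex.add_re, Complex.mul_re,
      hγi, mul_zero, sub_zero] at h
    have h3 : (2 * G (rectConj α b β)).re = 2 * (G (rectConj α b β)).re := by simp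
    have h4 : γ.re = -g := by rw [hgdef]; ring
    rw [h3, h4] at h
    simp only [mul_left_comm _ (g : ℂ)⁻¹, ← Finset.mul_sum]
    rw [hgc, Complex.re_ofReal_mul, Complex.re_ofReal_mul, ← mul_add, inv_mul_eq_div,
      le_div_iff₀ hg]
    linarith

/-- The functional `φ ↦ G (φ ⊗ e_kl)` as a bounded functional on `F`. -/
def entryFunctional {m : ℕ} (G : Matrix (Fin m) (Fin m) F →ₗ[ℂ] ℂ)
    (hG : ∀ b, ‖G b‖ ≤ (OperatorSpace.mnorm m b).toReal) (k l : Fin m) : StrongDual ℂ F :=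
  LinearMap.mkContinuous
    { toFun := fun φ => G (Matrix.single k l φ)
      map_add' := fun φ ψ => by rw [Matrix.single_add, map_add]
      map_smul' := fun c φ => by rw [← Matrix.smul_single, map_smul, RingHom.id_apply] } 1
    (fun φ => by
      rw [one_mul]
      exact (hG _).trans (ENNReal.toReal_le_of_le_ofReal (norm_nonneg _) (mnorm_single_le k l φ)))

omit [OperatorSpace F] in
theorem map_rectConj_eq {m r : ℕ} (G : Matrix (Fin m) (Fin m) F →ₗ[ℂ] ℂ)
    (α : Matrix (Fin m) (Fin r) ℂ) (b : Matrix (Fin r) (Fin r) F)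
    (β : Matrix (Fin r) (Fin m) ℂ) :
    G (rectConj α b β) = ∑ s, ∑ t, (fun k => α k s) ⬝ᵥ
      (Matrix.of fun k l => G (Matrix.single k l (b s t))).mulVec (β t) := by
  have h : rectConj α b β =
      ∑ s, ∑ t, ∑ k, ∑ l, (α k s * β t l) • Matrix.single k l (b s t) := by
    ext i j
    simp [rectConj, Matrix.sum_apply, Matrix.single_apply, ite_and]
  rw [h]
  simp only [map_sum, map_smul, smul_eq_mul, dotProduct, Matrix.mulVec, Matrix.of_apply,
    Finset.mul_sum]
  refine Finset.sum_congr rfl fun s _ => Finset.sum_congr rfl fun t _ =>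
    Finset.sum_congr rfl fun k _ => Finset.sum_congr rfl fun l _ => by ring

theorem opNorm_le_one_of_two_mul_sq_le {H : Type*} [NormedAddCommGroup H] [InnerProductSpace ℂ H]
    (A : H →L[ℂ] H) (h : ∀ v, 2 * ‖A v‖ ^ 2 ≤ ‖A v‖ ^ 2 + ‖v‖ ^ 2) : ‖A‖ ≤ 1 := by
  refine ContinuousLinearMap.opNorm_le_bound _ zero_le_one fun v => ?_
  rw [one_mul]
  have := h v
  exact le_of_sq_le_sq (by linarith) (norm_nonneg _)

/-- The value `[X i j φ] ∈ M_m` at `φ` of a matrix `X` of functionals. -/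
def evalMat {m : ℕ} (X : Matrix (Fin m) (Fin m) (StrongDual ℂ F)) (φ : F) :
    EuclideanSpace ℂ (Fin m) →L[ℂ] EuclideanSpace ℂ (Fin m) :=
  Matrix.toEuclideanCLM (𝕜 := ℂ) (Matrix.of fun i j => X i j φ)

omit [OperatorSpace F] in
theorem evalMat_apply {m : ℕ} (X : Matrix (Fin m) (Fin m) (StrongDual ℂ F)) (φ : F)
    (v : EuclideanSpace ℂ (Fin m)) (i : Fin m) :
    evalMat X φ v i = ∑ j, X i j φ * v j := rfl

theorem blockOp_le_dualMatNorm {m r : ℕ} (X : Matrix (Fin m) (Fin m) (StrongDual ℂ F))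
    {a : Matrix (Fin r) (Fin r) F} (ha : OperatorSpace.mnorm r a ≤ 1) :
    ENNReal.ofReal ‖blockOp (a.map (evalMat X))‖ ≤ dualMatNorm F m X :=
  le_iSup_of_le r (le_iSup_of_le a (le_iSup_of_le ha le_rfl))

theorem dualMatNorm_le {m : ℕ} (X : Matrix (Fin m) (Fin m) (StrongDual ℂ F)) {C : ℝ≥0∞}
    (h : ∀ (r : ℕ) (a : Matrix (Fin r) (Fin r) F), OperatorSpace.mnorm r a ≤ 1 →
      ENNReal.ofReal ‖blockOp (a.map (evalMat X))‖ ≤ C) : dualMatNorm F m X ≤ C :=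
  iSup_le fun r => iSup_le fun a => iSup_le fun ha => h r a ha

/-- Ruan's duality, up to a factor `2`: the norm of `a ∈ M_m(F)` is attained by a complete
contraction `X : F → M_m` and two vectors `T`, `S` of `ℂ^m ⊗ ℂ^m` of norm at most `√2`. -/
theorem exists_dual_norming {m : ℕ} (a : Matrix (Fin m) (Fin m) F) :
    ∃ X : Matrix (Fin m) (Fin m) (StrongDual ℂ F), dualMatNorm F m X ≤ 1 ∧
      ∃ T S : Matrix (Fin m) (Fin m) ℂ, ∑ i, ∑ k, ‖T i k‖ ^ 2 ≤ 2 ∧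
        ∑ i, ∑ k, ‖S i k‖ ^ 2 ≤ 2 ∧
        ∑ k, ∑ l, ∑ i, ∑ j, T i k * S j l * X i j (a k l) =
          ((OperatorSpace.mnorm m a).toReal : ℂ) := by
  obtain ⟨G, hGa, hG⟩ := exists_dual_matrix a
  obtain ⟨P, Q, hP, hQ, hPQ⟩ := exists_dominating_forms G hG
  have hPpos : ∀ ζ : Fin m → ℂ, 0 ≤ (∑ i, ∑ j, ζ i * star (ζ j) * P i j).re := by
    intro ζ
    have h := hPQ 1 (Matrix.of fun i _ => ζ i) 0 0 (by simp [mnorm_zero])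
    have e : rectConj (Matrix.of fun i (_ : Fin 1) => ζ i) (0 : Matrix (Fin 1) (Fin 1) F) 0 =
      0 := by ext i j; simp [rectConj]
    simpa [e, Matrix.mul_apply] using h
  have hQpos : ∀ ζ : Fin m → ℂ,
      0 ≤ (∑ i, ∑ j, ζ i * star (ζ j) * Q.transpose i j).re := by
    intro ζ
    have h := hPQ 1 0 0 (Matrix.of fun _ i => ζ i) (by simp [mnorm_zero])
    have e : rectConj (0 : Matrix (Fin m) (Fin 1) ℂ) (0 : Matrix (Fin 1) (Fin 1) F)
      (Matrix.of fun _ i => ζ i) = 0 := by ext i j; simp [rectConj]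
    rw [Finset.sum_comm]
    simpa [e, Matrix.mul_apply, mul_comm] using h
  obtain ⟨T, hTu, hT2, hT⟩ := exists_isUnit_dominating P hPpos hP
  obtain ⟨S, hSu, hS2, hS⟩ := exists_isUnit_dominating Q.transpose hQpos hQ
  have hT1 : T * T⁻¹ = 1 := Matrix.mul_nonsing_inv _ ((Matrix.isUnit_iff_isUnit_det _).1 hTu)
  have hS1 : S * S⁻¹ = 1 := Matrix.mul_nonsing_inv _ ((Matrix.isUnit_iff_isUnit_det _).1 hSu)
  have hT1' : T⁻¹ * T = 1 := Matrix.nonsing_inv_mul _ ((Matrix.isUnit_iff_isUnit_det _).1 hTu)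
  have hS1' : S⁻¹ * S = 1 := Matrix.nonsing_inv_mul _ ((Matrix.isUnit_iff_isUnit_det _).1 hSu)
  set Gm : F → Matrix (Fin m) (Fin m) ℂ :=
    fun φ => Matrix.of fun k l => G (Matrix.single k l φ) with hGm
  -- the map `X` is the matrix of `G`, renormalized by the forms which dominate `G`
  set X : Matrix (Fin m) (Fin m) (StrongDual ℂ F) := Matrix.of fun i j =>
    ∑ k, ∑ l, (T⁻¹ k i * S⁻¹ l j) • entryFunctional G hG k l with hX
  have hXφ : ∀ φ, (Matrix.of fun i j => X i j φ) = T⁻¹.transpose * Gm φ * S⁻¹ := by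
    intro φ
    ext i j
    have : ∀ k l, entryFunctional G hG k l φ = Gm φ k l := fun k l => rfl
    simp only [hX, Matrix.of_apply, sum_apply, smul_apply,
      this, Matrix.mul_apply, Matrix.transpose_apply, Finset.sum_mul, smul_eq_mul]
    rw [Finset.sum_comm]
    refine Finset.sum_congr rfl fun l _ => Finset.sum_congr rfl fun k _ => by ring
  refine ⟨X, ?_, T, S, hT2, hS2, ?_⟩
  · refine dualMatNorm_le X fun r b hb => ?_
    rw [ENNReal.ofReal_le_one]
    refine opNorm_le_one_of_two_mul_sq_le _ fun v => ?_
    set A := blockOp (b.map (evalMat X)) with hA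
    set w := A v with hw
    -- with these columns of `α` and rows of `β`, `G (α b β)` is `⟪A v, A v⟫`, while the dominating
    -- forms take the values `‖A v‖²` and `‖v‖²`
    set α : Matrix (Fin m) (Fin r) ℂ :=
      Matrix.of fun k s => (T⁻¹.mulVec (fun i => star (w s i))) k with hα
    set β : Matrix (Fin r) (Fin m) ℂ := Matrix.of fun t => S⁻¹.mulVec (fun j => v t j) with hβ
    have hwst : ∀ s, (fun i => w s i) =
        ∑ t, (T⁻¹.transpose * Gm (b s t) * S⁻¹).mulVec (fun j => v t j) := by
      intro s
      ext i
      rw [hw, hA, blockOp_apply, Finset.sum_apply, WithLp.ofLp_sum, Finset.sum_apply]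
      refine Finset.sum_congr rfl fun t _ => ?_
      rw [← hXφ]
      rfl
    have hnw : ((‖w‖ ^ 2 : ℝ) : ℂ) = G (rectConj α b β) := by
      rw [map_rectConj_eq]
      have h1 : ((‖w‖ ^ 2 : ℝ) : ℂ) = ∑ s, (fun i => star (w s i)) ⬝ᵥ (fun i => w s i) := by
        rw [PiLp.norm_sq_eq_of_L2]
        push_cast
        refine Finset.sum_congr rfl fun s _ => ?_
        rw [← Complex.ofReal_pow, EuclideanSpace.norm_sq_eq]
        simp [dotProduct, Complex.conj_mul']
      rw [h1]
      refine Finset.sum_congr rfl fun s _ => ?_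
      rw [hwst s, dotProduct_sum]
      refine Finset.sum_congr rfl fun t _ => ?_
      have e1 : (fun k => α k s) = T⁻¹.mulVec (fun i => star (w s i)) := rfl
      have e2 : β t = S⁻¹.mulVec (fun j => v t j) := rfl
      have e3 : (Matrix.of fun k l => G (Matrix.single k l (b s t))) = Gm (b s t) := rfl
      rw [e1, e2, e3, ← Matrix.mulVec_mulVec, ← Matrix.mulVec_mulVec, Matrix.dotProduct_mulVec,
        Matrix.vecMul_transpose]
    have h := hPQ r α b β hb
    rw [← hnw, Complex.ofReal_re] at h
    refine h.trans (add_le_add ?_ ?_)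
    · have e : (∑ i, ∑ j, (α * α.conjTranspose) i j * P i j) =
          ∑ s, ∑ i, ∑ j, α i s * star (α j s) * P i j := by
        simp only [Matrix.mul_apply, Matrix.conjTranspose_apply, Finset.sum_mul]
        rw [Finset.sum_comm]
        refine Eq.trans (Finset.sum_congr rfl fun i _ => Finset.sum_comm) ?_
        rw [Finset.sum_comm]
        refine Finset.sum_congr rfl fun s _ => Finset.sum_comm
      rw [e, Complex.re_sum, PiLp.norm_sq_eq_of_L2]
      refine Finset.sum_le_sum fun s _ => (hT fun k => α k s).trans ?_
      have e1 : (fun k => α k s) = T⁻¹.mulVec (fun i => star (w s i)) := rfl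
      rw [e1, Matrix.mulVec_mulVec, hT1, Matrix.one_mulVec, EuclideanSpace.norm_sq_eq]
      simp
    · have e : (∑ i, ∑ j, (β.conjTranspose * β) i j * Q i j) =
          ∑ t, ∑ i, ∑ j, β t i * star (β t j) * Q.transpose i j := by
        simp only [Matrix.mul_apply, Matrix.conjTranspose_apply, Finset.sum_mul,
          Matrix.transpose_apply]
        refine Eq.trans (Finset.sum_congr rfl fun i _ => Finset.sum_comm) ?_
        rw [Finset.sum_comm]
        refine Finset.sum_congr rfl fun s _ => ?_
        rw [Finset.sum_comm]
        refine Finset.sum_congr rfl fun i _ => Finset.sum_congr rfl fun j _ => ?_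
        ring
      rw [e, Complex.re_sum, PiLp.norm_sq_eq_of_L2]
      refine Finset.sum_le_sum fun t _ => (hS fun l => β t l).trans ?_
      have e1 : (fun l => β t l) = S⁻¹.mulVec (fun j => v t j) := rfl
      rw [e1, Matrix.mulVec_mulVec, hS1, Matrix.one_mulVec, EuclideanSpace.norm_sq_eq]
  · rw [← hGa]
    have e : ∀ k l, ∑ i, ∑ j, T i k * S j l * X i j (a k l) = G (Matrix.single k l (a k l)) := by
      intro k l
      have h1 : (T.transpose * (Matrix.of fun i j => X i j (a k l)) * S) = Gm (a k l) := by
        rw [hXφ, ← Matrix.mul_assoc, ← Matrix.mul_assoc, ← Matrix.transpose_mul, hT1',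
          Matrix.transpose_one, Matrix.one_mul, Matrix.mul_assoc, hS1', Matrix.mul_one]
      have h2 := congrFun (congrFun h1 k) l
      refine Eq.trans ?_ h2
      simp only [Matrix.mul_apply, Matrix.transpose_apply, Matrix.of_apply, Finset.sum_mul]
      rw [Finset.sum_comm]
      refine Finset.sum_congr rfl fun i _ => Finset.sum_congr rfl fun j _ => by ring
    simp only [e]
    conv_rhs => rw [Matrix.matrix_eq_sum_single a]
    simp only [map_sum]

end Duality

/-! ### Hilbert space sums -/

section HilbertSums
open scoped Classical

variable {N : Type w} {H : Type*} [NormedAddCommGroup H] [InnerProductSpace ℂ H]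

theorem mem_of_forall_single_mem {S : Submodule ℂ (L2Sum N H)} (hS : IsClosed (S : Set (L2Sum N H)))
    (h : ∀ k ζ, lp.single 2 k ζ ∈ S) (ξ : L2Sum N H) : ξ ∈ S :=
  hS.mem_of_tendsto (lp.hasSum_single ENNReal.ofNat_ne_top ξ)
    (Filter.Eventually.of_forall fun _ => S.sum_mem fun k _ => h k _)

theorem single_eq_smul_stdVec {ι : Type*} (i : ι) (c : ℂ) :
    (lp.single 2 i c : L2 ι) = c • stdVec i := by
  rw [stdVec, ← lp.single_smul, smul_eq_mul, mul_one]

theorem mem_of_forall_stdVec_mem {ι : Type*} {S : Submodule ℂ (L2 ι)}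
    (hS : IsClosed (S : Set (L2 ι))) (h : ∀ i, stdVec i ∈ S) (ξ : L2 ι) : ξ ∈ S :=
  mem_of_forall_single_mem hS (fun i c => by
    rw [single_eq_smul_stdVec]; exact S.smul_mem _ (h i)) ξ

theorem closure_span_stdVec (ι : Type*) :
    (Submodule.span ℂ (Set.range (stdVec : ι → L2 ι))).topologicalClosure = ⊤ :=
  eq_top_iff.2 fun ξ _ => mem_of_forall_stdVec_mem (Submodule.isClosed_topologicalClosure _)
    (fun i => Submodule.le_topologicalClosure _ (Submodule.subset_span (Set.mem_range_self i))) ξ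

variable (N H) in
theorem closure_span_single :
    (Submodule.span ℂ (Set.range fun p : N × H =>
      (lp.single 2 p.1 p.2 : L2Sum N H))).topologicalClosure = ⊤ :=
  eq_top_iff.2 fun ξ _ => mem_of_forall_single_mem (Submodule.isClosed_topologicalClosure _)
    (fun k ζ => Submodule.le_topologicalClosure _ (Submodule.subset_span
      (Set.mem_range_self (f := fun p : N × H => (lp.single 2 p.1 p.2 : L2Sum N H)) (k, ζ)))) ξ

theorem inner_stdVec_left {ι : Type*} (i : ι) (ξ : L2 ι) : ⟪(stdVec i : L2 ι), ξ⟫_ℂ = ξ i := by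
  rw [stdVec, lp.inner_single_left]; simp

theorem stdVec_apply {ι : Type*} (i j : ι) :
    (stdVec i : L2 ι) j = if j = i then 1 else 0 := by
  rw [stdVec, lp.single_apply, Pi.single_apply]

omit [InnerProductSpace ℂ H] in
theorem hasSum_norm_sq (ξ : L2Sum N H) : HasSum (fun k => ‖ξ k‖ ^ 2) (‖ξ‖ ^ 2) := by
  have h := lp.hasSum_norm (p := 2) (by norm_num) ξ
  simpa using h

omit [InnerProductSpace ℂ H] in
theorem sum_norm_sq_le (ξ : L2Sum N H) (s : Finset N) : ∑ k ∈ s, ‖ξ k‖ ^ 2 ≤ ‖ξ‖ ^ 2 :=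
  sum_le_hasSum s (fun _ _ => by positivity) (hasSum_norm_sq ξ)

theorem norm_stdVec {ι : Type*} (i : ι) : ‖(stdVec i : L2 ι)‖ = 1 := by
  rw [stdVec, lp.norm_single (by norm_num)]; simp

/-- The embedding of the `k`-th summand in a Hilbert space sum. -/
abbrev inclCLM (H : Type*) [NormedAddCommGroup H] [InnerProductSpace ℂ H] (k : N) :
    H →L[ℂ] L2Sum N H :=
  lp.singleContinuousLinearMap ℂ (fun _ : N => H) 2 k

/-- The projection onto the `k`-th summand in a Hilbert space sum. -/
abbrev coordCLM (H : Type*) [NormedAddCommGroup H] [InnerProductSpace ℂ H] (k : N) :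
    L2Sum N H →L[ℂ] H :=
  lp.evalCLM ℂ (fun _ : N => H) 2 k

omit [InnerProductSpace ℂ H] in
theorem coord_single (k l : N) (ζ : H) :
    (lp.single 2 l ζ : L2Sum N H) k = if k = l then ζ else 0 := by
  rw [lp.single_apply]
  by_cases h : k = l
  · subst h; simp
  · simp [h]

/-- The embedding of a finite sum in `ℓ²(N) ⊗ H` along an injection. -/
def finIncl {m : ℕ} (e : Fin m ↪ N) : PiLp 2 (fun _ : Fin m => H) →L[ℂ] L2Sum N H :=
  ∑ i, inclCLM H (e i) ∘L PiLp.proj 2 (fun _ : Fin m => H) i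

theorem finIncl_apply {m : ℕ} (e : Fin m ↪ N) (ξ : PiLp 2 (fun _ : Fin m => H)) :
    finIncl e ξ = ∑ i, lp.single 2 (e i) (ξ i) := by
  simp [finIncl]

theorem finIncl_coord {m : ℕ} (e : Fin m ↪ N) (ξ : PiLp 2 (fun _ : Fin m => H)) (i : Fin m) :
    finIncl e ξ (e i) = ξ i := by
  rw [finIncl_apply, lp.coeFn_sum, Finset.sum_apply]
  simp [Pi.single_apply]

theorem norm_finIncl {m : ℕ} (e : Fin m ↪ N) (ξ : PiLp 2 (fun _ : Fin m => H)) :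
    ‖finIncl e ξ‖ = ‖ξ‖ := by
  rw [← sq_eq_sq₀ (norm_nonneg _) (norm_nonneg _), PiLp.norm_sq_eq_of_L2]
  refine (hasSum_norm_sq _).unique ?_
  have h : ∀ k ∉ Finset.univ.map e, ‖finIncl e ξ k‖ ^ 2 = 0 := by
    intro k hk
    rw [finIncl_apply, lp.coeFn_sum, Finset.sum_apply, Finset.sum_eq_zero]
    · simp
    · intro i _
      rw [coord_single, if_neg]
      rintro rfl
      exact hk (by simp)
  have h2 := hasSum_sum_of_ne_finset_zero (L := .unconditional N) h
  rw [Finset.sum_map] at h2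
  simpa only [finIncl_coord] using h2

/-- The restriction of elements of `ℓ²(N) ⊗ H` to finitely many coordinates. -/
def finProj {m : ℕ} (e : Fin m ↪ N) : L2Sum N H →L[ℂ] PiLp 2 (fun _ : Fin m => H) :=
  ((PiLp.continuousLinearEquiv 2 ℂ (fun _ : Fin m => H)).symm :
      (∀ _ : Fin m, H) →L[ℂ] PiLp 2 (fun _ : Fin m => H)) ∘L
    ContinuousLinearMap.pi (fun i => coordCLM H (e i))

theorem finProj_apply {m : ℕ} (e : Fin m ↪ N) (ξ : L2Sum N H) (i : Fin m) :
    finProj e ξ i = ξ (e i) := rfl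

theorem norm_finProj_le {m : ℕ} (e : Fin m ↪ N) (ξ : L2Sum N H) : ‖finProj e ξ‖ ≤ ‖ξ‖ := by
  rw [← sq_le_sq₀ (norm_nonneg _) (norm_nonneg _), PiLp.norm_sq_eq_of_L2]
  have h := sum_norm_sq_le ξ (Finset.univ.map e)
  rw [Finset.sum_map] at h
  exact h

/-- Finite submatrices of an operator matrix on `ℓ²(N) ⊗ H` are bounded by its norm. -/
theorem norm_blockOp_le_of_entries {m : ℕ} (e : Fin m ↪ N) (T : L2Sum N H →L[ℂ] L2Sum N H)
    (B : Matrix (Fin m) (Fin m) (H →L[ℂ] H))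
    (hB : ∀ i j ζ, B i j ζ = T (lp.single 2 (e j) ζ) (e i)) : ‖blockOp B‖ ≤ ‖T‖ := by
  refine ContinuousLinearMap.opNorm_le_bound _ (ContinuousLinearMap.opNorm_nonneg _) fun ξ => ?_
  have h : blockOp B ξ = finProj e (T (finIncl e ξ)) := by
    ext i
    rw [blockOp_apply, finProj_apply, finIncl_apply, map_sum, lp.coeFn_sum, Finset.sum_apply]
    simp only [hB]
  rw [h]
  refine (norm_finProj_le e _).trans ((T.le_opNorm _).trans_eq ?_)
  rw [norm_finIncl]

theorem ampl_single {H' : Type*} [NormedAddCommGroup H'] [InnerProductSpace ℂ H']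
    (b : H →L[ℂ] H') (k : N) (ζ : H) :
    ampl N b (lp.single 2 k ζ) = lp.single 2 k (b ζ) := by
  ext l
  rw [ampl_apply, coord_single, coord_single]
  split_ifs <;> simp

theorem inner_ampl_left {H' : Type*} [NormedAddCommGroup H'] [InnerProductSpace ℂ H']
    [CompleteSpace H] [CompleteSpace H'] (b : H →L[ℂ] H') (ξ : L2Sum N H) (η : L2Sum N H') :
    ⟪ampl N b ξ, η⟫_ℂ = ⟪ξ, ampl N (ContinuousLinearMap.adjoint b) η⟫_ℂ := by
  rw [lp.inner_eq_tsum, lp.inner_eq_tsum]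
  refine tsum_congr fun k => ?_
  rw [ampl_apply, ampl_apply, ContinuousLinearMap.adjoint_inner_right]

end HilbertSums

/-! ### The weak* topology of `B(H)` -/

section Predual

variable {H : Type*} [NormedAddCommGroup H] [InnerProductSpace ℂ H]

/-- A closed space of functionals on `B(H)` contains all normal functionals as soon as it contains
the vector functionals of a total set of vectors. -/
theorem opPredual_le_of_total {D : Set H}
    (hD : (Submodule.span ℂ D).topologicalClosure = ⊤)
    {S : Submodule ℂ (StrongDual ℂ (H →L[ℂ] H))}
    (hS : IsClosed (S : Set (StrongDual ℂ (H →L[ℂ] H))))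
    (h : ∀ η ∈ D, ∀ ξ ∈ D, vecFunctional η ξ ∈ S) : opPredual H ≤ S := by
  refine Submodule.topologicalClosure_minimal _ (Submodule.span_le.2 ?_) hS
  rintro _ ⟨⟨η, ξ⟩, rfl⟩
  have h1 : ∀ η ∈ D, ∀ ξ, vecFunctional η ξ ∈ S := by
    intro η hη ξ
    let L : H →L[ℂ] StrongDual ℂ (H →L[ℂ] H) :=
      ContinuousLinearMap.compL ℂ (H →L[ℂ] H) H ℂ (innerSL ℂ η) ∘L ContinuousLinearMap.apply ℂ H
    have h2 : (⊤ : Submodule ℂ H) ≤ S.comap (L : H →ₗ[ℂ] _) := by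
      rw [← hD]
      refine Submodule.topologicalClosure_minimal _ (Submodule.span_le.2 fun ξ hξ => h η hη ξ hξ) ?_
      exact hS.preimage L.continuous
    exact h2 (Submodule.mem_top (x := ξ))
  let L : H →L⋆[ℂ] StrongDual ℂ (H →L[ℂ] H) :=
    ((ContinuousLinearMap.compL ℂ (H →L[ℂ] H) H ℂ).flip (ContinuousLinearMap.apply ℂ H ξ)).comp
      (innerSL ℂ)
  have h2 : (⊤ : Submodule ℂ H) ≤ S.comap (L : H →ₛₗ[starRingEnd ℂ] _) := by
    rw [← hD]
    refine Submodule.topologicalClosure_minimal _ (Submodule.span_le.2 fun η hη => h1 η hη ξ) ?_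
    exact hS.preimage L.continuous
  exact h2 (Submodule.mem_top (x := η))

theorem vecFunctional_mem_opPredual (η ξ : H) : vecFunctional η ξ ∈ opPredual H :=
  Submodule.le_topologicalClosure _ (Submodule.subset_span ⟨(η, ξ), rfl⟩)

theorem continuous_opWeakStar_iff {Z : Type*} [t : TopologicalSpace Z] {f : Z → (H →L[ℂ] H)} :
    Continuous[t, opWeakStar H] f ↔ ∀ ω ∈ opPredual H, Continuous fun z => ω (f z) := by
  rw [continuous_induced_rng, continuous_pi_iff]
  exact ⟨fun h ω hω => h ⟨ω, hω⟩, fun h ω => h ω.1 ω.2⟩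

/-- A bounded map into `B(H)` is weak* continuous if its matrix coefficients on a total set of
vectors are continuous. -/
theorem continuous_opWeakStar_of_bounded {Z : Type*} [t : TopologicalSpace Z]
    {f : Z → (H →L[ℂ] H)} {C : ℝ} (hC : ∀ z, ‖f z‖ ≤ C) {D : Set H}
    (hD : (Submodule.span ℂ D).topologicalClosure = ⊤)
    (h : ∀ η ∈ D, ∀ ξ ∈ D, Continuous fun z => ⟪η, f z ξ⟫_ℂ) :
    Continuous[t, opWeakStar H] f := by
  rw [continuous_opWeakStar_iff]
  let S : Submodule ℂ (StrongDual ℂ (H →L[ℂ] H)) :=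
    { carrier := {ω | Continuous fun z => ω (f z)}
      zero_mem' := continuous_const
      add_mem' := fun {a b} ha hb => Continuous.add ha hb
      smul_mem' := fun c a ha => Continuous.const_smul ha c }
  refine fun ω hω => opPredual_le_of_total hD (S := S) ?_ h hω
  refine isClosed_of_closure_subset fun ω hω => ?_
  refine continuous_of_uniform_approx_of_continuous fun u hu => ?_
  obtain ⟨ε, hε, hu⟩ := Metric.mem_uniformity_dist.1 hu
  obtain ⟨ω', hω', hd⟩ := (Metric.mem_closure_iff (α := StrongDual ℂ (H →L[ℂ] H))).1 hω
    (ε / (|C| + 1)) (by positivity)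
  refine ⟨fun z => ω' (f z), hω', fun z => hu ?_⟩
  rw [dist_eq_norm, ← sub_apply]
  refine (ContinuousLinearMap.le_opNorm _ _).trans_lt ?_
  have hd : ‖ω - ω'‖ < ε / (|C| + 1) := lt_of_eq_of_lt (dist_eq_norm ω ω').symm hd
  have h1 : ‖f z‖ < |C| + 1 := ((hC z).trans (le_abs_self C)).trans_lt (lt_add_one _)
  calc ‖ω - ω'‖ * ‖f z‖ ≤ ‖ω - ω'‖ * (|C| + 1) := by gcongr
    _ < ε / (|C| + 1) * (|C| + 1) := by gcongr
    _ = ε := div_mul_cancel₀ _ (by positivity)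

/-- The uniform boundedness principle for the weak operator topology. -/
theorem exists_norm_le_of_weakly_bounded [CompleteSpace H] {Z : Type*} {f : Z → (H →L[ℂ] H)}
    (h : ∀ η ξ : H, ∃ C : ℝ, ∀ z, ‖⟪η, f z ξ⟫_ℂ‖ ≤ C) : ∃ C, ∀ z, ‖f z‖ ≤ C := by
  refine banach_steinhaus fun ξ => ?_
  obtain ⟨C, hC⟩ := banach_steinhaus (g := fun z => innerSL ℂ (f z ξ)) fun η => by
    obtain ⟨C, hC⟩ := h η ξ
    refine ⟨C, fun z => ?_⟩
    rw [innerSL_apply_apply, norm_inner_symm]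
    exact hC z
  exact ⟨C, fun z => by simpa using hC z⟩

/-- `T ↦ A T B` is weak* continuous. -/
theorem continuous_opWeakStar_comp {H' : Type*} [NormedAddCommGroup H'] [InnerProductSpace ℂ H']
    [CompleteSpace H] [CompleteSpace H'] (A : H →L[ℂ] H') (B : H' →L[ℂ] H) :
    Continuous[opWeakStar H, opWeakStar H'] fun T => A ∘L T ∘L B := by
  rw [@continuous_opWeakStar_iff _ _ _ _ (opWeakStar H)]
  have hid := (@continuous_opWeakStar_iff _ _ _ _ (opWeakStar H) _).1
    (@continuous_id (H →L[ℂ] H) (opWeakStar H))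
  let L : (H →L[ℂ] H) →L[ℂ] (H' →L[ℂ] H') :=
    (ContinuousLinearMap.compL ℂ H' H H' A) ∘L (ContinuousLinearMap.compL ℂ H' H H).flip B
  let M := (ContinuousLinearMap.compL ℂ (H →L[ℂ] H) (H' →L[ℂ] H') ℂ).flip L
  have key : opPredual H' ≤ (opPredual H).comap (M : StrongDual ℂ (H' →L[ℂ] H') →ₗ[ℂ] _) := by
    refine Submodule.topologicalClosure_minimal _ (Submodule.span_le.2 ?_) ?_
    · rintro _ ⟨⟨η, ξ⟩, rfl⟩
      have : M (vecFunctional η ξ) = vecFunctional (ContinuousLinearMap.adjoint A η) (B ξ) := by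
        refine ContinuousLinearMap.ext fun T => ?_
        change ⟪η, A (T (B ξ))⟫_ℂ = ⟪ContinuousLinearMap.adjoint A η, T (B ξ)⟫_ℂ
        rw [ContinuousLinearMap.adjoint_inner_left]
      change M (vecFunctional η ξ) ∈ opPredual H
      rw [this]
      exact vecFunctional_mem_opPredual _ _
    · exact (Submodule.isClosed_topologicalClosure _).preimage M.continuous
  exact fun ω hω => hid _ (key hω)

end Predual

/-! ### Isometric partitions -/

section Partitions

theorem adjoint_apply_self_of_isometry {m n : Type v} {β : L2 m →L[ℂ] L2 n} (hβ : Isometry β)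
    (ξ : L2 m) : ContinuousLinearMap.adjoint β (β ξ) = ξ :=
  congrArg (fun T : L2 m →L[ℂ] L2 m => T ξ)
    ((ContinuousLinearMap.isometry_iff_adjoint_comp_self β).1 hβ)

variable {I n : Type v} {m : I → Type v} {α : ∀ i, L2 (m i) →L[ℂ] L2 n}

theorem IsIsometricPartition.sum_norm_sq_le (hα : IsIsometricPartition α) (s : Finset I)
    (ξ : L2 n) : ∑ i ∈ s, ‖ContinuousLinearMap.adjoint (α i) ξ‖ ^ 2 ≤ ‖ξ‖ ^ 2 := by
  have h := ((hα.hasSum ξ).mapL (innerSL ℂ ξ)).mapL Complex.reCLM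
  have h1 : ∀ i, Complex.reCLM (innerSL ℂ ξ (α i (ContinuousLinearMap.adjoint (α i) ξ))) =
      ‖ContinuousLinearMap.adjoint (α i) ξ‖ ^ 2 := by
    intro i
    rw [innerSL_apply_apply, ← ContinuousLinearMap.adjoint_inner_left, inner_self_eq_norm_sq_to_K]
    simp [← Complex.ofReal_pow]
  have h2 : Complex.reCLM (innerSL ℂ ξ ξ) = ‖ξ‖ ^ 2 := by
    rw [innerSL_apply_apply, inner_self_eq_norm_sq_to_K]
    simp [← Complex.ofReal_pow]
  simp only [h1, h2] at h
  exact sum_le_hasSum s (fun _ _ => by positivity) h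

theorem IsIsometricPartition.sum_norm_sq_ampl_le (hα : IsIsometricPartition α) {N : Type w}
    (s : Finset I) (ξ : L2Sum N (L2 n)) :
    ∑ i ∈ s, ‖ampl N (ContinuousLinearMap.adjoint (α i)) ξ‖ ^ 2 ≤ ‖ξ‖ ^ 2 :=
  hasSum_le (fun k => hα.sum_norm_sq_le s (ξ k))
    (hasSum_sum fun i _ => hasSum_norm_sq (ampl N (ContinuousLinearMap.adjoint (α i)) ξ))
    (hasSum_norm_sq ξ)

/-- The ranges of the isometries of a partition are pairwise orthogonal. -/
theorem IsIsometricPartition.adjoint_apply_of_ne (hα : IsIsometricPartition α) {i j : I}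
    (hij : i ≠ j) (ξ : L2 (m j)) : ContinuousLinearMap.adjoint (α i) (α j ξ) = 0 := by
  classical
  have h := hα.sum_norm_sq_le {i, j} (α j ξ)
  rw [Finset.sum_pair hij, adjoint_apply_self_of_isometry (hα.isometry j),
    (AddMonoidHomClass.isometry_iff_norm (α j)).1 (hα.isometry j)] at h
  have h2 : ‖ContinuousLinearMap.adjoint (α i) (α j ξ)‖ ^ 2 = 0 :=
    le_antisymm (by linarith) (by positivity)
  simpa using h2

theorem orthonormal_stdVec (n : Type v) : Orthonormal ℂ (stdVec : n → L2 n) := by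
  classical
  refine ⟨norm_stdVec, fun i j hij => ?_⟩
  change ⟪(stdVec i : L2 n), stdVec j⟫_ℂ = 0
  rw [inner_stdVec_left, stdVec_apply, if_neg hij]

/-- The isometry `ℓ²(m) → ℓ²(n)` permuting basis vectors along an injection. -/
def coordIsometry {m n : Type v} (σ : m ↪ n) : L2 m →L[ℂ] L2 n :=
  ((orthonormal_stdVec n).comp σ σ.injective).orthogonalFamily.linearIsometry.toContinuousLinearMap

theorem isometry_coordIsometry {m n : Type v} (σ : m ↪ n) : Isometry (coordIsometry σ) :=
  ((orthonormal_stdVec n).comp σ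
    σ.injective).orthogonalFamily.linearIsometry.isometry

theorem hasSum_coordIsometry {m n : Type v} (σ : m ↪ n) (ξ : L2 m) :
    HasSum (fun j => ξ j • (stdVec (σ j) : L2 n)) (coordIsometry σ ξ) :=
  ((orthonormal_stdVec n).comp σ σ.injective).orthogonalFamily.hasSum_linearIsometry ξ

theorem coordIsometry_stdVec {m n : Type v} (σ : m ↪ n) (j : m) :
    coordIsometry σ (stdVec j) = stdVec (σ j) := by
  classical
  refine (hasSum_coordIsometry σ (stdVec j)).unique ?_
  convert! hasSum_single (f := fun i => (stdVec j : L2 m) i • (stdVec (σ i) : L2 n)) j ?_ using 1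
  · rw [stdVec_apply, if_pos rfl, one_smul]
  · intro i hi
    rw [stdVec_apply, if_neg hi, zero_smul]

theorem adjoint_coordIsometry_apply {m n : Type v} (σ : m ↪ n) (ξ : L2 n) (j : m) :
    ContinuousLinearMap.adjoint (coordIsometry σ) ξ j = ξ (σ j) := by
  rw [← inner_stdVec_left, ContinuousLinearMap.adjoint_inner_right, coordIsometry_stdVec,
    inner_stdVec_left]

/-- A bijection `I × m ≃ n` splits `ℓ²(n)` into `I` copies of `ℓ²(m)`. -/
theorem isIsometricPartition_of_equiv {I m n : Type v} (e : I × m ≃ n) :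
    IsIsometricPartition fun i => coordIsometry
      (⟨fun j => e (i, j), fun _ _ h => by simpa using e.injective h⟩ : m ↪ n) := by
  classical
  refine ⟨fun i => isometry_coordIsometry _, fun ξ => ?_⟩
  have h := lp.hasSum_single (p := 2) ENNReal.ofNat_ne_top ξ
  rw [← e.hasSum_iff] at h
  refine h.prod_fiberwise fun i => ?_
  have h2 := hasSum_coordIsometry
    (⟨fun j => e (i, j), fun _ _ h => by simpa using e.injective h⟩ : m ↪ n)
    (ContinuousLinearMap.adjoint (coordIsometry
      (⟨fun j => e (i, j), fun _ _ h => by simpa using e.injective h⟩ : m ↪ n)) ξ)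
  simp only [adjoint_coordIsometry_apply] at h2
  convert! h2 using 2 with j
  rw [← single_eq_smul_stdVec]
  simp only [Function.comp_apply]
  congr 1

/-- The top level `κ` of a nc set, for an infinite cardinal `κ`. -/
def topLevel (κ : Cardinal.{v}) (hκ : Cardinal.aleph0 ≤ κ) : Level κ :=
  ⟨κ.out, by
    rw [← Cardinal.mk_ne_zero_iff, Cardinal.mk_out]
    exact (Cardinal.aleph0_pos.trans_le hκ).ne', (Cardinal.mk_out κ).le⟩

/-- Every level occurs in the top level with multiplicity `κ`. -/
theorem exists_partition_topLevel {κ : Cardinal.{v}} (hκ : Cardinal.aleph0 ≤ κ) (m : Level κ) :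
    ∃ α : (topLevel κ hκ).1 → (L2 m.1 →L[ℂ] L2 (topLevel κ hκ).1), IsIsometricPartition α := by
  have h : Cardinal.mk (κ.out × m.1) = Cardinal.mk κ.out := by
    rw [Cardinal.mk_prod, Cardinal.lift_id, Cardinal.lift_id, Cardinal.mk_out]
    have := m.2.1
    exact Cardinal.mul_eq_left hκ m.2.2 (Cardinal.mk_ne_zero m.1)
  obtain ⟨e⟩ := Cardinal.eq.1 h
  exact ⟨_, isIsometricPartition_of_equiv e⟩

end Partitions

/-! ### Weak* compact sets are bounded -/

section Boundedness

theorem opNorm_le_of_inner_le {H : Type*} [NormedAddCommGroup H] [InnerProductSpace ℂ H]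
    {A : H →L[ℂ] H} {C : ℝ} (hC : 0 ≤ C)
    (h : ∀ η ξ : H, ‖η‖ ≤ 1 → ‖ξ‖ ≤ 1 → ‖⟪η, A ξ⟫_ℂ‖ ≤ C) : ‖A‖ ≤ C := by
  refine ContinuousLinearMap.opNorm_le_of_unit_norm hC fun ξ hξ => ?_
  rcases eq_or_ne (A ξ) 0 with h0 | h0
  · rw [h0, norm_zero]; exact hC
  have h1 : ‖A ξ‖ ≠ 0 := norm_ne_zero_iff.2 h0
  have h2 := h (((‖A ξ‖⁻¹ : ℝ) : ℂ) • A ξ) ξ (by rw [norm_smul]; simp [h1]) hξ.le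
  rw [inner_smul_left, inner_self_eq_norm_sq_to_K, norm_mul] at h2
  simpa [sq, h1] using h2

theorem inner_blockOp {H : Type*} [NormedAddCommGroup H] [InnerProductSpace ℂ H] {n : ℕ}
    (T : Matrix (Fin n) (Fin n) (H →L[ℂ] H)) (η ξ : PiLp 2 (fun _ : Fin n => H)) :
    ⟪η, blockOp T ξ⟫_ℂ = ∑ s, ∑ t, ⟪η s, T s t (ξ t)⟫_ℂ := by
  rw [PiLp.inner_apply]
  refine Finset.sum_congr rfl fun s _ => ?_
  rw [blockOp_apply, inner_sum]

variable {F : Type u} [NormedAddCommGroup F] [NormedSpace ℂ F] [OperatorSpace F] {ι : Type v}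

/-- The elementary tensors `η ⊗ a ⊗ ξ` in the unit ball of the predual of `M_ι(F^*)`, for matrices
`a` over `F` of all sizes. -/
structure UnitTensor (F : Type u) [NormedAddCommGroup F] [NormedSpace ℂ F] [OperatorSpace F]
    (ι : Type v) where
  size : ℕ
  mat : Matrix (Fin size) (Fin size) F
  left : PiLp 2 (fun _ : Fin size => L2 ι)
  right : PiLp 2 (fun _ : Fin size => L2 ι)
  mnorm_mat : OperatorSpace.mnorm size mat ≤ 1
  norm_left : ‖left‖ ≤ 1
  norm_right : ‖right‖ ≤ 1

/-- The functional `x ↦ ⟪η, x(a) ξ⟫` on `M_ι(F^*)`. -/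
def UnitTensor.functional (j : UnitTensor F ι) : DualMat F ι →ₗ[ℂ] ℂ :=
  ∑ s, ∑ t, coefFunctional (j.mat s t) (j.left s) (j.right t)

theorem UnitTensor.functional_apply (j : UnitTensor F ι) (x : DualMat F ι) :
    j.functional x = ⟪j.left, blockOp (j.mat.map x.1) j.right⟫_ℂ := by
  rw [inner_blockOp, functional]
  simp [LinearMap.sum_apply, coefFunctional]

theorem norm_blockOp_le_matNorm (x : DualMat F ι) {n : ℕ} {a : Matrix (Fin n) (Fin n) F}
    (ha : OperatorSpace.mnorm n a ≤ 1) : ‖blockOp (a.map x.1)‖ ≤ (matNorm x.1).toReal := by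
  have h := blockOp_le_matNorm x.1 ha
  rwa [ENNReal.ofReal_le_iff_le_toReal x.2.ne] at h

theorem UnitTensor.norm_functional_le (j : UnitTensor F ι) (x : DualMat F ι) :
    ‖j.functional x‖ ≤ (matNorm x.1).toReal := by
  rw [functional_apply]
  refine (norm_inner_le_norm _ _).trans ?_
  refine (mul_le_of_le_one_left (norm_nonneg _) j.norm_left).trans ?_
  refine (ContinuousLinearMap.le_opNorm _ _).trans ?_
  refine (mul_le_of_le_one_right (ContinuousLinearMap.opNorm_nonneg _) j.norm_right).trans ?_
  exact norm_blockOp_le_matNorm x j.mnorm_mat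

/-- Elementary tensors in the unit ball of the predual compute the completely bounded norm. -/
theorem matNorm_le_of_functional_le {x : DualMat F ι} {C : ℝ≥0}
    (h : ∀ j : UnitTensor F ι, ‖j.functional x‖ ≤ C) : matNorm x.1 ≤ C := by
  refine iSup_le fun n => iSup_le fun a => iSup_le fun ha => ?_
  rw [opMatNorm, ← ENNReal.ofReal_coe_nnreal]
  refine ENNReal.ofReal_le_ofReal (opNorm_le_of_inner_le C.2 fun η ξ hη hξ => ?_)
  have h1 := h ⟨n, a, η, ξ, ha, hη, hξ⟩
  rwa [UnitTensor.functional_apply] at h1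

theorem summable_mul_functional (c : lp (fun _ : UnitTensor F ι => ℂ) 1) (x : DualMat F ι) :
    Summable fun j => c j * j.functional x := by
  have hc : Summable fun j => ‖c j‖ := by simpa using (lp.memℓp c).summable (by norm_num)
  refine Summable.of_norm_bounded (hc.mul_right (matNorm x.1).toReal) fun j => ?_
  rw [norm_mul]
  exact mul_le_mul_of_nonneg_left (j.norm_functional_le x) (norm_nonneg _)

/-- An element `x` of `M_ι(F^*)` as the functional `c ↦ ∑ c_j ⟪η_j, x(a_j) ξ_j⟫` on the space `ℓ¹`
over all elementary tensors in the unit ball of the predual. -/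
def tensorSum (x : DualMat F ι) : lp (fun _ : UnitTensor F ι => ℂ) 1 →L[ℂ] ℂ :=
  LinearMap.mkContinuous
    { toFun := fun c => ∑' j, c j * j.functional x
      map_add' := fun c d => by
        rw [← (summable_mul_functional c x).tsum_add (summable_mul_functional d x)]
        exact tsum_congr fun j => by rw [lp.coeFn_add, Pi.add_apply, add_mul]
      map_smul' := fun z c => by
        rw [RingHom.id_apply, smul_eq_mul, ← tsum_mul_left]
        exact tsum_congr fun j => by
          rw [lp.coeFn_smul, Pi.smul_apply, smul_eq_mul, mul_assoc] }
    (matNorm x.1).toReal (fun c => by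
      have hc := lp.hasSum_norm (p := 1) (by norm_num) c
      simp only [ENNReal.toReal_one, Real.rpow_one] at hc
      have h := hc.mul_left (matNorm x.1).toReal
      refine tsum_of_norm_bounded h fun j => ?_
      rw [norm_mul, mul_comm]
      exact mul_le_mul_of_nonneg_right (j.norm_functional_le x) (norm_nonneg _))

theorem tensorSum_apply (x : DualMat F ι) (c : lp (fun _ : UnitTensor F ι => ℂ) 1) :
    tensorSum x c = ∑' j, c j * j.functional x := rfl

theorem norm_tensorSum_le (x : DualMat F ι) : ‖tensorSum x‖ ≤ (matNorm x.1).toReal :=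
  LinearMap.mkContinuous_norm_le _ ENNReal.toReal_nonneg _

open Classical in
theorem tensorSum_single (x : DualMat F ι) (j : UnitTensor F ι) (z : ℂ) :
    tensorSum x (lp.single 1 j z) = z * j.functional x := by
  rw [tensorSum_apply, tsum_eq_single j]
  · rw [lp.single_apply_self]
  · intro i hi
    rw [lp.single_apply_ne _ _ _ hi, zero_mul]

open Classical in
theorem exists_norm_sub_sum_single_lt {J : Type*} (c : lp (fun _ : J => ℂ) 1) {ε : ℝ}
    (hε : 0 < ε) : ∃ s : Finset J, ‖c - ∑ j ∈ s, lp.single 1 j (c j)‖ < ε := by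
  have h := lp.hasSum_single (p := 1) ENNReal.one_ne_top c
  rw [HasSum, SummationFilter.unconditional_filter, Metric.tendsto_nhds] at h
  obtain ⟨s, hs⟩ := (h ε hε).exists
  rw [dist_comm, dist_eq_norm] at hs
  exact ⟨s, hs⟩

/-- The functional `x ↦ ∑ c_j ⟪η_j, x(a_j) ξ_j⟫` on `M_ι(F^*)`. -/
def tensorFunctional (c : lp (fun _ : UnitTensor F ι => ℂ) 1) : DualMat F ι →ₗ[ℂ] ℂ where
  toFun x := tensorSum x c
  map_add' x y := by
    simp only [tensorSum_apply]
    rw [← (summable_mul_functional c x).tsum_add (summable_mul_functional c y)]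
    exact tsum_congr fun j => by rw [map_add, mul_add]
  map_smul' z x := by
    simp only [tensorSum_apply]
    rw [RingHom.id_apply, smul_eq_mul, ← tsum_mul_left]
    exact tsum_congr fun j => by rw [map_smul, smul_eq_mul, mul_left_comm]

open Classical in
theorem norm_tensorFunctional_sub_le (c : lp (fun _ : UnitTensor F ι => ℂ) 1)
    (s : Finset (UnitTensor F ι)) (x : DualMat F ι) :
    ‖tensorFunctional c x - (∑ j ∈ s, c j • j.functional) x‖ ≤
      ‖c - ∑ j ∈ s, lp.single 1 j (c j)‖ * (matNorm x.1).toReal := by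
  have h1 : tensorFunctional c x - (∑ j ∈ s, c j • j.functional) x =
      tensorSum x (c - ∑ j ∈ s, lp.single 1 j (c j)) := by
    rw [map_sub, map_sum, LinearMap.sum_apply]
    simp only [tensorSum_single, LinearMap.smul_apply, smul_eq_mul]
    rfl
  rw [h1, mul_comm]
  refine (ContinuousLinearMap.le_opNorm _ _).trans ?_
  exact mul_le_mul_of_nonneg_right (norm_tensorSum_le x) (norm_nonneg _)

theorem tensorFunctional_mem_matPredual (c : lp (fun _ : UnitTensor F ι => ℂ) 1) :
    tensorFunctional c ∈ matPredual F ι := by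
  classical
  intro ε hε
  obtain ⟨s, hs⟩ := exists_norm_sub_sum_single_lt c (NNReal.coe_pos.2 hε)
  refine ⟨∑ j ∈ s, c j • j.functional, ?_, fun x => ?_⟩
  · refine Submodule.sum_mem _ fun j _ => Submodule.smul_mem _ _ ?_
    refine Submodule.sum_mem _ fun p _ => Submodule.sum_mem _ fun q _ => ?_
    exact Submodule.subset_span ⟨(j.mat p q, j.left p, j.right q), rfl⟩
  · have h1 : ‖tensorFunctional c x - (∑ j ∈ s, c j • j.functional) x‖ ≤
        (ε : ℝ) * (matNorm x.1).toReal :=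
      (norm_tensorFunctional_sub_le c s x).trans
        (mul_le_mul_of_nonneg_right hs.le ENNReal.toReal_nonneg)
    refine (ENNReal.ofReal_le_ofReal h1).trans ?_
    rw [ENNReal.ofReal_mul ε.coe_nonneg, ENNReal.ofReal_toReal x.2.ne, ENNReal.ofReal_coe_nnreal]

/-- Weak* compact subsets of `M_ι(F^*)` are bounded in the completely bounded norm. The predual is
only present as a set of functionals, so the uniform boundedness principle is applied on the `ℓ¹`
space which maps onto it. -/
theorem exists_matNorm_le_of_isCompact {S : Set (DualMat F ι)}
    (hS : @IsCompact _ (weakStar F ι) S) : ∃ C : ℝ≥0, ∀ x ∈ S, matNorm x.1 ≤ C := by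
  classical
  obtain ⟨C, hC⟩ := banach_steinhaus (g := fun x : S => tensorSum x.1) fun c => by
    have hc : Continuous[weakStar F ι, _] fun x => tensorFunctional (F := F) (ι := ι) c x :=
      @Continuous.comp _ _ _ (weakStar F ι) _ _ (fun x (ω : matPredual F ι) => ω.1 x)
        (fun p : matPredual F ι → ℂ => p ⟨_, tensorFunctional_mem_matPredual c⟩)
        (continuous_apply _) continuous_induced_dom
    obtain ⟨C, hC⟩ := (@IsCompact.image _ _ (weakStar F ι) _ _ _ hS hc).isBounded.exists_norm_le
    exact ⟨C, fun x => hC _ ⟨x.1, x.2, rfl⟩⟩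
  refine ⟨C.toNNReal, fun x hx => matNorm_le_of_functional_le fun j => ?_⟩
  have h1 := (tensorSum x).le_opNorm (lp.single 1 j 1)
  rw [tensorSum_single, one_mul, lp.norm_single (by norm_num), norm_one, mul_one] at h1
  exact (h1.trans (hC ⟨x, hx⟩)).trans (Real.le_coe_toNNReal C)

end Boundedness

/-! ### Uniform bounds over all levels -/

section Uniform

variable {F : Type u} [NormedAddCommGroup F] [NormedSpace ℂ F] [OperatorSpace F]
variable {κ : Cardinal.{v}} {K : NCSet F κ}

/-- A direct sum is reduced by the range of each `α i`, on which it acts as `x i`. -/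
theorem IsDirectSum.apply_range {I n : Type v} {m : I → Type v}
    {α : ∀ i, L2 (m i) →L[ℂ] L2 n} {x : ∀ i, DualMat F (m i)} {y : DualMat F n}
    (hα : IsIsometricPartition α) (h : IsDirectSum α x y) (i : I) (φ : F) (ξ : L2 (m i)) :
    y.1 φ (α i ξ) = α i ((x i).1 φ ξ) := by
  refine (h φ (α i ξ)).unique ?_
  convert! hasSum_single
    (f := fun j => α j ((x j).1 φ (ContinuousLinearMap.adjoint (α j) (α i ξ)))) i ?_ using 1
  · rw [adjoint_apply_self_of_isometry (hα.isometry i)]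
  · intro j hj
    rw [hα.adjoint_apply_of_ne hj, map_zero, map_zero]

theorem norm_diagOp_apply_of_isometry {m n : Type v} {β : L2 m →L[ℂ] L2 n} (hβ : Isometry β)
    {r : ℕ} (ξ : PiLp 2 (fun _ : Fin r => L2 m)) : ‖diagOp r β ξ‖ = ‖ξ‖ := by
  rw [← sq_eq_sq₀ (norm_nonneg _) (norm_nonneg _), PiLp.norm_sq_eq_of_L2, PiLp.norm_sq_eq_of_L2]
  refine Finset.sum_congr rfl fun i _ => ?_
  rw [diagOp_apply, (AddMonoidHomClass.isometry_iff_norm β).1 hβ]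

theorem norm_ampl_apply_of_isometry {m n : Type v} {β : L2 m →L[ℂ] L2 n} (hβ : Isometry β)
    {N : Type w} (ξ : L2Sum N (L2 m)) : ‖ampl N β ξ‖ = ‖ξ‖ := by
  rw [← sq_eq_sq₀ (norm_nonneg _) (norm_nonneg _)]
  refine (hasSum_norm_sq _).unique ?_
  simpa only [ampl_apply, (AddMonoidHomClass.isometry_iff_norm β).1 hβ] using hasSum_norm_sq ξ

/-- Summands have smaller completely bounded norm than their direct sum. -/
theorem IsDirectSum.matNorm_le {I n : Type v} {m : I → Type v}
    {α : ∀ i, L2 (m i) →L[ℂ] L2 n} {x : ∀ i, DualMat F (m i)} {y : DualMat F n}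
    (hα : IsIsometricPartition α) (h : IsDirectSum α x y) (i : I) :
    matNorm (x i).1 ≤ matNorm y.1 := by
  refine iSup_le fun r => iSup_le fun a => iSup_le fun ha => ?_
  refine le_trans ?_ (blockOp_le_matNorm y.1 ha)
  refine ENNReal.ofReal_le_ofReal ?_
  refine ContinuousLinearMap.opNorm_le_bound _ (ContinuousLinearMap.opNorm_nonneg _) fun ξ => ?_
  have h1 : diagOp r (α i) (blockOp (a.map (x i).1) ξ) =
      blockOp (a.map y.1) (diagOp r (α i) ξ) := by
    ext1 s
    rw [diagOp_apply, blockOp_apply, blockOp_apply, map_sum]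
    refine Finset.sum_congr rfl fun t _ => ?_
    rw [diagOp_apply, Matrix.map_apply, Matrix.map_apply, h.apply_range hα]
  have h2 := norm_diagOp_apply_of_isometry (hα.isometry i) (blockOp (a.map (x i).1) ξ)
  rw [h1] at h2
  refine (h2.symm.trans_le ((ContinuousLinearMap.le_opNorm _ _).trans_eq ?_))
  rw [norm_diagOp_apply_of_isometry (hα.isometry i)]

theorem exists_directSum_topLevel (hκ : Cardinal.aleph0 ≤ κ) (hK : IsNCConvex K) (m : Level κ)
    (x : K m) : ∃ α : (topLevel κ hκ).1 → (L2 m.1 →L[ℂ] L2 (topLevel κ hκ).1),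
      IsIsometricPartition α ∧ ∃ y : K (topLevel κ hκ), IsDirectSum α (fun _ => x.1) y.1 := by
  obtain ⟨α, hα⟩ := exists_partition_topLevel hκ m
  obtain ⟨y, hy, h⟩ := hK.directSum (topLevel κ hκ) (fun _ => m) α (fun _ => x.1) hα
    (fun _ => x.2) ⟨(matNorm x.1.1).toNNReal, fun _ => (ENNReal.coe_toNNReal x.1.2.ne).ge⟩
  exact ⟨α, hα, ⟨y, hy⟩, h⟩

/-- A nc compact convex set is bounded, uniformly over all levels. -/
theorem IsNCCompactConvex.exists_matNorm_le (hκ : Cardinal.aleph0 ≤ κ)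
    (hK : IsNCCompactConvex K) : ∃ C : ℝ≥0, ∀ n, ∀ x ∈ K n, matNorm x.1 ≤ C := by
  obtain ⟨C, hC⟩ := exists_matNorm_le_of_isCompact (hK.compact (topLevel κ hκ))
  refine ⟨C, fun n x hx => ?_⟩
  obtain ⟨α, hα, y, hy⟩ := exists_directSum_topLevel hκ hK.convex n ⟨x, hx⟩
  obtain ⟨i⟩ := (topLevel κ hκ).2.1
  exact (hy.matNorm_le hα i).trans (hC y.1 y.2)

/-- Continuous nc affine functions are bounded, uniformly over all levels. -/
theorem IsMatAff.exists_norm_le (hκ : Cardinal.aleph0 ≤ κ) (hK : IsNCCompactConvex K)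
    {N : Type w} {f : ∀ n : Level κ, K n → (L2Sum N (L2 n.1) →L[ℂ] L2Sum N (L2 n.1))}
    (hf : IsMatAff K N f) : ∃ C : ℝ, 0 ≤ C ∧ ∀ n x, ‖f n x‖ ≤ C := by
  obtain ⟨C, hC⟩ := exists_norm_le_of_weakly_bounded (f := f (topLevel κ hκ)) fun η ξ => by
    have h1 := (@continuous_opWeakStar_iff _ _ _ _ (levelTop K _) _).1
      (hf.continuous (topLevel κ hκ)) _ (vecFunctional_mem_opPredual η ξ)
    have h2 := (@isCompact_iff_compactSpace _ (weakStar F _) _).1 (hK.compact (topLevel κ hκ))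
    obtain ⟨C, hC⟩ := (@isCompact_range _ _ (levelTop K _) _ h2 _ h1).isBounded.exists_norm_le
    exact ⟨C, fun z => hC _ ⟨z, rfl⟩⟩
  refine ⟨max C 0, le_max_right _ _, fun n x => ?_⟩
  obtain ⟨α, hα, y, hy⟩ := exists_directSum_topLevel hκ hK.convex n x
  obtain ⟨i⟩ := (topLevel κ hκ).2.1
  refine (ContinuousLinearMap.opNorm_le_bound _
    (ContinuousLinearMap.opNorm_nonneg (f _ y)) fun ξ => ?_).trans ((hC y).trans (le_max_left _ _))
  have h1 : f _ y (ampl N (α i) ξ) = ampl N (α i) (f n x ξ) := by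
    refine (hf.directSum _ _ α (fun _ => x) y hα ⟨(matNorm x.1.1).toNNReal,
      fun _ => (ENNReal.coe_toNNReal x.1.2.ne).ge⟩ hy (ampl N (α i) ξ)).unique ?_
    convert! hasSum_single (f := fun j => ampl N (α j) (f n x
      (ampl N (ContinuousLinearMap.adjoint (α j)) (ampl N (α i) ξ)))) i ?_ using 1
    · congr 2
      ext1
      funext k
      rw [ampl_apply, ampl_apply, adjoint_apply_self_of_isometry (hα.isometry i)]
    · intro j hj
      have h0 : ampl N (ContinuousLinearMap.adjoint (α j)) (ampl N (α i) ξ) = 0 := by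
        ext1
        funext k
        rw [ampl_apply, ampl_apply, hα.adjoint_apply_of_ne hj]
        rfl
      rw [h0, map_zero, map_zero]
  rw [← norm_ampl_apply_of_isometry (hα.isometry i), ← h1]
  refine (ContinuousLinearMap.le_opNorm _ _).trans_eq ?_
  rw [norm_ampl_apply_of_isometry (hα.isometry i)]

end Uniform

/-! ### Nc spanning sets and the lower bound -/

section BoundedBelow

variable {F : Type u} [NormedAddCommGroup F] [NormedSpace ℂ F] [OperatorSpace F]

/-- The element `g ⊗ e_ii` of `M_ι(F^*)`. -/
def diagUnit {ι : Type v} (i : ι) (g : StrongDual ℂ F) : DualMat F ι :=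
  ⟨g.smulRight ((innerSL ℂ (stdVec i : L2 ι)).smulRight (stdVec i)), by
    refine lt_of_le_of_lt (b := ENNReal.ofReal ‖g‖) ?_ ENNReal.ofReal_lt_top
    refine iSup_le fun r => iSup_le fun a => iSup_le fun ha => ?_
    refine ENNReal.ofReal_le_ofReal (opNorm_le_of_inner_le (norm_nonneg _) fun η ξ hη hξ => ?_)
    rw [inner_blockOp]
    have e : ∑ s, ∑ t, ⟪η s, (a.map ⇑(g.smulRight ((innerSL ℂ (stdVec i : L2 ι)).smulRight
        (stdVec i : L2 ι)))) s t (ξ t)⟫_ℂ =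
        g (∑ s, ∑ t, (⟪η s, (stdVec i : L2 ι)⟫_ℂ * ⟪(stdVec i : L2 ι), ξ t⟫_ℂ) • a s t) := by
      simp only [map_sum, map_smul, Matrix.map_apply, ContinuousLinearMap.smulRight_apply,
        smul_apply, innerSL_apply_apply, inner_smul_right, smul_eq_mul]
      refine Finset.sum_congr rfl fun s _ => Finset.sum_congr rfl fun t _ => by ring
    have hs : ∀ ζ : PiLp 2 (fun _ : Fin r => L2 ι), ‖ζ‖ ≤ 1 → ∀ c : Fin r → ℂ,
        (∀ s, ‖c s‖ ≤ ‖ζ s‖) → Real.sqrt (∑ s, ‖c s‖ ^ 2) ≤ 1 := by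
      intro ζ hζ c hc
      rw [Real.sqrt_le_one]
      refine (Finset.sum_le_sum fun s _ => pow_le_pow_left₀ (norm_nonneg _) (hc s) 2).trans ?_
      rw [← PiLp.norm_sq_eq_of_L2]
      exact pow_le_one₀ (norm_nonneg _) hζ
    have h1 := norm_sum_smul_le a (fun s => ⟪η s, (stdVec i : L2 ι)⟫_ℂ)
      (fun t => ⟪(stdVec i : L2 ι), ξ t⟫_ℂ)
    have h2 : (OperatorSpace.mnorm r a).toReal ≤ 1 := by
      simpa using ENNReal.toReal_mono ENNReal.one_ne_top ha
    change ‖∑ s, ∑ t, ⟪η s, (a.map ⇑(g.smulRight ((innerSL ℂ (stdVec i : L2 ι)).smulRight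
        (stdVec i : L2 ι)))) s t (ξ t)⟫_ℂ‖ ≤ ‖g‖
    rw [e]
    refine (g.le_opNorm _).trans (mul_le_of_le_one_right (norm_nonneg _) (h1.trans ?_))
    refine mul_le_one₀ (mul_le_one₀ ?_ ENNReal.toReal_nonneg h2) (Real.sqrt_nonneg _) ?_
    · refine hs η hη _ fun s => (norm_inner_le_norm _ _).trans_eq ?_
      rw [norm_stdVec, mul_one]
    · refine hs ξ hξ _ fun s => (norm_inner_le_norm _ _).trans_eq ?_
      rw [norm_stdVec, one_mul]⟩

theorem diagUnit_apply {ι : Type v} (i : ι) (g : StrongDual ℂ F) (φ : F) (ξ : L2 ι) :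
    (diagUnit i g).1 φ ξ = (g φ * ξ i) • stdVec i := by
  change (g φ • (innerSL ℂ (stdVec i : L2 ι)).smulRight (stdVec i : L2 ι)) ξ = _
  rw [smul_apply, ContinuousLinearMap.smulRight_apply, innerSL_apply_apply,
    inner_stdVec_left, smul_smul]

variable {κ : Cardinal.{v}} {K : NCSet F κ}

/-- A nc span in the square sense is contained in the nc span in the rectangular sense. -/
theorem IsNCSpanning.exists_ncSpan_eq_top (h : IsNCSpanning K) :
    ∃ n : Level κ, ncSpan K n = ⊤ := by
  rcases h with h | ⟨n, hn⟩
  · exact h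
  refine ⟨n, eq_top_iff.2 (hn.ge.trans (Submodule.span_le.2 ?_))⟩
  rintro _ ⟨a, b, x, hx, rfl⟩
  exact Submodule.subset_span ⟨n, a, b, x, hx, rfl⟩

theorem conj_eq {ι κ : Type v} (a : L2 κ →L[ℂ] L2 ι) (x : DualMat F ι) (b : L2 κ →L[ℂ] L2 ι)
    (φ : F) : (conj a x b).1 φ = ContinuousLinearMap.adjoint a ∘L x.1 φ ∘L b := rfl

/-- If `K` is nc spanning, evaluation on `K` is bounded below: each functional on `F` is a
coefficient of a finite combination of elements of `K`, so the set of those `φ` with `‖x(φ)‖ ≤ 1` on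
`K` is weakly bounded, hence bounded. -/
theorem IsNCSpanning.exists_norm_le (h : IsNCSpanning K) :
    ∃ C : ℝ, ∀ (φ : F) (t : ℝ), 0 < t → (∀ n, ∀ x ∈ K n, ‖x.1 φ‖ ≤ t) → ‖φ‖ ≤ C * t := by
  obtain ⟨n, hn⟩ := h.exists_ncSpan_eq_top
  obtain ⟨i⟩ := n.2.1
  let S : Set F := {φ | ∀ n, ∀ x ∈ K n, ‖x.1 φ‖ ≤ 1}
  have h1 : ∀ y ∈ ncSpan K n, ∃ C : ℝ, ∀ φ ∈ S, ‖y.1 φ‖ ≤ C := by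
    intro y hy
    refine Submodule.span_induction (p := fun y _ => ∃ C : ℝ, ∀ φ ∈ S, ‖y.1 φ‖ ≤ C)
      ?_ ?_ ?_ ?_ hy
    · rintro _ ⟨m, a, b, x, hx, rfl⟩
      refine ⟨‖ContinuousLinearMap.adjoint a‖ * (1 * ‖b‖), fun φ hφ => ?_⟩
      rw [conj_eq]
      refine (ContinuousLinearMap.opNorm_comp_le _ _).trans ?_
      refine mul_le_mul_of_nonneg_left ?_ (norm_nonneg _)
      refine (ContinuousLinearMap.opNorm_comp_le _ _).trans ?_
      exact mul_le_mul_of_nonneg_right (hφ m x hx) (norm_nonneg _)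
    · exact ⟨0, fun φ _ => by simp⟩
    · rintro x y _ _ ⟨C, hC⟩ ⟨D, hD⟩
      exact ⟨C + D, fun φ hφ => (norm_add_le _ _).trans (add_le_add (hC φ hφ) (hD φ hφ))⟩
    · rintro c x _ ⟨C, hC⟩
      refine ⟨‖c‖ * C, fun φ hφ => ?_⟩
      refine (norm_smul c (x.1 φ)).trans_le ?_
      exact mul_le_mul_of_nonneg_left (hC φ hφ) (norm_nonneg _)
  obtain ⟨C, hC⟩ := banach_steinhaus
    (g := fun φ : S => NormedSpace.inclusionInDoubleDual ℂ F φ.1) fun g => by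
      obtain ⟨C, hC⟩ := h1 (diagUnit i g) (hn ▸ Submodule.mem_top)
      refine ⟨C, fun φ => ?_⟩
      have h2 := ((diagUnit i g).1 φ.1).le_opNorm (stdVec i)
      rw [diagUnit_apply, norm_smul, norm_stdVec, stdVec_apply, if_pos rfl, mul_one, mul_one,
        mul_one] at h2
      exact h2.trans (hC φ.1 φ.2)
  refine ⟨C, fun φ t ht hφ => ?_⟩
  have h3 : ((t⁻¹ : ℝ) : ℂ) • φ ∈ S := by
    intro n x hx
    rw [map_smul, norm_smul, Complex.norm_real, Real.norm_of_nonneg (by positivity)]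
    rw [inv_mul_le_iff₀ ht, mul_one]
    exact hφ n x hx
  have h4 := hC ⟨_, h3⟩
  rw [show ‖NormedSpace.inclusionInDoubleDual ℂ F (((t⁻¹ : ℝ) : ℂ) • φ)‖ =
    ‖((t⁻¹ : ℝ) : ℂ) • φ‖ from (NormedSpace.inclusionInDoubleDualLi ℂ).norm_map _,
    norm_smul, Complex.norm_real, Real.norm_of_nonneg (by positivity), inv_mul_le_iff₀ ht,
    mul_comm] at h4
  exact h4

theorem ofReal_norm_le_affMatNorm (φ : F) (n : Level κ) (x : K n) :
    ENNReal.ofReal ‖x.1.1 φ‖ ≤ affMatNorm K 1 (Matrix.of fun _ _ => restrict K φ) := by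
  refine le_iSup_of_le n (le_iSup_of_le x ?_)
  exact ENNReal.ofReal_le_ofReal (norm_le_blockOp (x.1.1 φ))

theorem IsNCSpanning.exists_mnorm_one_le (h : IsNCSpanning K) :
    ∃ C : ℝ≥0, ∀ φ : F, OperatorSpace.mnorm 1 (Matrix.of fun _ _ => φ) ≤
      C * affMatNorm K 1 (Matrix.of fun _ _ => restrict K φ) := by
  obtain ⟨C, hC⟩ := h.exists_norm_le
  -- the maximum with `1` allows for division by the constant
  refine ⟨(max C 1).toNNReal, fun φ => ?_⟩
  have hpos : 0 < max C 1 := lt_max_of_lt_right one_pos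
  set q := affMatNorm K 1 (Matrix.of fun _ _ => restrict K φ) with hq
  rw [OperatorSpace.mnorm_one]
  simp only [Matrix.of_apply]
  rcases eq_or_ne q ⊤ with hT | hT
  · rw [hT, ENNReal.mul_top (by simp)]
    exact le_top
  have h1 : ‖φ‖ ≤ max C 1 * q.toReal := by
    refine le_of_forall_pos_le_add fun ε hε => ?_
    have h2 := hC φ (q.toReal + ε / max C 1) (by positivity) fun n x hx => by
      have h3 := ofReal_norm_le_affMatNorm φ n ⟨x, hx⟩
      rw [ENNReal.ofReal_le_iff_le_toReal hT] at h3
      exact h3.trans (le_add_of_nonneg_right (by positivity))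
    refine h2.trans ?_
    calc C * (q.toReal + ε / max C 1) ≤ max C 1 * (q.toReal + ε / max C 1) := by
          gcongr; exact le_max_left _ _
      _ = max C 1 * q.toReal + ε := by
          rw [mul_add, mul_div_cancel₀ _ hpos.ne']
  refine (ENNReal.ofReal_le_ofReal h1).trans_eq ?_
  rw [ENNReal.ofReal_mul hpos.le, ENNReal.ofReal_toReal hT]
  rfl

/-- Restriction to a nc spanning set is injective. -/
theorem IsNCSpanning.restrict_injective (h : IsNCSpanning K) :
    Function.Injective (restrict K) := by
  refine (injective_iff_map_eq_zero (restrict K)).2 fun φ hφ => ?_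
  obtain ⟨C, hC⟩ := h.exists_norm_le
  have hx : ∀ n, ∀ x ∈ K n, x.1 φ = 0 := by
    intro n x hx
    have h1 := congrArg (fun f : Aff K => f.1 n ⟨x, hx⟩) hφ
    exact h1
  rw [← norm_le_zero_iff]
  refine le_of_forall_pos_le_add fun ε hε => ?_
  have h2 := hC φ (ε / max C 1) (by positivity) fun n x hx' => by
    rw [hx n x hx', norm_zero]; positivity
  refine h2.trans ?_
  rw [zero_add]
  calc C * (ε / max C 1) ≤ max C 1 * (ε / max C 1) := by gcongr; exact le_max_left _ _
    _ = ε := mul_div_cancel₀ _ (by positivity)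

/-- Restriction to a nc compact convex set is completely bounded. -/
theorem IsNCCompactConvex.exists_affMatNorm_restrict_le (hκ : Cardinal.aleph0 ≤ κ)
    (hK : IsNCCompactConvex K) : ∃ C : ℝ≥0, cbNorm OperatorSpace.mnorm (affMatNorm K)
      (restrict K) ≤ C := by
  obtain ⟨C, hC⟩ := hK.exists_matNorm_le hκ
  refine ⟨C, iSup_le fun r => iSup_le fun a => iSup_le fun ha => iSup_le fun n =>
    iSup_le fun x => ?_⟩
  exact (blockOp_le_matNorm x.1.1 ha).trans (hC n x.1 x.2)

end BoundedBelow

/-! ### Complete isomorphisms and matrix extensions -/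

section CompletelyBounded

theorem le_cbNorm {V W : Type*} [AddCommGroup V] [Module ℂ V] [AddCommGroup W] [Module ℂ W]
    {p : MatNorm V} {q : MatNorm W} (T : V →ₗ[ℂ] W) {n : ℕ} {a : Matrix (Fin n) (Fin n) V}
    (ha : p n a ≤ 1) : q n (a.map T) ≤ cbNorm p q T := by
  rw [cbNorm]
  refine le_iSup_of_le n ?_
  refine le_iSup_of_le a ?_
  exact le_iSup_of_le ha le_rfl

theorem cb_apply_le_mul {V W : Type*} [AddCommGroup V] [Module ℂ V] [AddCommGroup W] [Module ℂ W]
    {p : MatNorm V} {q : MatNorm W} (T : V →ₗ[ℂ] W)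
    (hp : ∀ (n : ℕ) (c : ℂ) (a : Matrix (Fin n) (Fin n) V),
      p n (c • a) ≤ ENNReal.ofReal ‖c‖ * p n a)
    (hq : ∀ (n : ℕ) (c : ℂ) (b : Matrix (Fin n) (Fin n) W),
      q n (c • b) ≤ ENNReal.ofReal ‖c‖ * q n b)
    {n : ℕ} {a : Matrix (Fin n) (Fin n) V} {D : ℝ} (hD : 0 < D) (ha : p n a ≤ ENNReal.ofReal D) :
    q n (a.map T) ≤ ENNReal.ofReal D * cbNorm p q T := by
  have h1 : p n (((D⁻¹ : ℝ) : ℂ) • a) ≤ 1 := by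
    refine (hp n _ a).trans ((mul_le_mul_right ha _).trans ?_)
    rw [Complex.norm_real, Real.norm_of_nonneg (by positivity), ← ENNReal.ofReal_mul (by positivity),
      inv_mul_cancel₀ hD.ne', ENNReal.ofReal_one]
  have h2 : a.map T = (D : ℂ) • ((((D⁻¹ : ℝ) : ℂ) • a).map T) := by
    have hD' : (D : ℂ) ≠ 0 := by exact_mod_cast hD.ne'
    ext i j
    rw [Matrix.smul_apply, Matrix.map_apply, Matrix.map_apply, Matrix.smul_apply, map_smul,
      smul_smul, Complex.ofReal_inv, mul_inv_cancel₀ hD', one_smul]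
  rw [h2]
  refine (hq n _ _).trans ?_
  rw [Complex.norm_real, Real.norm_of_nonneg hD.le]
  exact mul_le_mul_right (le_cbNorm T h1) _

theorem opMatNorm_smul_le {H : Type*} [NormedAddCommGroup H] [InnerProductSpace ℂ H] (n : ℕ) (c : ℂ)
    (T : Matrix (Fin n) (Fin n) (H →L[ℂ] H)) :
    opMatNorm H n (c • T) ≤ ENNReal.ofReal ‖c‖ * opMatNorm H n T := by
  rw [opMatNorm, blockOp_smul, opMatNorm, ← ENNReal.ofReal_mul (norm_nonneg _)]
  exact ENNReal.ofReal_le_ofReal (ContinuousLinearMap.opNorm_smul_le c (blockOp T))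

variable {F : Type u} [NormedAddCommGroup F] [NormedSpace ℂ F] [OperatorSpace F]
variable {κ : Cardinal.{v}} {K : NCSet F κ}

theorem affMatNorm_smul_le (n : ℕ) (c : ℂ) (a : Matrix (Fin n) (Fin n) (Aff K)) :
    affMatNorm K n (c • a) ≤ ENNReal.ofReal ‖c‖ * affMatNorm K n a := by
  refine iSup_le fun m => iSup_le fun x => ?_
  have h : ((c • a).map fun g => g.1 m x) = c • (a.map fun g => g.1 m x) := by
    ext i j : 2
    rfl
  rw [h]
  refine (opMatNorm_smul_le n c _).trans (mul_le_mul_right ?_ _)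
  exact le_iSup_of_le m (le_iSup_of_le x le_rfl)

theorem opMatNorm_one_le {H : Type*} [NormedAddCommGroup H] [InnerProductSpace ℂ H]
    (T : Matrix (Fin 1) (Fin 1) (H →L[ℂ] H)) : opMatNorm H 1 T ≤ ENNReal.ofReal ‖T 0 0‖ := by
  have h : blockOp T = diagOp 1 (T 0 0) := by
    ext1 ξ
    refine PiLp.ext fun i => ?_
    rw [blockOp_apply, diagOp_apply, Fin.sum_univ_one, Subsingleton.elim i 0]
  rw [opMatNorm, h]
  exact ENNReal.ofReal_le_ofReal (norm_diagOp_le 1 _)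

theorem affMatNorm_restrict_le_mul {C : ℝ≥0} (hC : ∀ n, ∀ x ∈ K n, matNorm x.1 ≤ C) (φ : F) :
    affMatNorm K 1 (Matrix.of fun _ _ => restrict K φ) ≤
      C * OperatorSpace.mnorm 1 (Matrix.of fun _ _ => φ) := by
  have hm : ENNReal.ofReal ‖φ‖ * C = C * OperatorSpace.mnorm 1 (Matrix.of fun _ _ => φ) := by
    rw [OperatorSpace.mnorm_one, mul_comm]
    rfl
  refine le_trans ?_ hm.le
  refine iSup_le fun n => iSup_le fun x => ?_
  refine (opMatNorm_one_le (Matrix.of fun _ _ => x.1.1 φ)).trans ?_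
  have h : ENNReal.ofReal ‖x.1.1 φ‖ ≤ ENNReal.ofReal ‖φ‖ * C :=
    (norm_apply_le x.1.1 φ).trans (mul_le_mul_right (hC n x.1 x.2) _)
  exact h

/-- Bicontinuity of the restriction map amounts to surjectivity. -/
theorem isBicontinuousIso_restrict_iff (hκ : Cardinal.aleph0 ≤ κ) (hK : IsNCCompactConvex K)
    (hspan : IsNCSpanning K) :
    IsBicontinuousIso OperatorSpace.mnorm (affMatNorm K) (restrict K) ↔
      Function.Surjective (restrict K) := by
  obtain ⟨C, hC⟩ := hK.exists_matNorm_le hκ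
  exact ⟨fun h => h.1.2, fun h => ⟨⟨hspan.restrict_injective, h⟩,
    ⟨C, affMatNorm_restrict_le_mul hC⟩, hspan.exists_mnorm_one_le⟩⟩

end CompletelyBounded

section Entries

variable {F : Type u} [NormedAddCommGroup F] [NormedSpace ℂ F] [OperatorSpace F]
variable {κ : Cardinal.{v}} {K : NCSet F κ} {N : Type w}

open Classical in
/-- The matrix entries of a continuous nc affine function with values in `M_N`. -/
def IsMatAff.entry {f : ∀ n : Level κ, K n → (L2Sum N (L2 n.1) →L[ℂ] L2Sum N (L2 n.1))}
    (hf : IsMatAff K N f) (k l : N) : Aff K :=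
  ⟨fun n x => coordCLM (L2 n.1) k ∘L f n x ∘L inclCLM (L2 n.1) l, by
    refine ⟨fun n m α x y hα hC hd ξ => ?_, fun n m β hβ x y hxy => ?_, fun n => ?_⟩
    · have h := (hf.directSum n m α x y hα hC hd (lp.single 2 l ξ)).mapL (coordCLM (L2 n.1) k)
      simp only [ampl_single] at h
      exact h
    · refine ContinuousLinearMap.ext fun ξ => ?_
      have h := hf.compress n m β hβ x y hxy
      change f m y (lp.single 2 l ξ) k =
        ContinuousLinearMap.adjoint β (f n x (lp.single 2 l (β ξ)) k)
      rw [h, ← ampl_single]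
      rfl
    · exact @Continuous.comp _ _ _ (levelTop K n) (opWeakStar _) (opWeakStar _) _ _
        (continuous_opWeakStar_comp (coordCLM (L2 n.1) k) (inclCLM (L2 n.1) l))
        (hf.continuous n)⟩

open Classical in
theorem IsMatAff.entry_apply {f : ∀ n : Level κ, K n → (L2Sum N (L2 n.1) →L[ℂ] L2Sum N (L2 n.1))}
    (hf : IsMatAff K N f) (k l : N) (n : Level κ) (x : K n) (ξ : L2 n.1) :
    (hf.entry k l).1 n x ξ = f n x (lp.single 2 l ξ) k := rfl

/-- If restriction is a complete isomorphism, continuous nc affine functions into `M_N` are given by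
matrices over `F`: apply the inverse of the restriction map to the entries. -/
theorem exists_matrixExtension_of_isCompleteIso (hκ : Cardinal.aleph0 ≤ κ)
    (hK : IsNCCompactConvex K)
    (h : IsCompleteIso OperatorSpace.mnorm (affMatNorm K) (restrict K))
    {f : ∀ n : Level κ, K n → (L2Sum N (L2 n.1) →L[ℂ] L2Sum N (L2 n.1))}
    (hf : IsMatAff K N f) :
    ∃ ψ : Matrix N N F, IsBoundedMatrix ψ ∧ IsMatrixExtension K f ψ := by
  classical
  obtain ⟨e, he, -, hcb⟩ := h
  obtain ⟨C, hC0, hC⟩ := hf.exists_norm_le hκ hK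
  refine ⟨Matrix.of fun k l => e.symm (hf.entry k l), ?_, fun n x k l ξ => ?_⟩
  -- `C + 1` instead of `C`, so as to divide by it
  · have hpos : 0 < C + 1 := by positivity
    refine ⟨(ENNReal.ofReal (C + 1) * cbNorm (affMatNorm K) OperatorSpace.mnorm
      (e.symm : Aff K →ₗ[ℂ] F)).toNNReal, fun m σ => ?_⟩
    rw [ENNReal.coe_toNNReal (ENNReal.mul_lt_top ENNReal.ofReal_lt_top hcb).ne]
    refine cb_apply_le_mul (e.symm : Aff K →ₗ[ℂ] F) affMatNorm_smul_le
      (fun n c a => (OperatorSpace.mnorm_smul n c a).le)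
      (a := Matrix.of fun i j => hf.entry (σ i) (σ j)) hpos ?_
    refine iSup_le fun n => iSup_le fun x => ENNReal.ofReal_le_ofReal ?_
    refine (norm_blockOp_le_of_entries σ (f n x) _ fun i j ζ => ?_).trans
      ((hC n x).trans (by linarith))
    rw [Matrix.map_apply, Matrix.of_apply, hf.entry_apply]
  · have h1 : restrict K (e.symm (hf.entry k l)) = hf.entry k l :=
      (LinearMap.congr_fun he _).symm.trans (e.apply_symm_apply _)
    have h2 : (restrict K (e.symm (hf.entry k l))).1 n x ξ = (hf.entry k l).1 n x ξ := by rw [h1]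
    refine Eq.trans ?_ h2.symm
    rw [hf.entry_apply]

end Entries

/-! ### The linear map given by a matrix of entries -/

section MatrixToLinear
open scoped Classical

variable {F : Type u} [NormedAddCommGroup F] [NormedSpace ℂ F] [OperatorSpace F]
variable {κ : Cardinal.{v}} {K : NCSet F κ} {N : Type w}

theorem clm_ext_stdVec {ι : Type*} {E : Type*} [NormedAddCommGroup E] [NormedSpace ℂ E]
    {S T : L2 ι →L[ℂ] E} (h : ∀ j, S (stdVec j) = T (stdVec j)) : S = T := by
  refine ContinuousLinearMap.ext fun ξ => ?_
  exact mem_of_forall_stdVec_mem (S := LinearMap.eqLocus (S : L2 ι →ₗ[ℂ] E) T)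
    (isClosed_eq S.continuous T.continuous) h ξ

/-- If `ψ` extends a function on a nc spanning set with values in `M_N`, then `[g(ψ_kl)]` is a
bounded operator for every functional `g`, since `g` is a coefficient of an element of the span. -/
theorem IsMatrixExtension.exists_operator (hspan : IsNCSpanning K)
    {f : ∀ n : Level κ, K n → (L2Sum N (L2 n.1) →L[ℂ] L2Sum N (L2 n.1))} {ψ : Matrix N N F}
    (hψ : IsMatrixExtension K f ψ) (g : StrongDual ℂ F) :
    ∃ T : L2 N →L[ℂ] L2 N, ∀ k l, T (stdVec l) k = g (ψ k l) := by
  obtain ⟨n, hn⟩ := hspan.exists_ncSpan_eq_top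
  obtain ⟨i⟩ := n.2.1
  have h1 : ∀ y ∈ ncSpan K n, ∃ T : L2Sum N (L2 n.1) →L[ℂ] L2Sum N (L2 n.1),
      ∀ k l ξ, T (lp.single 2 l ξ) k = y.1 (ψ k l) ξ := by
    intro y hy
    refine Submodule.span_induction (p := fun y _ => ∃ T : L2Sum N (L2 n.1) →L[ℂ] L2Sum N (L2 n.1),
      ∀ k l ξ, T (lp.single 2 l ξ) k = y.1 (ψ k l) ξ) ?_ ?_ ?_ ?_ hy
    · rintro _ ⟨m, a, b, x, hx, rfl⟩
      refine ⟨ampl N (ContinuousLinearMap.adjoint a) ∘L f m ⟨x, hx⟩ ∘L ampl N b, fun k l ξ => ?_⟩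
      rw [conj_apply, ContinuousLinearMap.comp_apply, ContinuousLinearMap.comp_apply, ampl_single,
        ampl_apply, ← hψ m ⟨x, hx⟩]
    · exact ⟨0, fun k l ξ => by simp⟩
    · rintro x y _ _ ⟨S, hS⟩ ⟨T, hT⟩
      refine ⟨S + T, fun k l ξ => ?_⟩
      change S (lp.single 2 l ξ) k + T (lp.single 2 l ξ) k = x.1 (ψ k l) ξ + y.1 (ψ k l) ξ
      rw [hS, hT]
    · rintro c x _ ⟨T, hT⟩
      refine ⟨c • T, fun k l ξ => ?_⟩
      change c • T (lp.single 2 l ξ) k = c • x.1 (ψ k l) ξ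
      rw [hT]
  obtain ⟨T, hT⟩ := h1 (diagUnit i g) (hn ▸ Submodule.mem_top)
  let b : ℂ →L[ℂ] L2 n.1 := (ContinuousLinearMap.id ℂ ℂ).smulRight (stdVec i)
  refine ⟨ampl N (innerSL ℂ (stdVec i : L2 n.1)) ∘L T ∘L ampl N b, fun k l => ?_⟩
  have hb : ampl N b (stdVec l : L2 N) = lp.single 2 l (b 1) := ampl_single b l (1 : ℂ)
  change innerSL ℂ (stdVec i : L2 n.1) (T (ampl N b (stdVec l : L2 N)) k) = g (ψ k l)
  rw [hb, hT, innerSL_apply_apply, inner_stdVec_left, diagUnit_apply]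
  simp [b, stdVec_apply]

/-- The operators `[g(ψ_kl)]` depend linearly on `g`. -/
theorem IsMatrixExtension.exists_linearMap (hspan : IsNCSpanning K)
    {f : ∀ n : Level κ, K n → (L2Sum N (L2 n.1) →L[ℂ] L2Sum N (L2 n.1))} {ψ : Matrix N N F}
    (hψ : IsMatrixExtension K f ψ) :
    ∃ Ψ : StrongDual ℂ F →ₗ[ℂ] (L2 N →L[ℂ] L2 N),
      ∀ g k l, Ψ g (stdVec l) k = g (ψ k l) := by
  choose T hT using hψ.exists_operator hspan
  refine ⟨{ toFun := T, map_add' := fun g h => ?_, map_smul' := fun c g => ?_ }, hT⟩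
  · refine clm_ext_stdVec fun l => lp.ext (funext fun k => ?_)
    rw [add_apply, lp.coeFn_add, Pi.add_apply, hT, hT, hT, add_apply]
  · refine clm_ext_stdVec fun l => lp.ext (funext fun k => ?_)
    rw [RingHom.id_apply, smul_apply, lp.coeFn_smul, Pi.smul_apply, hT, hT, smul_apply]

theorem inner_finIncl_apply_finIncl {r : ℕ} (e : Fin r ↪ N) (T : L2 N →L[ℂ] L2 N)
    (u v : PiLp 2 (fun _ : Fin r => ℂ)) :
    ⟪(finIncl e u : L2 N), T (finIncl e v)⟫_ℂ =
      ∑ p, ∑ q, star (u p) * v q * T (stdVec (e q)) (e p) := by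
  rw [finIncl_apply, finIncl_apply, sum_inner]
  refine Finset.sum_congr rfl fun p _ => ?_
  rw [map_sum, inner_sum]
  refine Finset.sum_congr rfl fun q _ => ?_
  rw [single_eq_smul_stdVec, single_eq_smul_stdVec, map_smul, inner_smul_left, inner_smul_right,
    inner_stdVec_left, ← mul_assoc]
  rfl

omit [OperatorSpace F] in
/-- The matrix coefficients of `[Ψ(X_ij)]` at finitely supported vectors, when
`Ψ(g) = [g(ψ_kl)]`. -/
theorem inner_blockOp_map_finIncl {ψ : Matrix N N F}
    {Ψ : StrongDual ℂ F →ₗ[ℂ] (L2 N →L[ℂ] L2 N)} (hΨ : ∀ g k l, Ψ g (stdVec l) k = g (ψ k l))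
    {m r : ℕ} (e : Fin r ↪ N) (X : Matrix (Fin m) (Fin m) (StrongDual ℂ F))
    (u v : Fin m → PiLp 2 (fun _ : Fin r => ℂ)) :
    ⟪(WithLp.toLp 2 fun i => finIncl e (u i) : PiLp 2 fun _ : Fin m => L2 N),
      blockOp (X.map Ψ) (WithLp.toLp 2 fun i => finIncl e (v i))⟫_ℂ =
      ∑ i, ∑ j, ∑ p, ∑ q, star (u i p) * v j q * X i j (ψ (e p) (e q)) := by
  rw [inner_blockOp]
  refine Finset.sum_congr rfl fun i _ => Finset.sum_congr rfl fun j _ => ?_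
  refine (inner_finIncl_apply_finIncl e (Ψ (X i j)) (u i) (v j)).trans ?_
  simp only [hΨ]

theorem norm_toLp_finIncl {m r : ℕ} (e : Fin r ↪ N) (u : Fin m → PiLp 2 (fun _ : Fin r => ℂ)) :
    ‖(WithLp.toLp 2 fun i => finIncl e (u i) : PiLp 2 fun _ : Fin m => L2 N)‖ ^ 2 =
      ∑ i, ∑ p, ‖u i p‖ ^ 2 := by
  rw [PiLp.norm_sq_eq_of_L2]
  refine Finset.sum_congr rfl fun i _ => ?_
  refine (congrArg (· ^ 2) (norm_finIncl e (u i))).trans ?_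
  exact PiLp.norm_sq_eq_of_L2 _ _

/-- An enumeration of a finite set of indices. -/
def finsetEmb (s : Finset N) : Fin s.card ↪ N :=
  s.equivFin.symm.toEmbedding.trans (Function.Embedding.subtype _)

theorem finIncl_finProj_finsetEmb (s : Finset N) (ξ : L2 N) :
    (finIncl (finsetEmb s) (finProj (finsetEmb s) ξ) : L2 N) = ∑ k ∈ s, lp.single 2 k (ξ k) := by
  rw [finIncl_apply, ← Finset.sum_coe_sort s,
    ← Equiv.sum_comp s.equivFin.symm]
  rfl

theorem tendsto_finIncl_finProj (ξ : L2 N) :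
    Filter.Tendsto (fun s : Finset N => (finIncl (finsetEmb s) (finProj (finsetEmb s) ξ) : L2 N))
      Filter.atTop (𝓝 ξ) := by
  have h := lp.hasSum_single (p := 2) ENNReal.ofNat_ne_top ξ
  rw [HasSum, SummationFilter.unconditional_filter] at h
  refine h.congr fun s => ?_
  rw [finIncl_finProj_finsetEmb]

theorem opNorm_le_of_finitely_supported {m : ℕ}
    {A : PiLp 2 (fun _ : Fin m => L2 N) →L[ℂ] PiLp 2 (fun _ : Fin m => L2 N)} {C : ℝ} (hC : 0 ≤ C)
    (h : ∀ (r : ℕ) (e : Fin r ↪ N) (u v : Fin m → PiLp 2 (fun _ : Fin r => ℂ)),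
      ‖⟪(WithLp.toLp 2 fun i => finIncl e (u i) : PiLp 2 fun _ : Fin m => L2 N),
        A (WithLp.toLp 2 fun i => finIncl e (v i))⟫_ℂ‖ ≤
        C * (Real.sqrt (∑ i, ∑ p, ‖u i p‖ ^ 2) * Real.sqrt (∑ i, ∑ p, ‖v i p‖ ^ 2))) :
    ‖A‖ ≤ C := by
  refine opNorm_le_of_inner_le hC fun η ξ hη hξ => ?_
  have ht : ∀ ζ : PiLp 2 (fun _ : Fin m => L2 N), Filter.Tendsto (fun s : Finset N =>
      (WithLp.toLp 2 fun i => finIncl (finsetEmb s) (finProj (finsetEmb s) (ζ i)) :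
        PiLp 2 fun _ : Fin m => L2 N)) Filter.atTop (𝓝 ζ) := by
    intro ζ
    have h1 := (PiLp.continuous_toLp 2 fun _ : Fin m => L2 N).continuousAt (x := ζ.ofLp)
    exact h1.tendsto.comp (tendsto_pi_nhds.2 fun i => tendsto_finIncl_finProj (ζ i))
  have hs : ∀ (ζ : PiLp 2 (fun _ : Fin m => L2 N)) (s : Finset N), ‖ζ‖ ≤ 1 →
      Real.sqrt (∑ i, ∑ p, ‖(finProj (finsetEmb s) (ζ i) : PiLp 2 fun _ => ℂ) p‖ ^ 2) ≤ 1 := by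
    intro ζ s hζ
    rw [Real.sqrt_le_one]
    refine le_trans ?_ (pow_le_one₀ (n := 2) (norm_nonneg ζ) hζ)
    rw [PiLp.norm_sq_eq_of_L2]
    refine Finset.sum_le_sum fun i _ => ?_
    have h1 := norm_finProj_le (finsetEmb s) (ζ i)
    rw [← sq_le_sq₀ (norm_nonneg _) (norm_nonneg _), PiLp.norm_sq_eq_of_L2] at h1
    exact h1
  refine le_of_tendsto (((ht η).inner ((A.continuous.tendsto ξ).comp (ht ξ))).norm)
    (Filter.Eventually.of_forall fun s => ?_)
  refine (h _ _ _ _).trans (mul_le_of_le_one_right hC ?_)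
  exact mul_le_one₀ (hs η s hη) (Real.sqrt_nonneg _) (hs ξ s hξ)

/-- If the finite submatrices of `ψ` are uniformly bounded, `Ψ(g) = [g(ψ_kl)]` is completely
bounded: up to a flip of tensor factors, `[Ψ(X_ij)]` is `X` applied to `ψ`. -/
theorem isCB_of_isBoundedMatrix {ψ : Matrix N N F} (hψ : IsBoundedMatrix ψ)
    {Ψ : StrongDual ℂ F →ₗ[ℂ] (L2 N →L[ℂ] L2 N)} (hΨ : ∀ g k l, Ψ g (stdVec l) k = g (ψ k l)) :
    IsCB (dualMatNorm F) (opMatNorm (L2 N)) Ψ := by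
  obtain ⟨C, hC⟩ := hψ
  refine lt_of_le_of_lt (b := ENNReal.ofReal (C + 1)) ?_ ENNReal.ofReal_lt_top
  refine iSup_le fun m => iSup_le fun X => iSup_le fun hX => ENNReal.ofReal_le_ofReal ?_
  have hC1 : (0 : ℝ) < C + 1 := by positivity
  refine opNorm_le_of_finitely_supported hC1.le fun r e u v => ?_
  rw [inner_blockOp_map_finIncl hΨ]
  set B := blockOp ((ψ.submatrix e e).map (evalMat X)) with hB
  have hBn : ‖B‖ ≤ C + 1 := by
    have h1 : OperatorSpace.mnorm r ((((C + 1)⁻¹ : ℝ) : ℂ) • ψ.submatrix e e) ≤ 1 := by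
      rw [OperatorSpace.mnorm_smul, Complex.norm_real, Real.norm_of_nonneg (by positivity)]
      refine (mul_le_mul_right
        ((hC r e).trans (?_ : (C : ℝ≥0∞) ≤ ENNReal.ofReal (C + 1))) _).trans ?_
      · rw [← ENNReal.ofReal_coe_nnreal]
        exact ENNReal.ofReal_le_ofReal (by linarith)
      · rw [← ENNReal.ofReal_mul (by positivity), inv_mul_cancel₀ hC1.ne', ENNReal.ofReal_one]
    have h2 := (blockOp_le_dualMatNorm X h1).trans hX
    rw [ENNReal.ofReal_le_one] at h2
    have h3 : B = ((C + 1 : ℝ) : ℂ) •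
        blockOp (((((C + 1)⁻¹ : ℝ) : ℂ) • ψ.submatrix e e).map (evalMat X)) := by
      rw [← blockOp_smul, hB]
      congr 1
      refine Matrix.ext fun p q => ?_
      have hlin : ∀ (c : ℂ) φ, evalMat X (c • φ) = c • evalMat X φ := by
        intro c φ
        rw [evalMat, evalMat, ← map_smul]
        congr 1
        ext i j
        simp
      rw [Matrix.smul_apply, Matrix.map_apply, Matrix.map_apply, Matrix.smul_apply, hlin,
        smul_smul, ← Complex.ofReal_mul, mul_inv_cancel₀ hC1.ne', Complex.ofReal_one, one_smul]
    rw [h3]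
    refine (ContinuousLinearMap.opNorm_smul_le _ _).trans ?_
    rw [Complex.norm_real, Real.norm_of_nonneg hC1.le]
    exact mul_le_of_le_one_right hC1.le h2
  set u' : PiLp 2 (fun _ : Fin r => EuclideanSpace ℂ (Fin m)) :=
    WithLp.toLp 2 fun p => WithLp.toLp 2 fun i => u i p with hu'
  set v' : PiLp 2 (fun _ : Fin r => EuclideanSpace ℂ (Fin m)) :=
    WithLp.toLp 2 fun p => WithLp.toLp 2 fun i => v i p with hv'
  have hn : ∀ w : Fin m → PiLp 2 (fun _ : Fin r => ℂ),
      ‖(WithLp.toLp 2 fun p => WithLp.toLp 2 fun i => w i p :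
        PiLp 2 (fun _ : Fin r => EuclideanSpace ℂ (Fin m)))‖ =
        Real.sqrt (∑ i, ∑ p, ‖w i p‖ ^ 2) := by
    intro w
    rw [PiLp.norm_eq_of_L2, Finset.sum_comm]
    congr 1
    refine Finset.sum_congr rfl fun p _ => ?_
    exact EuclideanSpace.norm_sq_eq _
  have hsum : ∑ i, ∑ j, ∑ p, ∑ q, star (u i p) * v j q * X i j (ψ (e p) (e q)) =
      ⟪u', B v'⟫_ℂ := by
    rw [inner_blockOp]
    have h1 : ∀ p q, ⟪u' p, ((ψ.submatrix e e).map (evalMat X)) p q (v' q)⟫_ℂ =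
        ∑ i, ∑ j, star (u i p) * v j q * X i j (ψ (e p) (e q)) := by
      intro p q
      rw [PiLp.inner_apply]
      refine Finset.sum_congr rfl fun i _ => ?_
      rw [Matrix.map_apply, evalMat_apply, inner_sum]
      refine Finset.sum_congr rfl fun j _ => ?_
      rw [RCLike.inner_apply]
      simp only [hu', hv', Matrix.submatrix_apply, Complex.star_def]
      ring
    simp only [h1]
    calc ∑ i, ∑ j, ∑ p, ∑ q, star (u i p) * v j q * X i j (ψ (e p) (e q))
        = ∑ i, ∑ p, ∑ j, ∑ q, star (u i p) * v j q * X i j (ψ (e p) (e q)) :=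
          Finset.sum_congr rfl fun i _ => Finset.sum_comm
      _ = ∑ p, ∑ i, ∑ j, ∑ q, star (u i p) * v j q * X i j (ψ (e p) (e q)) := Finset.sum_comm
      _ = ∑ p, ∑ i, ∑ q, ∑ j, star (u i p) * v j q * X i j (ψ (e p) (e q)) :=
          Finset.sum_congr rfl fun p _ => Finset.sum_congr rfl fun i _ => Finset.sum_comm
      _ = _ := Finset.sum_congr rfl fun p _ => Finset.sum_comm
  rw [hsum]
  refine (norm_inner_le_norm _ _).trans ?_
  rw [← hn u, ← hn v]
  refine (mul_le_mul_of_nonneg_left (B.le_opNorm v') (norm_nonneg _)).trans ?_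
  rw [mul_left_comm]
  exact mul_le_mul_of_nonneg_right hBn (by positivity)

omit [OperatorSpace F] in
/-- If `Ψ(g) = [g(ψ_kl)]` with `ψ_kl ∈ F`, then `Ψ` is weak* continuous: the functionals `ω` with
`ω ∘ Ψ ∈ F` form a closed subspace, because `F` is complete. -/
theorem isWeakStarContinuous_of_entries [CompleteSpace F] {ψ : Matrix N N F}
    {Ψ : StrongDual ℂ F →ₗ[ℂ] (L2 N →L[ℂ] L2 N)} (hΨ : ∀ g k l, Ψ g (stdVec l) k = g (ψ k l)) :
    IsWeakStarContinuous Ψ := by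
  -- closed graph theorem, as the entries of `Ψ` are continuous
  have hcont : Continuous Ψ := by
    refine LinearMap.continuous_of_seq_closed_graph Ψ fun g g₀ T hg hT => ?_
    refine clm_ext_stdVec fun l => lp.ext (funext fun k => ?_)
    have h1 : Filter.Tendsto (fun n => (Ψ (g n)) (stdVec l) k) Filter.atTop
        (𝓝 (T (stdVec l) k)) :=
      (((coordCLM ℂ k) ∘L ContinuousLinearMap.apply ℂ (L2 N) (stdVec l)).continuous.tendsto T).comp
        hT
    have h2 : Filter.Tendsto (fun n => (g n) (ψ k l)) Filter.atTop (𝓝 (g₀ (ψ k l))) :=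
      ((ContinuousLinearMap.apply ℂ ℂ (ψ k l)).continuous.tendsto g₀).comp hg
    simp only [hΨ] at h1
    rw [hΨ]
    exact tendsto_nhds_unique h1 h2
  let L : StrongDual ℂ F →L[ℂ] (L2 N →L[ℂ] L2 N) := ⟨Ψ, hcont⟩
  let M := (ContinuousLinearMap.compL ℂ (StrongDual ℂ F) (L2 N →L[ℂ] L2 N) ℂ).flip L
  let J := NormedSpace.inclusionInDoubleDual ℂ F
  have hJi : Isometry J := (NormedSpace.inclusionInDoubleDualLi (E := F) ℂ).isometry
  have hJ : IsClosed (Set.range J) := hJi.isClosedEmbedding.isClosed_range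
  have key : opPredual (L2 N) ≤ (LinearMap.range (J : F →ₗ[ℂ] _)).comap
      M.toLinearMap := by
    refine opPredual_le_of_total (closure_span_stdVec N) (hJ.preimage M.continuous) ?_
    rintro _ ⟨k, rfl⟩ _ ⟨l, rfl⟩
    refine ⟨ψ k l, ?_⟩
    refine ContinuousLinearMap.ext fun g => ?_
    change g (ψ k l) = ⟪(stdVec k : L2 N), Ψ g (stdVec l)⟫_ℂ
    rw [inner_stdVec_left, hΨ]
  refine continuous_opWeakStar_iff.2 fun ω hω => ?_
  obtain ⟨φ, hφ⟩ := key hω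
  have h1 : (fun x : WeakDual ℂ F => ω (Ψ (WeakDual.toStrongDual x))) = fun x => x φ := by
    funext x
    exact (congrArg (fun G : StrongDual ℂ (StrongDual ℂ F) => G (WeakDual.toStrongDual x))
      hφ).symm
  rw [h1]
  exact WeakDual.eval_continuous φ

theorem isLinearExtension_of_entries
    {f : ∀ n : Level κ, K n → (L2Sum N (L2 n.1) →L[ℂ] L2Sum N (L2 n.1))} {ψ : Matrix N N F}
    (hψ : IsMatrixExtension K f ψ)
    {Ψ : StrongDual ℂ F →ₗ[ℂ] (L2 N →L[ℂ] L2 N)} (hΨ : ∀ g k l, Ψ g (stdVec l) k = g (ψ k l)) :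
    IsLinearExtension K f Ψ := by
  intro n x i j k l
  rw [inner_stdVec_left k, hΨ, entry_apply]
  congr 1
  exact hψ n x k l (stdVec j)

end MatrixToLinear

/-! ### Matrices over `𝔸(K)` with finite columns -/

section ColumnFinite
open scoped Classical

variable {F : Type u} [NormedAddCommGroup F] [NormedSpace ℂ F] [OperatorSpace F]
variable {κ : Cardinal.{v}} {K : NCSet F κ} {N : Type w}

theorem isClosed_setOf_tendsto_of_norm_le {E J : Type*} [NormedAddCommGroup E] [NormedSpace ℂ E]
    {l : Filter J} {S : J → E →L[ℂ] E} {C : ℝ} (hS : ∀ j, ‖S j‖ ≤ C) (T : E →L[ℂ] E) :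
    IsClosed {ξ | Filter.Tendsto (fun j => S j ξ) l (𝓝 (T ξ))} := by
  refine Equicontinuous.isClosed_setOfPred_tendsto ?_ T.continuous
  have h : ∃ C, ∀ j, ‖S j‖ ≤ C := ⟨C, hS⟩
  exact ((NormedSpace.equicontinuous_TFAE S).out 5 1).1 h

/-- The partial sums `∑ α_i T_i α_i^*` of a direct sum of operators of norm at most `C` have norm
at most `C`. -/
theorem IsIsometricPartition.norm_partialSum_le {I n : Type v} {m : I → Type v}
    {α : ∀ i, L2 (m i) →L[ℂ] L2 n} (hα : IsIsometricPartition α)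
    {T : ∀ i, L2Sum N (L2 (m i)) →L[ℂ] L2Sum N (L2 (m i))} {C : ℝ} (hC : 0 ≤ C)
    (hT : ∀ i, ‖T i‖ ≤ C) (s : Finset I) :
    ‖∑ i ∈ s, ampl N (α i) ∘L T i ∘L ampl N (ContinuousLinearMap.adjoint (α i))‖ ≤ C := by
  refine opNorm_le_of_inner_le hC fun η ξ hη hξ => ?_
  rw [sum_apply, inner_sum]
  refine (norm_sum_le _ _).trans ?_
  have h1 : ∀ i, ‖⟪η, (ampl N (α i) ∘L T i ∘L
      ampl N (ContinuousLinearMap.adjoint (α i))) ξ⟫_ℂ‖ ≤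
      C * (‖ampl N (ContinuousLinearMap.adjoint (α i)) η‖ *
        ‖ampl N (ContinuousLinearMap.adjoint (α i)) ξ‖) := by
    intro i
    rw [ContinuousLinearMap.comp_apply, ContinuousLinearMap.comp_apply, norm_inner_symm,
      inner_ampl_left, norm_inner_symm]
    refine (norm_inner_le_norm _ _).trans ?_
    rw [mul_left_comm]
    refine mul_le_mul_of_nonneg_left ?_ (norm_nonneg _)
    exact (ContinuousLinearMap.le_opNorm _ _).trans
      (mul_le_mul_of_nonneg_right (hT i) (norm_nonneg _))
  refine (Finset.sum_le_sum fun i _ => h1 i).trans ?_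
  rw [← Finset.mul_sum]
  refine mul_le_of_le_one_right hC ((Real.sum_mul_le_sqrt_mul_sqrt _ _ _).trans ?_)
  refine mul_le_one₀ (Real.sqrt_le_one.2 ?_) (Real.sqrt_nonneg _) (Real.sqrt_le_one.2 ?_)
  · exact (hα.sum_norm_sq_ampl_le s η).trans (pow_le_one₀ (norm_nonneg _) hη)
  · exact (hα.sum_norm_sq_ampl_le s ξ).trans (pow_le_one₀ (norm_nonneg _) hξ)

theorem continuous_inner_aff (g : Aff K) (n : Level κ) (η ξ : L2 n.1) :
    Continuous[levelTop K n, _] fun x => ⟪η, g.1 n x ξ⟫_ℂ :=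
  (@continuous_opWeakStar_iff _ _ _ _ (levelTop K n) _).1 (g.2.2.2 n) _
    (vecFunctional_mem_opPredual η ξ)

/-- A bounded operator-valued function whose matrix has entries in `𝔸(K)` and finitely supported
columns is a continuous nc affine function. -/
theorem isMatAff_of_columns
    {f : ∀ n : Level κ, K n → (L2Sum N (L2 n.1) →L[ℂ] L2Sum N (L2 n.1))} {C : ℝ} (hC0 : 0 ≤ C)
    (hC : ∀ n x, ‖f n x‖ ≤ C) (s : N → Finset N) (G : N → N → Aff K)
    (hf : ∀ n x l ζ, f n x (lp.single 2 l ζ) = ∑ k ∈ s l, lp.single 2 k ((G k l).1 n x ζ)) :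
    IsMatAff K N f := by
  refine ⟨fun n m α x y hα hb hd ξ => ?_, fun n m β hβ x y hxy => ?_, fun n => ?_⟩
  · have hcl := isClosed_setOf_tendsto_of_norm_le (l := Filter.atTop)
      (hα.norm_partialSum_le hC0 fun i => hC (m i) (x i)) (f n y)
    -- convergence holds on columns, and passes to closed spans because partial sums are bounded
    let S : Submodule ℂ (L2Sum N (L2 n.1)) :=
      { carrier := {ξ | HasSum (fun i => ampl N (α i) (f (m i) (x i)
          (ampl N (ContinuousLinearMap.adjoint (α i)) ξ))) (f n y ξ)}
        zero_mem' := by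
          simp only [Set.mem_ofPred_eq, map_zero]
          exact hasSum_zero
        add_mem' := fun {a b} ha hb => by
          simp only [Set.mem_ofPred_eq, map_add] at ha hb ⊢
          exact ha.add hb
        smul_mem' := fun c a ha => by
          simp only [Set.mem_ofPred_eq, map_smul] at ha ⊢
          exact ha.const_smul c }
    refine mem_of_forall_single_mem (S := S) ?_ (fun l ζ => ?_) ξ
    · convert hcl using 1
      ext ξ
      simp only [sum_apply, ContinuousLinearMap.comp_apply, Set.mem_ofPred_eq]
      rfl
    · have h1 := hasSum_sum (s := s l) fun k _ =>
        (((G k l).2.1 n m α x y hα hb hd ζ).mapL (inclCLM (L2 n.1) k))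
      change HasSum _ _
      rw [hf]
      convert h1 using 1
      · funext i
        rw [ampl_single, hf, map_sum]
        refine Finset.sum_congr rfl fun k _ => ?_
        rw [ampl_single]
        rfl
      · rfl
  · refine ContinuousLinearMap.ext fun ξ => ?_
    refine mem_of_forall_single_mem (S := LinearMap.eqLocus (f m y : L2Sum N (L2 m.1) →ₗ[ℂ] _)
      (ampl N (ContinuousLinearMap.adjoint β) ∘L f n x ∘L ampl N β).toLinearMap)
      (isClosed_eq (f m y).continuous (ContinuousLinearMap.continuous _)) (fun l ζ => ?_) ξ
    change f m y (lp.single 2 l ζ) =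
      ampl N (ContinuousLinearMap.adjoint β) (f n x (ampl N β (lp.single 2 l ζ)))
    rw [ampl_single, hf, hf, map_sum]
    refine Finset.sum_congr rfl fun k _ => ?_
    rw [ampl_single, (G k l).2.2.1 n m β hβ x y hxy]
    rfl
  · refine @continuous_opWeakStar_of_bounded _ _ _ _ (levelTop K n) _ _ (hC n) _
      (closure_span_single N (L2 n.1)) ?_
    rintro _ ⟨⟨k', η⟩, rfl⟩ _ ⟨⟨l, ξ⟩, rfl⟩
    simp only [hf, inner_sum]
    let _ := levelTop K n
    refine continuous_finsetSum _ fun k _ => ?_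
    simp only [lp.inner_single_right]
    exact continuous_inner_aff (G k l) n _ ξ

end ColumnFinite

/-! ### Block diagonal operators -/

section BlockDiagonal
open scoped Classical

variable {N : Type w} {H : Type*} [NormedAddCommGroup H] [InnerProductSpace ℂ H]

/-- The embedding of the `j`-th block. -/
def blockEmb {m : ℕ → ℕ} (σ : (Σ j, Fin (m j)) ↪ N) (j : ℕ) : Fin (m j) ↪ N :=
  (Function.Embedding.sigmaMk j).trans σ

theorem blockEmb_apply {m : ℕ → ℕ} (σ : (Σ j, Fin (m j)) ↪ N) (j : ℕ) (p : Fin (m j)) :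
    blockEmb σ j p = σ ⟨j, p⟩ := rfl

/-- The coordinates of the block diagonal operator with blocks `B j` along the injection `σ`. -/
def blockDiagFun {m : ℕ → ℕ} (σ : (Σ j, Fin (m j)) ↪ N)
    (B : ∀ j, PiLp 2 (fun _ : Fin (m j) => H) →L[ℂ] PiLp 2 (fun _ : Fin (m j) => H))
    (ξ : L2Sum N H) (k : N) : H :=
  if h : ∃ c, σ c = k then B h.choose.1 (finProj (blockEmb σ h.choose.1) ξ) h.choose.2 else 0

theorem blockDiagFun_apply {m : ℕ → ℕ} (σ : (Σ j, Fin (m j)) ↪ N)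
    (B : ∀ j, PiLp 2 (fun _ : Fin (m j) => H) →L[ℂ] PiLp 2 (fun _ : Fin (m j) => H))
    (ξ : L2Sum N H) (c : Σ j, Fin (m j)) :
    blockDiagFun σ B ξ (σ c) = B c.1 (finProj (blockEmb σ c.1) ξ) c.2 := by
  have h : ∃ c', σ c' = σ c := ⟨c, rfl⟩
  have h2 : h.choose = c := σ.injective h.choose_spec
  rw [blockDiagFun, dif_pos h, h2]

theorem sum_norm_sq_blockDiagFun_le {m : ℕ → ℕ} (σ : (Σ j, Fin (m j)) ↪ N)
    {B : ∀ j, PiLp 2 (fun _ : Fin (m j) => H) →L[ℂ] PiLp 2 (fun _ : Fin (m j) => H)}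
    (hB : ∀ j, ‖B j‖ ≤ 1) (ξ : L2Sum N H) (s : Finset N) :
    ∑ k ∈ s, ‖blockDiagFun σ B ξ k‖ ^ 2 ≤ ‖ξ‖ ^ 2 := by
  let J : Finset ℕ := (s.preimage σ σ.injective.injOn).image Sigma.fst
  let A : Finset (Σ j, Fin (m j)) := J.sigma fun _ => Finset.univ
  have h1 : ∑ k ∈ s, ‖blockDiagFun σ B ξ k‖ ^ 2 ≤
      ∑ c ∈ A, ‖blockDiagFun σ B ξ (σ c)‖ ^ 2 := by
    rw [← Finset.sum_map A σ fun k => ‖blockDiagFun σ B ξ k‖ ^ 2]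
    rw [← Finset.sum_filter_ne_zero]
    refine Finset.sum_le_sum_of_subset_of_nonneg (fun k hk' => ?_) fun _ _ _ => sq_nonneg _
    obtain ⟨hk, hne⟩ := Finset.mem_filter.1 hk'
    have h : ∃ c, σ c = k := by
      by_contra h
      rw [blockDiagFun, dif_neg h, norm_zero] at hne
      exact hne (by norm_num)
    obtain ⟨c, rfl⟩ := h
    refine Finset.mem_map_of_mem σ (Finset.mem_sigma.2 ⟨?_, Finset.mem_univ _⟩)
    exact Finset.mem_image_of_mem _ (Finset.mem_preimage.2 hk)
  refine h1.trans ?_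
  have h2 := sum_norm_sq_le ξ (A.map σ)
  rw [Finset.sum_map] at h2
  refine le_trans ?_ h2
  rw [Finset.sum_sigma, Finset.sum_sigma]
  refine Finset.sum_le_sum fun j _ => ?_
  simp only [blockDiagFun_apply]
  have h3 := (B j).le_opNorm (finProj (blockEmb σ j) ξ)
  have h4 := h3.trans (mul_le_of_le_one_left (norm_nonneg _) (hB j))
  rw [← sq_le_sq₀ (norm_nonneg _) (norm_nonneg _), PiLp.norm_sq_eq_of_L2,
    PiLp.norm_sq_eq_of_L2] at h4
  exact h4

/-- The block diagonal operator with contractive blocks `B j` along an injection `σ`. -/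
def blockDiagOp {m : ℕ → ℕ} (σ : (Σ j, Fin (m j)) ↪ N)
    (B : ∀ j, PiLp 2 (fun _ : Fin (m j) => H) →L[ℂ] PiLp 2 (fun _ : Fin (m j) => H))
    (hB : ∀ j, ‖B j‖ ≤ 1) : L2Sum N H →L[ℂ] L2Sum N H :=
  LinearMap.mkContinuous
    { toFun := fun ξ => ⟨blockDiagFun σ B ξ, memℓp_gen' (C := ‖ξ‖ ^ 2) fun s => by
        simpa using sum_norm_sq_blockDiagFun_le σ hB ξ s⟩
      map_add' := fun ξ η => by
        ext k
        change blockDiagFun σ B (ξ + η) k = blockDiagFun σ B ξ k + blockDiagFun σ B η k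
        simp only [blockDiagFun]
        split_ifs <;> simp
      map_smul' := fun c ξ => by
        ext k
        change blockDiagFun σ B (c • ξ) k = c • blockDiagFun σ B ξ k
        simp only [blockDiagFun]
        split_ifs <;> simp } 1
    (fun ξ => by
      rw [one_mul]
      refine lp.norm_le_of_forall_sum_le (by norm_num) (norm_nonneg _) fun s => ?_
      simpa using sum_norm_sq_blockDiagFun_le σ hB ξ s)

theorem norm_blockDiagOp_le {m : ℕ → ℕ} (σ : (Σ j, Fin (m j)) ↪ N)
    {B : ∀ j, PiLp 2 (fun _ : Fin (m j) => H) →L[ℂ] PiLp 2 (fun _ : Fin (m j) => H)}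
    (hB : ∀ j, ‖B j‖ ≤ 1) : ‖blockDiagOp σ B hB‖ ≤ 1 :=
  LinearMap.mkContinuous_norm_le _ zero_le_one _

theorem blockDiagOp_apply {m : ℕ → ℕ} (σ : (Σ j, Fin (m j)) ↪ N)
    {B : ∀ j, PiLp 2 (fun _ : Fin (m j) => H) →L[ℂ] PiLp 2 (fun _ : Fin (m j) => H)}
    (hB : ∀ j, ‖B j‖ ≤ 1) (ξ : L2Sum N H) (k : N) :
    blockDiagOp σ B hB ξ k = blockDiagFun σ B ξ k := rfl

/-- The entries of the block diagonal matrix with blocks `a j` along the injection `σ`. -/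
def blockDiagEntry {V : Type*} [Zero V] {m : ℕ → ℕ} (σ : (Σ j, Fin (m j)) ↪ N)
    (a : ∀ j, Matrix (Fin (m j)) (Fin (m j)) V) (k l : N) : V :=
  if h : ∃ j, ∃ p q : Fin (m j), σ ⟨j, p⟩ = k ∧ σ ⟨j, q⟩ = l then
    a h.choose h.choose_spec.choose h.choose_spec.choose_spec.choose else 0

theorem blockDiagEntry_apply {V : Type*} [Zero V] {m : ℕ → ℕ} (σ : (Σ j, Fin (m j)) ↪ N)
    (a : ∀ j, Matrix (Fin (m j)) (Fin (m j)) V) (j : ℕ) (p q : Fin (m j)) :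
    blockDiagEntry σ a (σ ⟨j, p⟩) (σ ⟨j, q⟩) = a j p q := by
  have h : ∃ j', ∃ p' q' : Fin (m j'), σ ⟨j', p'⟩ = σ ⟨j, p⟩ ∧ σ ⟨j', q'⟩ = σ ⟨j, q⟩ :=
    ⟨j, p, q, rfl, rfl⟩
  rw [blockDiagEntry, dif_pos h]
  have h1 := σ.injective h.choose_spec.choose_spec.choose_spec.1
  have h2 := σ.injective h.choose_spec.choose_spec.choose_spec.2
  generalize h.choose_spec.choose_spec.choose = q' at *
  generalize h.choose_spec.choose = p' at *
  generalize h.choose = j' at *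
  obtain ⟨rfl, hp⟩ := Sigma.mk.inj_iff.1 h1
  obtain ⟨-, hq⟩ := Sigma.mk.inj_iff.1 h2
  rw [eq_of_heq hp, eq_of_heq hq]

/-- The support of the `l`-th column of a block diagonal matrix. -/
def blockDiagSupport {m : ℕ → ℕ} (σ : (Σ j, Fin (m j)) ↪ N) (l : N) : Finset N :=
  if h : ∃ c, σ c = l then Finset.univ.map (blockEmb σ h.choose.1) else ∅

theorem blockDiagSupport_apply {m : ℕ → ℕ} (σ : (Σ j, Fin (m j)) ↪ N) (c : Σ j, Fin (m j)) :
    blockDiagSupport σ (σ c) = Finset.univ.map (blockEmb σ c.1) := by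
  have h : ∃ c', σ c' = σ c := ⟨c, rfl⟩
  have h2 : h.choose = c := σ.injective h.choose_spec
  rw [blockDiagSupport, dif_pos h, h2]

theorem finProj_blockEmb_single_of_ne {m : ℕ → ℕ} (σ : (Σ j, Fin (m j)) ↪ N) {j : ℕ} {l : N}
    (h : ∀ p, σ ⟨j, p⟩ ≠ l) (ζ : H) :
    finProj (blockEmb σ j) (lp.single 2 l ζ : L2Sum N H) = 0 := by
  refine PiLp.ext fun p => ?_
  rw [finProj_apply, coord_single, blockEmb_apply, if_neg (h p)]
  rfl

/-- The columns of a block diagonal operator. -/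
theorem blockDiagOp_single {m : ℕ → ℕ} (σ : (Σ j, Fin (m j)) ↪ N)
    {V : Type*} [Zero V] (a : ∀ j, Matrix (Fin (m j)) (Fin (m j)) V) (ρ : V → (H →L[ℂ] H))
    (hB : ∀ j, ‖blockOp ((a j).map ρ)‖ ≤ 1) (l : N) (ζ : H) :
    blockDiagOp σ (fun j => blockOp ((a j).map ρ)) hB (lp.single 2 l ζ) =
      ∑ k ∈ blockDiagSupport σ l, lp.single 2 k (ρ (blockDiagEntry σ a k l) ζ) := by
  refine lp.ext (funext fun k => ?_)
  rw [blockDiagOp_apply, lp.coeFn_sum, Finset.sum_apply]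
  by_cases hl : ∃ c, σ c = l
  · obtain ⟨⟨j, q⟩, rfl⟩ := hl
    rw [blockDiagSupport_apply, Finset.sum_map]
    simp only [coord_single, blockEmb_apply, blockDiagEntry_apply]
    by_cases hk : ∃ c, σ c = k
    · obtain ⟨⟨i, p⟩, rfl⟩ := hk
      rw [blockDiagFun_apply]
      simp only [σ.injective.eq_iff]
      by_cases hij : i = j
      · subst hij
        simp only [Sigma.mk.inj_iff, heq_eq_eq, true_and, Finset.sum_ite_eq, Finset.mem_univ,
          if_true]
        rw [blockOp_apply]
        simp only [finProj_apply, blockEmb_apply, coord_single, σ.injective.eq_iff,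
          Sigma.mk.inj_iff, heq_eq_eq, true_and]
        rw [Finset.sum_eq_single q]
        · rw [if_pos rfl]; rfl
        · intro b _ hb
          rw [if_neg hb, map_zero]
        · intro h; exact absurd (Finset.mem_univ q) h
      · rw [finProj_blockEmb_single_of_ne, map_zero, Finset.sum_eq_zero]
        · rfl
        · intro p' _
          rw [if_neg]
          intro h
          exact hij (Sigma.mk.inj_iff.1 h).1
        · intro p' h
          exact hij (Sigma.mk.inj_iff.1 (σ.injective h)).1
    · rw [blockDiagFun, dif_neg hk, Finset.sum_eq_zero]
      intro p _
      rw [if_neg]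
      rintro rfl
      exact hk ⟨_, rfl⟩
  · rw [blockDiagSupport, dif_neg hl, Finset.sum_empty, blockDiagFun]
    split_ifs with hk
    · rw [finProj_blockEmb_single_of_ne, map_zero]
      · rfl
      · intro p h
        exact hl ⟨_, h⟩
    · rfl

theorem blockDiagOp_single_coord {m : ℕ → ℕ} (σ : (Σ j, Fin (m j)) ↪ N)
    {V : Type*} [Zero V] (a : ∀ j, Matrix (Fin (m j)) (Fin (m j)) V) (ρ : V → (H →L[ℂ] H))
    (hB : ∀ j, ‖blockOp ((a j).map ρ)‖ ≤ 1) (j : ℕ) (p q : Fin (m j)) (ζ : H) :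
    blockDiagOp σ (fun j => blockOp ((a j).map ρ)) hB (lp.single 2 (blockEmb σ j q) ζ)
      (blockEmb σ j p) = ρ (a j p q) ζ := by
  rw [blockDiagOp_single, blockEmb_apply σ j q, blockDiagSupport_apply, Finset.sum_map,
    lp.coeFn_sum, Finset.sum_apply, Finset.sum_eq_single p]
  · rw [coord_single, if_pos rfl, blockEmb_apply, blockDiagEntry_apply]
  · intro p' _ hp'
    rw [coord_single, if_neg fun h => hp' ((blockEmb σ j).injective h).symm]
  · intro hp; exact absurd (Finset.mem_univ p) hp

end BlockDiagonal

/-! ### From linear extensions to complete isomorphism -/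

section LinearExtension
open scoped Classical

variable {F : Type u} [NormedAddCommGroup F] [NormedSpace ℂ F] [OperatorSpace F]
variable {κ : Cardinal.{v}} {K : NCSet F κ} {N : Type w}

omit [OperatorSpace F] in
/-- The entries of a weak* continuous map `E → M_N` are evaluations at elements of `F`. -/
theorem IsWeakStarContinuous.exists_entries {Ψ : StrongDual ℂ F →ₗ[ℂ] (L2 N →L[ℂ] L2 N)}
    (hΨ : IsWeakStarContinuous Ψ) :
    ∃ ψ : Matrix N N F, ∀ g k l, Ψ g (stdVec l) k = g (ψ k l) := by
  have h : ∀ k l, ∃ φ : F, ∀ g : StrongDual ℂ F, Ψ g (stdVec l) k = g φ := by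
    intro k l
    have hc : Continuous fun g : WeakDual ℂ F =>
        ⟪(stdVec k : L2 N), Ψ (WeakDual.toStrongDual g) (stdVec l)⟫_ℂ :=
      continuous_opWeakStar_iff.1 hΨ _ (vecFunctional_mem_opPredual _ _)
    let ω : StrongDual ℂ (WeakDual ℂ F) :=
      { toFun := fun g => ⟪(stdVec k : L2 N), Ψ (WeakDual.toStrongDual g) (stdVec l)⟫_ℂ
        map_add' := fun g h => by rw [map_add, map_add, add_apply, inner_add_right]
        map_smul' := fun c g => by
          rw [map_smul, map_smul, smul_apply, inner_smul_right]; rfl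
        cont := hc }
    obtain ⟨φ, hφ⟩ := LinearMap.dualEmbedding_surjective (topDualPairing ℂ F) ω
    refine ⟨φ, fun g => ?_⟩
    have h1 := DFunLike.congr_fun hφ (StrongDual.toWeakDual g)
    exact (inner_stdVec_left k _).symm.trans h1.symm
  choose ψ hψ using h
  exact ⟨ψ, fun g k l => hψ k l g⟩

theorem IsLinearExtension.isMatrixExtension
    {f : ∀ n : Level κ, K n → (L2Sum N (L2 n.1) →L[ℂ] L2Sum N (L2 n.1))} {ψ : Matrix N N F}
    {Ψ : StrongDual ℂ F →ₗ[ℂ] (L2 N →L[ℂ] L2 N)} (hf : IsLinearExtension K f Ψ)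
    (hΨ : ∀ g k l, Ψ g (stdVec l) k = g (ψ k l)) : IsMatrixExtension K f ψ := by
  intro n x k l ξ
  have h : coordCLM (L2 n.1) k ∘L f n x ∘L inclCLM (L2 n.1) l = x.1.1 (ψ k l) := by
    refine clm_ext_stdVec fun j => lp.ext (funext fun i => ?_)
    have h1 := hf n x i j k l
    rw [inner_stdVec_left, inner_stdVec_left, hΨ, entry_apply, inner_stdVec_left] at h1
    exact h1
  exact DFunLike.congr_fun h ξ

/-- A continuous nc affine function `g`, placed at the matrix position `(k, k)`. -/
theorem isMatAff_diagonal (g : Aff K) (k : N) :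
    IsMatAff K N fun n x => inclCLM (L2 n.1) k ∘L g.1 n x ∘L coordCLM (L2 n.1) k := by
  refine ⟨fun n m α x y hα hb hd ξ => ?_, fun n m β hβ x y hxy => ?_, fun n => ?_⟩
  · have h1 := (g.2.1 n m α x y hα hb hd (ξ k)).mapL (inclCLM (L2 n.1) k)
    convert h1 using 1
    · funext i
      exact ampl_single _ _ _
    · rfl
  · rw [g.2.2.1 n m β hβ x y hxy]
    refine ContinuousLinearMap.ext fun ξ => ?_
    exact (ampl_single (ContinuousLinearMap.adjoint β) k (g.1 n x (β (ξ k)))).symm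
  · exact @Continuous.comp _ _ _ (levelTop K n) (opWeakStar (L2 n.1))
      (opWeakStar (L2Sum N (L2 n.1))) _ _
      (continuous_opWeakStar_comp (inclCLM (L2 n.1) k) (coordCLM (L2 n.1) k)) (g.2.2.2 n)

/-- Extending functions supported at one matrix position shows that restriction is onto. -/
theorem restrict_surjective_of_matrixExtension [Nonempty N]
    (h : ∀ f, IsMatAff K N f → ∃ ψ : Matrix N N F, IsMatrixExtension K f ψ) :
    Function.Surjective (restrict K) := by
  intro g
  obtain ⟨k⟩ := ‹Nonempty N›
  obtain ⟨ψ, hψ⟩ := h _ (isMatAff_diagonal g k)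
  refine ⟨ψ k k, Subtype.ext (funext fun n => funext fun x => ?_)⟩
  refine ContinuousLinearMap.ext fun ξ => ?_
  have h1 := hψ n x k k ξ
  change x.1.1 (ψ k k) ξ = g.1 n x ξ
  rw [← h1]
  change (lp.single 2 k (g.1 n x ((lp.single 2 k ξ : L2Sum N (L2 n.1)) k)) :
    L2Sum N (L2 n.1)) k = _
  rw [coord_single, if_pos rfl, coord_single, if_pos rfl]

/-- The block diagonal function with blocks `a j` in the unit balls of `M_{m j}(𝔸(K))` is a
continuous nc affine function. -/
theorem isMatAff_blockDiag {m : ℕ → ℕ} (σ : (Σ j, Fin (m j)) ↪ N)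
    (a : ∀ j, Matrix (Fin (m j)) (Fin (m j)) (Aff K))
    (ha : ∀ (n : Level κ) (x : K n) j, ‖blockOp ((a j).map fun g => g.1 n x)‖ ≤ 1) :
    IsMatAff K N fun n x => blockDiagOp σ (fun j => blockOp ((a j).map fun g => g.1 n x))
      (ha n x) :=
  isMatAff_of_columns zero_le_one (fun n x => norm_blockDiagOp_le σ (ha n x))
    (blockDiagSupport σ) (blockDiagEntry σ a) fun n x l ζ =>
      blockDiagOp_single σ a (fun g => g.1 n x) (ha n x) l ζ

/-- A matrix over `F` restricting to a block diagonal function has blocks restricting to the given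
blocks. -/
theorem IsMatrixExtension.restrict_entry_blockDiag {m : ℕ → ℕ} (σ : (Σ j, Fin (m j)) ↪ N)
    (a : ∀ j, Matrix (Fin (m j)) (Fin (m j)) (Aff K))
    (ha : ∀ (n : Level κ) (x : K n) j, ‖blockOp ((a j).map fun g => g.1 n x)‖ ≤ 1)
    {ψ : Matrix N N F} (hψ : IsMatrixExtension K (fun n x => blockDiagOp σ
      (fun j => blockOp ((a j).map fun g => g.1 n x)) (ha n x)) ψ) (j : ℕ) (p q : Fin (m j)) :
    restrict K (ψ (blockEmb σ j p) (blockEmb σ j q)) = a j p q := by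
  refine Subtype.ext (funext fun n => funext fun x => ContinuousLinearMap.ext fun ξ => ?_)
  change x.1.1 (ψ (blockEmb σ j p) (blockEmb σ j q)) ξ = (a j p q).1 n x ξ
  rw [← hψ n x (blockEmb σ j p) (blockEmb σ j q) ξ]
  exact blockDiagOp_single_coord σ a (fun g => g.1 n x) (ha n x) j p q ξ

/-- Submatrices of the matrix of entries of a completely bounded map `E → M_N` are bounded, by
duality. -/
theorem mnorm_submatrix_le_of_isCB {ψ : Matrix N N F}
    {Ψ : StrongDual ℂ F →ₗ[ℂ] (L2 N →L[ℂ] L2 N)} (hΨ : ∀ g k l, Ψ g (stdVec l) k = g (ψ k l))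
    (hcb : IsCB (dualMatNorm F) (opMatNorm (L2 N)) Ψ) {r : ℕ} (e : Fin r ↪ N) :
    (OperatorSpace.mnorm r (ψ.submatrix e e)).toReal ≤
      2 * (cbNorm (dualMatNorm F) (opMatNorm (L2 N)) Ψ).toReal := by
  obtain ⟨X, hX, T, S, hT, hS, hTS⟩ := exists_dual_norming (ψ.submatrix e e)
  have h1 : ‖blockOp (X.map Ψ)‖ ≤ (cbNorm (dualMatNorm F) (opMatNorm (L2 N)) Ψ).toReal :=
    (ENNReal.ofReal_le_iff_le_toReal hcb.ne).1 (le_cbNorm Ψ hX)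
  let u : Fin r → PiLp 2 (fun _ : Fin r => ℂ) := fun i => WithLp.toLp 2 fun p => star (T i p)
  let v : Fin r → PiLp 2 (fun _ : Fin r => ℂ) := fun j => WithLp.toLp 2 fun q => S j q
  have h2 := inner_blockOp_map_finIncl hΨ e X u v
  have h3 : ∑ i, ∑ j, ∑ p, ∑ q, star (u i p) * v j q * X i j (ψ (e p) (e q)) =
      ((OperatorSpace.mnorm r (ψ.submatrix e e)).toReal : ℂ) := by
    rw [← hTS]
    calc _ = ∑ i, ∑ j, ∑ p, ∑ q, T i p * S j q * X i j (ψ (e p) (e q)) := by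
          simp only [u, v, star_star]
      _ = ∑ i, ∑ p, ∑ j, ∑ q, T i p * S j q * X i j (ψ (e p) (e q)) :=
          Finset.sum_congr rfl fun i _ => Finset.sum_comm
      _ = ∑ p, ∑ i, ∑ j, ∑ q, T i p * S j q * X i j (ψ (e p) (e q)) := Finset.sum_comm
      _ = ∑ p, ∑ i, ∑ q, ∑ j, T i p * S j q * X i j (ψ (e p) (e q)) :=
          Finset.sum_congr rfl fun p _ => Finset.sum_congr rfl fun i _ => Finset.sum_comm
      _ = ∑ p, ∑ q, ∑ i, ∑ j, T i p * S j q * X i j (ψ (e p) (e q)) :=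
          Finset.sum_congr rfl fun p _ => Finset.sum_comm
  have hu := norm_toLp_finIncl e u
  have hv := norm_toLp_finIncl e v
  have hu2 : ∑ i, ∑ p, ‖u i p‖ ^ 2 ≤ 2 := by simpa [u] using hT
  have hv2 : ∑ i, ∑ p, ‖v i p‖ ^ 2 ≤ 2 := by simpa [v] using hS
  rw [← hu] at hu2
  rw [← hv] at hv2
  set U : PiLp 2 (fun _ : Fin r => L2 N) := WithLp.toLp 2 fun i => finIncl e (u i)
  set V : PiLp 2 (fun _ : Fin r => L2 N) := WithLp.toLp 2 fun i => finIncl e (v i)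
  have h4 : (OperatorSpace.mnorm r (ψ.submatrix e e)).toReal = ‖⟪U, blockOp (X.map Ψ) V⟫_ℂ‖ := by
    rw [h2, h3, Complex.norm_real, Real.norm_of_nonneg ENNReal.toReal_nonneg]
  rw [h4]
  have h5 : ‖U‖ * ‖V‖ ≤ 2 := by nlinarith [sq_nonneg (‖U‖ - ‖V‖)]
  calc _ ≤ ‖U‖ * ‖blockOp (X.map Ψ) V‖ := norm_inner_le_norm _ _
    _ ≤ ‖U‖ * (‖blockOp (X.map Ψ)‖ * ‖V‖) :=
        mul_le_mul_of_nonneg_left (ContinuousLinearMap.le_opNorm _ _) (norm_nonneg _)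
    _ = (‖U‖ * ‖V‖) * ‖blockOp (X.map Ψ)‖ := by ring
    _ ≤ _ := mul_le_mul h5 h1 (ContinuousLinearMap.opNorm_nonneg _) zero_le_two

/-- Restriction is a complete isomorphism if functions `K → M_N` have linear extensions: countably
many witnesses for the failure of complete boundedness of `θ⁻¹` would be glued to a block diagonal
function `K → M_N` whose linear extension is not completely bounded. -/
theorem isCompleteIso_of_linearExtension [Infinite N] (hκ : Cardinal.aleph0 ≤ κ)
    (hK : IsNCCompactConvex K) (hspan : IsNCSpanning K)
    (h : ∀ f, IsMatAff K N f → ∃ Ψ : StrongDual ℂ F →ₗ[ℂ] (L2 N →L[ℂ] L2 N),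
      IsWeakStarContinuous Ψ ∧ IsCB (dualMatNorm F) (opMatNorm (L2 N)) Ψ ∧
        IsLinearExtension K f Ψ) :
    IsCompleteIso OperatorSpace.mnorm (affMatNorm K) (restrict K) := by
  have hinj := hspan.restrict_injective
  have hsurj : Function.Surjective (restrict K) :=
    restrict_surjective_of_matrixExtension fun f hf => by
      obtain ⟨Ψ, hw, -, he⟩ := h f hf
      obtain ⟨ψ, hψ⟩ := hw.exists_entries
      exact ⟨ψ, he.isMatrixExtension hψ⟩
  let e := LinearEquiv.ofBijective (restrict K) ⟨hinj, hsurj⟩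
  have he : (e : F →ₗ[ℂ] Aff K) = restrict K := LinearMap.ext fun _ => rfl
  obtain ⟨C, hC⟩ := hK.exists_affMatNorm_restrict_le hκ
  refine ⟨e, he, ?_, ?_⟩
  · rw [he]
    exact hC.trans_lt ENNReal.coe_lt_top
  by_contra hcb
  rw [IsCB, not_lt, top_le_iff] at hcb
  have hw : ∀ j : ℕ, ∃ (m : ℕ) (a : Matrix (Fin m) (Fin m) (Aff K)), affMatNorm K m a ≤ 1 ∧
      (j : ℝ≥0∞) < OperatorSpace.mnorm m (a.map (e.symm : Aff K →ₗ[ℂ] F)) := by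
    intro j
    have hj : (j : ℝ≥0∞) <
        cbNorm (affMatNorm K) OperatorSpace.mnorm (e.symm : Aff K →ₗ[ℂ] F) := by
      rw [hcb]; exact ENNReal.natCast_lt_top j
    simp only [cbNorm, lt_iSup_iff] at hj
    obtain ⟨m, a, ha, hj⟩ := hj
    exact ⟨m, a, ha, hj⟩
  choose m a ha hm using hw
  let σ : (Σ j, Fin (m j)) ↪ N := (Encodable.encode' _).trans (Infinite.natEmbedding N)
  have ha1 : ∀ (n : Level κ) (x : K n) j, ‖blockOp ((a j).map fun g => g.1 n x)‖ ≤ 1 := by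
    intro n x j
    rw [← ENNReal.ofReal_le_one]
    refine le_trans ?_ (ha j)
    rw [affMatNorm]
    refine le_iSup_of_le n ?_
    exact le_iSup_of_le x le_rfl
  obtain ⟨Ψ, hΨw, hΨcb, hΨe⟩ := h _ (isMatAff_blockDiag σ a ha1)
  obtain ⟨ψ, hψ⟩ := hΨw.exists_entries
  have hext := hΨe.isMatrixExtension hψ
  have hent : ∀ j, ψ.submatrix (blockEmb σ j) (blockEmb σ j) =
      (a j).map (e.symm : Aff K →ₗ[ℂ] F) := by
    intro j
    ext p q
    rw [Matrix.map_apply]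
    exact (e.symm_apply_eq.2 (hext.restrict_entry_blockDiag σ a ha1 j p q).symm).symm
  obtain ⟨j, hj⟩ := exists_nat_gt (2 * (cbNorm (dualMatNorm F) (opMatNorm (L2 N)) Ψ).toReal)
  have h1 := mnorm_submatrix_le_of_isCB hψ hΨcb (blockEmb σ j)
  rw [hent] at h1
  have h2 : (j : ℝ) < (OperatorSpace.mnorm _ ((a j).map (e.symm : Aff K →ₗ[ℂ] F))).toReal := by
    have h3 := (ENNReal.toReal_lt_toReal (ENNReal.natCast_ne_top j)
      (OperatorSpace.mnorm_ne_top _ _)).2 (hm j)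
    rwa [ENNReal.toReal_natCast] at h3
  linarith

end LinearExtension

end NCReg

end

theorem proposition3p3 {F : Type u} [NormedAddCommGroup F] [NormedSpace ℂ F] [CompleteSpace F]
    [NCReg.OperatorSpace F] (κ : Cardinal.{v}) (hκ : Cardinal.aleph0 ≤ κ)
    (K : NCReg.NCSet F κ) (hK : NCReg.IsNCCompactConvex K) (hspan : NCReg.IsNCSpanning K) :
    -- `θ` is completely bounded and injective
    (NCReg.IsCB NCReg.OperatorSpace.mnorm (NCReg.affMatNorm K) (NCReg.restrict K) ∧
      Function.Injective (NCReg.restrict K)) ∧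
    -- bicontinuity of `θ` is surjectivity at level 1
    (NCReg.IsBicontinuousIso NCReg.OperatorSpace.mnorm (NCReg.affMatNorm K) (NCReg.restrict K) ↔
      Function.Surjective (NCReg.restrict K)) ∧
    -- complete isomorphism means linear extension of `M_N`-valued functions, `N` infinite
    (∀ (N : Type w) [Infinite N],
      (NCReg.IsCompleteIso NCReg.OperatorSpace.mnorm (NCReg.affMatNorm K) (NCReg.restrict K) ↔
        ∀ f, NCReg.IsMatAff K N f →
          ∃ Ψ : StrongDual ℂ F →ₗ[ℂ] (NCReg.L2 N →L[ℂ] NCReg.L2 N),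
            NCReg.IsWeakStarContinuous Ψ ∧
            NCReg.IsCB (NCReg.dualMatNorm F) (NCReg.opMatNorm (NCReg.L2 N)) Ψ ∧
            NCReg.IsLinearExtension K f Ψ) ∧
      (NCReg.IsCompleteIso NCReg.OperatorSpace.mnorm (NCReg.affMatNorm K) (NCReg.restrict K) ↔
        ∀ f, NCReg.IsMatAff K N f →
          ∃ ψ : Matrix N N F, NCReg.IsBoundedMatrix ψ ∧ NCReg.IsMatrixExtension K f ψ)) := by
  obtain ⟨C, hC⟩ := hK.exists_affMatNorm_restrict_le hκ
  refine ⟨⟨hC.trans_lt ENNReal.coe_lt_top, hspan.restrict_injective⟩,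
    NCReg.isBicontinuousIso_restrict_iff hκ hK hspan, fun N _ => ?_⟩
  have hac : NCReg.IsCompleteIso NCReg.OperatorSpace.mnorm (NCReg.affMatNorm K)
      (NCReg.restrict K) → ∀ f, NCReg.IsMatAff K N f →
        ∃ ψ : Matrix N N F, NCReg.IsBoundedMatrix ψ ∧ NCReg.IsMatrixExtension K f ψ :=
    fun h f hf => NCReg.exists_matrixExtension_of_isCompleteIso hκ hK h hf
  have hcb : (∀ f, NCReg.IsMatAff K N f → ∃ ψ : Matrix N N F,
      NCReg.IsBoundedMatrix ψ ∧ NCReg.IsMatrixExtension K f ψ) →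
      ∀ f, NCReg.IsMatAff K N f → ∃ Ψ : StrongDual ℂ F →ₗ[ℂ] (NCReg.L2 N →L[ℂ] NCReg.L2 N),
        NCReg.IsWeakStarContinuous Ψ ∧
        NCReg.IsCB (NCReg.dualMatNorm F) (NCReg.opMatNorm (NCReg.L2 N)) Ψ ∧
        NCReg.IsLinearExtension K f Ψ := by
    intro h f hf
    obtain ⟨ψ, hψb, hψ⟩ := h f hf
    obtain ⟨Ψ, hΨ⟩ := hψ.exists_linearMap hspan
    exact ⟨Ψ, NCReg.isWeakStarContinuous_of_entries hΨ, NCReg.isCB_of_isBoundedMatrix hψb hΨ,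
      NCReg.isLinearExtension_of_entries hψ hΨ⟩
  have hba := NCReg.isCompleteIso_of_linearExtension (N := N) hκ hK hspan
  exact ⟨⟨fun h => hcb (hac h), hba⟩, ⟨hac, fun h => hba (hcb h)⟩⟩
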